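/- Let $p$ be an odd prime, $\mathbb{Z}_p=\mathbb{Z}/p\mathbb{Z}$, $\omega=e^{2\pi i/p}$, and let $\chi_p(x)=0$ if $x$ is a square in $\mathbb{Z}_p$ and $\chi_p(x)=1$ otherwise. **Diagrams.** Diagrams $n\to m$ ($n,m\in\mathbb{N}$) are built by sequential composition ($A;B$ means first $A$, then $B$) and tensor product $\otimes$ from the empty diagram, the wire, the swap, the cup $0\to2$, the cap $2\to0$, and the following generators. Green ($g$) and red ($r$): a multiplication $2\to 1$, a comultiplication $1\to 2$, units $\mathrm{un}_{g},\mathrm{un}_r(x,y):0\to 1$ and counits $\mathrm{co}_{g},\mathrm{co}_r(x,y):1\to0$ for $x,y\in\mathbb{Z}_p$; an unlabelled green vertex $1\to1$ and an unlabelled red vertex $a:1\to1$ (the antipode); the Hadamard $H:1\to1$; and a scalar $\star:0\to0$. Unlabelled green spiders $m\to n$ are obtained by iterating the green (co)multiplication, ending in the green $1 \to 1$ vertex, and with $\mathrm{co}_g(0,0)$ if $n=0$; unlabelled red spiders likewise, with antipodes between successive red vertices, the $1\to1$ red spider being $a$. The labelled spiders $G_m^n(x,y),R_m^n(x,y):m\to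 n$ plug $\mathrm{un}_g(x,y)$, respectively $\mathrm{un}_r(x,y);a$, into an extra input of the unlabelled spider. We write $G(x,y)=G_1^1(x,y)$ and $R(x,y)=R_1^1(x,y)$ (green and red phases). Scalars: $\Omega(x,z)=\mathrm{un}_g(x,0);\mathrm{co}_r(z,0)$, $\sqrt p=\Omega(0,0)$, $\Gamma(x,y)=\mathrm{un}_g(x,y);\mathrm{co}_g(0,0)$, and $1/\sqrt p=G_0^3(0,0);(a\otimes\mathrm{id}_2);R_3^0(0,0)$. Let $M_z=G_1^z(0,0);R_z^1(0,0)$ ($z\in\mathbb{N}$; a green and a red vertex joined by $z$ edges). Multipliers are defined inductively by $[0]=\tfrac1{\sqrt p}\otimes(\mathrm{co}_g(0,0);\mathrm{un}_r(0,0))$ and $[k+1]=\sqrt p\otimes(\text{green comultiplication};([k]\otimes\mathrm{id});\text{red multiplication};a)$; for $x\in\mathbb{Z}_p$, $[x]=[k]$ with $k\in\{0,\dots,p-1\}$ the representative of $x$. The $x$-weighted Hadamard is $[x];H$. **Equational theory $\mathrm{zx}_p$.** It is the smallest congruence satisfying the following. The diagrams form a strict self-dual compact closed symmetric monoidal category;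 every generator is flexsymmetric (after bending all its inputs to outputs it is invariant under permutations of its legs), and for each colour multiplication and comultiplication, and unit and counit with the same label, become equal after bending; an unlabelled $1\to1$ vertex equals the $1 \to 1$ spider of its colour labelled $(0,0)$; and, for all $a',b,c,d\in\mathbb{Z}_p$, $z\in\mathbb{Z}_p^*$ (a $z$ used as a number of edges or a power being its representative in $\{1,\dots,p-1\}$) and all $m,n,m',n'\in\mathbb{N}$: - (Fusion) $(G_m^{n+1}(a',b)\otimes\mathrm{id}_{m'});(\mathrm{id}_n\otimes G_{1+m'}^{n'}(c,d))=G_{m+m'}^{n+n'}(a'+c,b+d)$; - (Colour) $H^{\otimes m};G_m^n(a',b);H^{\otimes n}=R_m^n(-a',b)$; - (Shear) $\Omega(a',-c)\otimes(G(a',0);R(c,d);G(a',0))=\Omega(a',2^{-1}a'd)\otimes R(c+a'd,d)$; - (Char) $\sqrt p^{\otimes p}\otimes M_p=\mathrm{co}_g(0,0);\mathrm{un}_r(0,0)$; - (Bigebra) $\sqrt p^{\otimes 2}\otimes$ (two green comultiplications, swap of the two middle wires, two red multiplications) $=\sqrt p\otimes$ (red multiplication; green comultiplication); - (Copy) $\sqrt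 p\otimes(\mathrm{un}_r(a',0);\text{green comultiplication})=\mathrm{un}_r(a',0)\otimes\mathrm{un}_r(a',0)$; - (G-Elim), (R-Elim) the unlabelled green $1\to1$ vertex equals the wire, and $a;a=\mathrm{id}$; - (Mult) $\Gamma(0,z^{-1})\otimes\sqrt p^{\otimes z}\otimes(M_z;a)=\sqrt p^{\otimes2}\otimes(H;G(0,z^{-1});R(0,z);G(0,z^{-1}))$; - (Gauss) $\Gamma(0,z)=\star^{\otimes\chi_p(z)}\otimes\gamma_p$, where $\gamma_p=\star^{\otimes\chi_p(2)}\otimes\sqrt p$ if $p\equiv1\bmod4$ and $\gamma_p=\Gamma(0,1)$ if $p\equiv3\bmod4$; - (M-One) $\star\otimes\star$ is the empty diagram; - (M-Elim) $\sqrt p^{\otimes(z-1)}\otimes(M_z;\mathrm{co}_r(a',b))=\mathrm{co}_r(-a'z^{-1},bz^{-2})$; - (Zero) $\Gamma(z,0)\otimes\mathrm{id}=\Gamma(z,0)\otimes(\mathrm{co}_g(0,0);\mathrm{un}_g(0,0))$; - (One) $\sqrt p\otimes\tfrac1{\sqrt p}$ is the empty diagram. **Elementary scalars.** An elementary scalar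 is a tensor product of diagrams from the following list: the empty diagram, $\star$, $\sqrt p$, $1/\sqrt p$, $\Omega(s,1)\otimes\tfrac1{\sqrt p}$ with $s\in\mathbb{Z}_p^*$, and, if $p\equiv3\bmod4$, also $\iota=\Gamma(0,1)\otimes\tfrac1{\sqrt p}$ and $\star\otimes\iota$. Write $A\simeq B$ if $\mathrm{zx}_p$ proves $A=B\otimes C$ for some elementary scalar $C$. **Statement.** A single-qupit Clifford diagram is a sequential composite (possibly empty) of diagrams $R(x,y)$, $G(x,y)$ with $x,y\in\mathbb{Z}_p$, and $[w]$, $([w];H)$ with $w\in\mathbb{Z}_p^*$. Consider the normal forms $$[w];R(u,v);G(s,t)\qquad\text{and}\qquad [w];R(u,v);G(s,1);R(0,1)$$ with $s,t,u,v\in\mathbb{Z}_p$ and $w\in\mathbb{Z}_p^*$. For every single-qupit Clifford diagram $A$ there is exactly one normal form $N$ (one family and one choice of its parameters) such that $A\simeq N$. The number of normal forms is $p^3(p^2-1)$, and this is also the order of the reduced single-qupit Clifford group modulo its scalars. Here the reduced single-qupit Clifford group consists of the operators $\lambda U$ on $\mathbb{C}^{\mathbb{Z}_p}$ with $U$ special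 unitary and conjugating every Pauli operator $\omega^kX^aZ^b$ ($X|m\rangle=|m+1\rangle$, $Z|m\rangle=\omega^m|m\rangle$) to a Pauli operator, and $\lambda\in\mathbb{P}_p$, where $\mathbb{P}_p=\{(-1)^s\omega^t\mid s,t\in\mathbb{Z}\}$ if $p\equiv1\bmod4$ and $\mathbb{P}_p=\{i^s\omega^t\mid s,t\in\mathbb{Z}\}$ if $p\equiv3\bmod4$; its scalars are $\mathbb{P}_p$. -/

import Mathlib

namespace QupitZX

/-! ## Diagrams -/

/-- The generators of the calculus other than wires, cups, caps and swaps.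
`g` stands for green, `r` for red; units and counits carry a label `(x, y)`. -/
inductive Gen (p : ℕ) : ℕ → ℕ → Type
  | gId : Gen p 1 1
  | rInv : Gen p 1 1
  | had : Gen p 1 1
  | gUnit (x y : ZMod p) : Gen p 0 1
  | rUnit (x y : ZMod p) : Gen p 0 1
  | gCounit (x y : ZMod p) : Gen p 1 0
  | rCounit (x y : ZMod p) : Gen p 1 0
  | gMul : Gen p 2 1
  | rMul : Gen p 2 1
  | gComul : Gen p 1 2
  | rComul : Gen p 1 2
  | star : Gen p 0 0

/-- Diagrams `n → m`. In `seq A B` the diagram `A` comes first; the arities in the middle only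
have to be propositionally equal, so that no transport along `n + (m + k) = (n + m) + k` is
needed to compose diagrams. -/
inductive Diag (p : ℕ) : ℕ → ℕ → Type
  | gen {n m : ℕ} (g : Gen p n m) : Diag p n m
  | empty : Diag p 0 0
  | wire : Diag p 1 1
  | swap : Diag p 2 2
  | cup : Diag p 0 2
  | cap : Diag p 2 0
  | seq {n m m' k : ℕ} (A : Diag p n m) (B : Diag p m' k)
      (h : m = m' := by first | rfl | omega) : Diag p n k
  | tensor {n m n' m' : ℕ} (A : Diag p n m) (B : Diag p n' m') : Diag p (n + n') (m + m')

infixl:60 " ⨟ " => Diag.seq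
infixr:70 " ⊠ " => Diag.tensor

open Diag

section Sugar

variable {p : ℕ}

/-- Transport of a diagram along equalities of its arities. -/
def Diag.cast {n m n' m' : ℕ} (D : Diag p n m) (hn : n = n') (hm : m = m') : Diag p n' m' :=
  hn ▸ hm ▸ D

def gId : Diag p 1 1 := gen .gId
/-- The antipode, i.e. the unlabelled red `1 → 1` vertex. -/
def rInv : Diag p 1 1 := gen .rInv
def had : Diag p 1 1 := gen .had
def gUnit (x y : ZMod p) : Diag p 0 1 := gen (.gUnit x y)
def rUnit (x y : ZMod p) : Diag p 0 1 := gen (.rUnit x y)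
def gCounit (x y : ZMod p) : Diag p 1 0 := gen (.gCounit x y)
def rCounit (x y : ZMod p) : Diag p 1 0 := gen (.rCounit x y)
def gMul : Diag p 2 1 := gen .gMul
def rMul : Diag p 2 1 := gen .rMul
def gComul : Diag p 1 2 := gen .gComul
def rComul : Diag p 1 2 := gen .rComul
def star : Diag p 0 0 := gen .star

/-- `n` parallel wires. -/
def idn : (n : ℕ) → Diag p n n
  | 0 => empty
  | n + 1 => idn n ⊠ wire

/-- `n` parallel Hadamards. -/
def hads : (n : ℕ) → Diag p n n
  | 0 => empty
  | n + 1 => hads n ⊠ had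

/-- The `k`-fold tensor power of a scalar. -/
def spow (D : Diag p 0 0) : ℕ → Diag p 0 0
  | 0 => empty
  | k + 1 => spow D k ⊠ D

/-- The symmetry moving one wire from the right of `n` wires to their left. -/
def braid : (n : ℕ) → Diag p (n + 1) (1 + n)
  | 0 => wire
  | n + 1 =>
    (idn n ⊠ swap : Diag p (n + 2) (n + 2)) ⨟ (braid n ⊠ wire : Diag p (n + 1 + 1) (1 + n + 1))

/-- `n` nested cups. -/
def cups : (n : ℕ) → Diag p 0 (n + n)
  | 0 => empty
  | n + 1 => (cups n ⨟ (idn n ⊠ (cup ⊠ idn n))).cast rfl (by omega)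

/-- The state `0 → n + m` obtained from `D : n → m` by bending its inputs into outputs. -/
def bend {n m : ℕ} (D : Diag p n m) : Diag p 0 (n + m) := cups n ⨟ (idn n ⊠ D)

/-- Diagrams made of wires and swaps only, i.e. permutations of wires. -/
inductive IsPerm : {n : ℕ} → Diag p n n → Prop
  | idn (n : ℕ) : IsPerm (idn n)
  | swap : IsPerm swap
  | seq {n : ℕ} {A B : Diag p n n} : IsPerm A → IsPerm B → IsPerm (A ⨟ B)
  | tensor {n m : ℕ} {A : Diag p n n} {B : Diag p m m} : IsPerm A → IsPerm B → IsPerm (A ⊠ B)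

/-! ### Spiders -/

/-- The unlabelled green `m + 1 → 1` spider. -/
def gMerge : (m : ℕ) → Diag p (m + 1) 1
  | 0 => gId
  | m + 1 => (gMerge m ⊠ wire) ⨟ gMul

/-- The unlabelled green `1 → n + 1` spider. -/
def gSplitSucc : (n : ℕ) → Diag p 1 (n + 1)
  | 0 => gId
  | n + 1 => gComul ⨟ (gSplitSucc n ⊠ wire)

/-- The unlabelled green `1 → n` spider. -/
def gSplit : (n : ℕ) → Diag p 1 n
  | 0 => gCounit 0 0
  | n + 1 => gSplitSucc n

/-- The green `m → n` spider with label `(x, y)`: the label is a unit plugged into an extra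
input wire. -/
def green (m n : ℕ) (x y : ZMod p) : Diag p m n :=
  (idn m ⊠ gUnit x y) ⨟ gMerge m ⨟ gSplit n

/-- The unlabelled red `m + 1 → 1` spider: successive vertices are joined by antipodes. -/
def rMerge : (m : ℕ) → Diag p (m + 1) 1
  | 0 => rInv
  | m + 1 => ((rMerge m ⨟ rInv) ⊠ wire) ⨟ rMul

/-- The unlabelled red `1 → n + 1` spider. -/
def rSplitSucc : (n : ℕ) → Diag p 1 (n + 1)
  | 0 => rInv
  | n + 1 => rComul ⨟ ((rInv ⨟ rSplitSucc n) ⊠ wire)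

/-- The unlabelled red `1 → n` spider. -/
def rSplit : (n : ℕ) → Diag p 1 n
  | 0 => rCounit 0 0
  | n + 1 => rSplitSucc n

/-- The red `m → n` spider with label `(x, y)`. Its interpretation is
`∑ k, ω ^ (2⁻¹ (x k + y k ^ 2)) |-k : X⟩^{⊗ n} ⟨k : X|^{⊗ m}`. -/
def red (m n : ℕ) (x y : ZMod p) : Diag p m n :=
  (idn m ⊠ (rUnit x y ⨟ rInv)) ⨟ rMerge m ⨟ rInv ⨟ rSplit n

/-! ### Scalars -/

/-- The green dot with label `(x, y)`, of value `∑ k, ω ^ (2⁻¹ (x k + y k ^ 2))`. -/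
def gDot (x y : ZMod p) : Diag p 0 0 := gUnit x y ⨟ gCounit 0 0

/-- A green and a red Pauli dot joined by a wire, of value `√p ω ^ (2⁻² x z)`. -/
def omegaDot (x z : ZMod p) : Diag p 0 0 := gUnit x 0 ⨟ rCounit z 0

/-- The scalar `√p`. -/
def sqrtP : Diag p 0 0 := gUnit 0 0 ⨟ rCounit 0 0

/-- The scalar `1 / √p`: a green and a red vertex joined by three edges, one of which carries an
antipode. -/
def sqrtPInv : Diag p 0 0 := green 0 3 0 0 ⨟ (rInv ⊠ idn 2) ⨟ red 3 0 0 0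

/-! ### Multipliers and weighted Hadamards -/

/-- A green vertex joined to a red vertex by `z` parallel edges. -/
def multiEdge (z : ℕ) : Diag p 1 1 := green 1 z 0 0 ⨟ red z 1 0 0

/-- Multipliers with natural number labels (interpretation `|j⟩ ↦ |m j⟩`). -/
def natMult : ℕ → Diag p 1 1
  | 0 => sqrtPInv ⊠ (gCounit 0 0 ⨟ rUnit 0 0)
  | m + 1 => sqrtP ⊠ (gComul ⨟ (natMult m ⊠ wire) ⨟ rMul ⨟ rInv)

def mult (x : ZMod p) : Diag p 1 1 := natMult x.val

/-- The weighted Hadamard (interpretation `|j⟩ ↦ |x j : X⟩`). -/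
def hbox (x : ZMod p) : Diag p 1 1 := mult x ⨟ had

/-- The characteristic function of the set of non-squares. -/
noncomputable def chi (x : ZMod p) : ℕ :=
  open Classical in if IsSquare x then 0 else 1

/-- The value of the quadratic Gauss sum `∑ k, ω ^ (2⁻¹ k ^ 2)`: it is `√p (-1) ^ chi 2` if
`p ≡ 1 mod 4`, while it is `±i √p`, and represented by the green dot itself, otherwise. -/
noncomputable def gaussUnit : Diag p 0 0 :=
  if p % 4 = 1 then spow star (chi (2 : ZMod p)) ⊠ sqrtP else gDot 0 1

end Sugar

/-! ## The equational theory -/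

/-- Provable equality of diagrams. The relation is stated between diagrams of a priori different
arities, but it only relates diagrams `n → m` and `n' → m'` with `n = n'` and `m = m'`. -/
inductive Derives (p : ℕ) [Fact p.Prime] :
    {n m n' m' : ℕ} → Diag p n m → Diag p n' m' → Prop
  -- congruence
  | refl {n m : ℕ} (A : Diag p n m) : Derives p A A
  | symm {n m n' m' : ℕ} {A : Diag p n m} {B : Diag p n' m'} : Derives p A B → Derives p B A
  | trans {n m n' m' n'' m'' : ℕ} {A : Diag p n m} {B : Diag p n' m'} {C : Diag p n'' m''} :
      Derives p A B → Derives p B C → Derives p A C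
  | seq {a b b' c a₁ b₁ b₁' c₁ : ℕ} {A : Diag p a b} {B : Diag p b' c} {A' : Diag p a₁ b₁}
      {B' : Diag p b₁' c₁} (h : b = b') (h' : b₁ = b₁') :
      Derives p A A' → Derives p B B' → Derives p (.seq A B h) (.seq A' B' h')
  | tensor {a b c d a₁ b₁ c₁ d₁ : ℕ} {A : Diag p a b} {B : Diag p c d} {A' : Diag p a₁ b₁}
      {B' : Diag p c₁ d₁} :
      Derives p A A' → Derives p B B' → Derives p (A ⊠ B) (A' ⊠ B')
  -- strict monoidal category
  | seqAssoc {a b b' c c' d : ℕ} (A : Diag p a b) (B : Diag p b' c) (C : Diag p c' d)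
      (h : b = b') (h' : c = c') :
      Derives p (.seq (.seq A B h) C h') (.seq A (.seq B C h') h)
  | idSeq {n m : ℕ} (A : Diag p n m) : Derives p (idn n ⨟ A) A
  | seqId {n m : ℕ} (A : Diag p n m) : Derives p (A ⨟ idn m) A
  | tensorAssoc {a b c d e f : ℕ} (A : Diag p a b) (B : Diag p c d) (C : Diag p e f) :
      Derives p ((A ⊠ B) ⊠ C) (A ⊠ (B ⊠ C))
  | emptyTensor {n m : ℕ} (A : Diag p n m) : Derives p (empty ⊠ A) A
  | tensorEmpty {n m : ℕ} (A : Diag p n m) : Derives p (A ⊠ empty) A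
  | interchange {a b b' c d e e' f : ℕ} (A : Diag p a b) (B : Diag p b' c) (C : Diag p d e)
      (D : Diag p e' f) (h : b = b') (h' : e = e') :
      Derives p (.seq A B h ⊠ .seq C D h') (.seq (A ⊠ C) (B ⊠ D) (by omega))
  -- symmetry
  | swapSwap : Derives p (swap ⨟ swap) (idn 2)
  | swapNat {n m : ℕ} (D : Diag p n m) :
      Derives p ((D ⊠ wire) ⨟ braid m) (braid n ⨟ (wire ⊠ D))
  -- self-dual compact closure
  | snake : Derives p ((cup ⊠ wire) ⨟ (wire ⊠ cap)) wire
  | snake' : Derives p ((wire ⊠ cup) ⨟ (cap ⊠ wire)) wire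
  | cupSwap : Derives p (cup ⨟ swap) cup
  | swapCap : Derives p (swap ⨟ cap) cap
  -- flexsymmetry: the legs of a generator can be permuted, and inputs can be bent into outputs
  | flex {n m k : ℕ} (g : Gen p n m) (σ : Diag p k k) (hσ : IsPerm σ) (h : n + m = k) :
      Derives p (.seq (bend (gen g)) σ h) (bend (gen g))
  | gBend : Derives p (bend gMul) (bend gComul)
  | rBend : Derives p (bend rMul) (bend rComul)
  | gUnitBend (x y : ZMod p) : Derives p (bend (gUnit x y)) (bend (gCounit x y))
  | rUnitBend (x y : ZMod p) : Derives p (bend (rUnit x y)) (bend (rCounit x y))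
  -- an unlabelled vertex is a vertex labelled by `(0, 0)`
  | gLabel : Derives p (green 1 1 0 0) gId
  | rLabel : Derives p (red 1 1 0 0) rInv
  -- (Fusion)
  | fusion (m n m' n' : ℕ) (a b c d : ZMod p) :
      Derives p ((green m (n + 1) a b ⊠ idn m') ⨟ (idn n ⊠ green (1 + m') n' c d))
        (green (m + m') (n + n') (a + c) (b + d))
  -- (Colour)
  | colour (m n : ℕ) (a b : ZMod p) :
      Derives p (hads m ⨟ green m n a b ⨟ hads n) (red m n (-a) b)
  -- (Shear)
  | shear (a c d : ZMod p) :
      Derives p (omegaDot a (-c) ⊠ (green 1 1 a 0 ⨟ red 1 1 c d ⨟ green 1 1 a 0))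
        (omegaDot a (2⁻¹ * a * d) ⊠ red 1 1 (c + a * d) d)
  -- (Char)
  | char : Derives p (spow sqrtP p ⊠ multiEdge p) (gCounit 0 0 ⨟ rUnit 0 0)
  -- (Bigebra)
  | bigebra :
      Derives p
        (spow sqrtP 2 ⊠ ((gComul ⊠ gComul) ⨟ (wire ⊠ (swap ⊠ wire)) ⨟ (rMul ⊠ rMul)))
        (sqrtP ⊠ (rMul ⨟ gComul))
  -- (Copy)
  | copy (a : ZMod p) :
      Derives p (sqrtP ⊠ (rUnit a 0 ⨟ gComul)) (rUnit a 0 ⊠ rUnit a 0)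
  -- (G-Elim), (R-Elim)
  | gElim : Derives p gId wire
  | rElim : Derives p (rInv ⨟ rInv) wire
  -- (Mult)
  | multRule (z : (ZMod p)ˣ) :
      Derives p
        (gDot 0 (z : ZMod p)⁻¹ ⊠ (spow sqrtP (z : ZMod p).val ⊠
          (multiEdge (z : ZMod p).val ⨟ rInv)))
        (spow sqrtP 2 ⊠ (had ⨟ green 1 1 0 (z : ZMod p)⁻¹ ⨟ red 1 1 0 z
          ⨟ green 1 1 0 (z : ZMod p)⁻¹))
  -- (Gauss)
  | gauss (z : (ZMod p)ˣ) :
      Derives p (gDot 0 (z : ZMod p)) (spow star (chi (z : ZMod p)) ⊠ gaussUnit)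
  -- (M-One)
  | mOne : Derives p (star ⊠ star) empty
  -- (M-Elim)
  | mElim (a b : ZMod p) (z : (ZMod p)ˣ) :
      Derives p
        (spow sqrtP ((z : ZMod p).val - 1) ⊠ (multiEdge (z : ZMod p).val ⨟ rCounit a b))
        (rCounit (-a * (z : ZMod p)⁻¹) (b * ((z : ZMod p)⁻¹) ^ 2))
  -- (Zero)
  | zero (z : (ZMod p)ˣ) :
      Derives p (gDot (z : ZMod p) 0 ⊠ wire) (gDot (z : ZMod p) 0 ⊠ (gCounit 0 0 ⨟ gUnit 0 0))
  -- (One)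
  | one : Derives p (sqrtP ⊠ sqrtPInv) empty

/-! ## Equality up to elementary scalars -/

section Elementary

variable (p : ℕ)

/-- The scalar `i` or `-i`, used when `p ≡ 3 mod 4`. -/
def imag : Diag p 0 0 := gDot 0 1 ⊠ sqrtPInv

/-- The sign scalars `O_p`. -/
def elemO : Set (Diag p 0 0) :=
  if p % 4 = 1 then {empty, star} else {empty, imag p, star, star ⊠ imag p}

/-- The scalars that are powers of `ω`. -/
def elemP : Set (Diag p 0 0) :=
  {D | D = empty ∨ ∃ s : (ZMod p)ˣ, D = omegaDot (s : ZMod p) 1 ⊠ sqrtPInv}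

/-- The scalars that generate the powers of `√p`. -/
def elemQ : Set (Diag p 0 0) := {sqrtP, empty, sqrtPInv}

/-- Elementary scalars: tensor products of diagrams from `elemO ∪ elemP ∪ elemQ`. -/
inductive IsElementary : Diag p 0 0 → Prop
  | base (D : Diag p 0 0) : D ∈ elemO p ∪ elemP p ∪ elemQ p → IsElementary D
  | tensor (D E : Diag p 0 0) : IsElementary D → IsElementary E → IsElementary (D ⊠ E)

/-- `A ≃ B`: the theory proves `A = B ⊗ C` for some elementary scalar `C`. -/
def EqUpToScalar [Fact p.Prime] {n m : ℕ} (A B : Diag p n m) : Prop :=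
  ∃ C : Diag p 0 0, IsElementary p C ∧ Derives p A (B ⊠ C)

end Elementary

/-! ## Single-qupit Clifford diagrams and their normal forms -/

/-- Single-qupit Clifford diagrams: sequential composites of red phases, green phases, (invertible)
multipliers and (invertibly) weighted Hadamards. -/
inductive IsC1 (p : ℕ) : Diag p 1 1 → Prop
  | wire : IsC1 p wire
  | redPhase (x y : ZMod p) : IsC1 p (red 1 1 x y)
  | greenPhase (x y : ZMod p) : IsC1 p (green 1 1 x y)
  | mult (w : (ZMod p)ˣ) : IsC1 p (mult (w : ZMod p))
  | hbox (w : (ZMod p)ˣ) : IsC1 p (hbox (w : ZMod p))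
  | seq (A B : Diag p 1 1) : IsC1 p A → IsC1 p B → IsC1 p (A ⨟ B)

/-- The parameters of the two families of normal forms. -/
inductive NormalForm (p : ℕ) : Type
  | first (s t u v : ZMod p) (w : (ZMod p)ˣ) : NormalForm p
  | second (s u v : ZMod p) (w : (ZMod p)ˣ) : NormalForm p

/-- The normal forms, read from input to output: a multiplier `w`, a red phase `(u, v)`, and then
either a green phase `(s, t)`, or a green phase `(s, 1)` followed by the red phase `(0, 1)`. -/
def NormalForm.toDiag {p : ℕ} : NormalForm p → Diag p 1 1
  | .first s t u v w => mult (w : ZMod p) ⨟ red 1 1 u v ⨟ green 1 1 s t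
  | .second s u v w => mult (w : ZMod p) ⨟ red 1 1 u v ⨟ green 1 1 s 1 ⨟ red 1 1 0 1

/-! ## The single-qupit Clifford group -/

section Clifford

variable (p : ℕ)

noncomputable def omega : ℂ := Complex.exp (2 * Real.pi * Complex.I / p)

/-- The shift operator `X |m⟩ = |m + 1⟩`. -/
def shiftX : Matrix (ZMod p) (ZMod p) ℂ := Matrix.of fun i j => if i = j + 1 then 1 else 0

/-- The clock operator `Z |m⟩ = ω ^ m |m⟩`. -/
noncomputable def clockZ : Matrix (ZMod p) (ZMod p) ℂ := Matrix.diagonal fun m => omega p ^ m.val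

/-- The group of phases `ℙ_p`. -/
def phases : Set ℂ :=
  if p % 4 = 1 then {c | ∃ s t : ℤ, c = (-1) ^ s * omega p ^ t}
  else {c | ∃ s t : ℤ, c = Complex.I ^ s * omega p ^ t}

variable [Fact p.Prime]

/-- Pauli operators `ω ^ k X ^ a Z ^ b`. -/
def IsPauli (P : Matrix (ZMod p) (ZMod p) ℂ) : Prop :=
  ∃ k a b : ℕ, P = omega p ^ k • (shiftX p ^ a * clockZ p ^ b)

/-- Clifford operators: unitaries that conjugate Pauli operators to Pauli operators. -/
def IsClifford (U : Matrix (ZMod p) (ZMod p) ℂ) : Prop :=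
  U ∈ Matrix.unitaryGroup (ZMod p) ℂ ∧ ∀ P, IsPauli p P → IsPauli p (U * P * U.conjTranspose)

/-- The reduced single-qupit Clifford group. -/
def reducedClifford : Set (Matrix (ZMod p) (ZMod p) ℂ) :=
  {V | ∃ c ∈ phases p, ∃ U, IsClifford p U ∧ U ∈ Matrix.specialUnitaryGroup (ZMod p) ℂ ∧
    V = c • U}

/-- The reduced single-qupit Clifford group modulo its scalars: the set of classes
`{c • U | c ∈ ℙ_p}` of its elements `U`. -/
def cliffordModScalars : Set (Set (Matrix (ZMod p) (ZMod p) ℂ)) :=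
  (fun U => {V | ∃ c ∈ phases p, V = c • U}) '' reducedClifford p

end Clifford

end QupitZX

/-! ### Diagrams modulo provable equality and invertible elementary scalars. -/

namespace QupitZX
open Diag

section Quotient

variable {p : ℕ} [Fact p.Prime]

/-! Existence of a normal form is a computation in a group. Call a scalar a phase if it is provably
elementary with a provably elementary inverse (`IsPhase`), and let `Cls` be the set of diagrams of
all arities modulo provable equality and phases. There `⋆`, `√p` and `1/√p` become 1 at once. The
`Ω(x,z)` become 1 because they behave like a bicharacter one of whose generating values is
elementary (`lam_eq_one`). The Gauss sums `Γ(0,z)` become 1 by (Gauss) and, when `p % 4 ≠ 1`, by a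
braid-type argument showing that the fourth power of `Γ(0,1)` is 1 (`dot_eq_one`).

In the units of the monoid `Endo` of `1 → 1` classes, (Mult) then reads as an Euler decomposition of
multipliers into Hadamards and quadratic phases (`mU_eq`). Together with (Shear), (M-Elim) and the
bigebra laws it yields the commutation rules of the affine group of `SL₂(ℤ_p)`: multipliers are
diagonal, red and green phases are the two kinds of shear with translations, and the Hadamard is the
Weyl element. Normal forms are a Bruhat decomposition of this group: products diagonal · red · green
form the big cell, and the rest is reached by one Hadamard. The set `IsNormal` contains 1 and is
stable under right multiplication by phases and Hadamards, hence by every Clifford diagram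
(`exists_normalForm`).

Uniqueness comes from a model that does not see elementary scalars. A diagram denotes an affine
relation between points (position, momentum) of phase space; all axioms hold in it
(`Derives.sem_iff`), elementary scalars denote the true relation, and the normal forms denote
pairwise distinct affine maps (`NormalForm.map_injective`).

The two families have `p⁴(p-1)` and `p³(p-1)` members. The order of the Clifford group is found
independently of diagrams: conjugation of `X` and `Z` attaches to a Clifford operator an affine
symplectic transformation. By Schur's lemma and a comparison of determinants, a special unitary
operator is determined by it up to a power of `ω`; conversely every transformation is realised by an
explicit operator (`exists_actsBy`). These transformations are in bijection with the normal form
parameters. -/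

instance {n m n' m' n'' m'' : ℕ} :
    Trans (Derives p : Diag p n m → Diag p n' m' → Prop)
      (Derives p : Diag p n' m' → Diag p n'' m'' → Prop)
      (Derives p : Diag p n m → Diag p n'' m'' → Prop) := ⟨Derives.trans⟩

namespace Derives

/-- Naturality of the symmetry for a diagram without legs: both braids involved are single wires and
drop out. -/
theorem scalar_wire (C : Diag p 0 0) : Derives p (C ⊠ wire) (wire ⊠ C) := by
  have e : Derives p (idn 1 : Diag p 1 1) wire := Derives.emptyTensor _
  have h := Derives.swapNat C
  refine .trans (.symm (.seqId (n := 0 + 1) (m := 0 + 1) _)) (.trans (.seq rfl rfl (.refl _) e) ?_)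
  refine .trans h ?_
  refine .trans (.seq rfl rfl (.symm e) (.refl _)) (.idSeq (n := 1) (m := 1) _)

theorem scalar_idn (C : Diag p 0 0) : ∀ n, Derives p (C ⊠ idn n) (idn n ⊠ C)
  | 0 => .trans (.tensorEmpty _) (.symm (.emptyTensor _))
  | n + 1 => calc
      Derives p _ _ := .symm (.tensorAssoc C (idn n) wire)
      Derives p _ _ := .tensor (scalar_idn C n) (.refl wire)
      Derives p _ _ := .tensorAssoc _ _ _
      Derives p _ _ := .tensor (.refl _) (scalar_wire C)
      Derives p _ _ := .symm (.tensorAssoc _ _ _)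

/-- By interchange the scalar only has to cross identity wires, after which it sits on the other
side. -/
theorem scalar_comm (C : Diag p 0 0) {n m : ℕ} (A : Diag p n m) : Derives p (C ⊠ A) (A ⊠ C) := by
  refine .trans (.tensor (.symm (.seqId C)) (.symm (.idSeq A))) ?_
  refine .trans (.interchange _ _ _ _ rfl rfl) ?_
  refine .trans (.seq (by omega) (by omega) (scalar_idn C n)
    (.trans (.emptyTensor A) (.symm (.tensorEmpty A)))) ?_
  refine .trans (.symm (.interchange _ _ _ _ rfl rfl)) ?_
  exact .tensor (.idSeq A) (.seqId C)

theorem scalar_seq {n m m' k : ℕ} (A : Diag p n m) (B : Diag p m' k) (C D : Diag p 0 0)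
    (h : m = m') :
    Derives p (.seq (A ⊠ C) (B ⊠ D) (by omega)) (.seq A B h ⊠ (C ⊠ D)) := by
  refine .trans (.symm (.interchange A B C D h rfl)) (.tensor (.refl _) ?_)
  refine .trans (.seq rfl rfl (.symm (.tensorEmpty C)) (.symm (.emptyTensor D))) ?_
  refine .trans (.symm (.interchange C empty empty D rfl rfl)) ?_
  exact .tensor (.seqId C) (.idSeq D)

theorem scalar_tensor {n m n' m' : ℕ} (A : Diag p n m) (B : Diag p n' m') (C D : Diag p 0 0) :
    Derives p ((A ⊠ C) ⊠ (B ⊠ D)) ((A ⊠ B) ⊠ (C ⊠ D)) := calc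
  Derives p _ _ := .tensorAssoc _ _ _
  Derives p _ _ := .tensor (.refl A) (.symm (.tensorAssoc C B D))
  Derives p _ _ := .tensor (.refl A) (.tensor (scalar_comm C B) (.refl D))
  Derives p _ _ := .tensor (.refl A) (.tensorAssoc B C D)
  Derives p _ _ := .symm (.tensorAssoc _ _ _)

end Derives

/-- Scalars that are provably elementary and have a provably elementary inverse. -/
def IsPhase (C : Diag p 0 0) : Prop :=
  ∃ E E' : Diag p 0 0, IsElementary p E ∧ IsElementary p E' ∧ Derives p C E ∧
    Derives p (E ⊠ E') empty

omit [Fact p.Prime] in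
theorem IsElementary.empty : IsElementary p empty := by
  refine .base _ (Or.inl (Or.inr (Or.inl rfl)))

theorem IsPhase.empty : IsPhase (empty : Diag p 0 0) :=
  ⟨_, _, .empty, .empty, .refl _, .tensorEmpty _⟩

theorem IsPhase.tensor {C D : Diag p 0 0} : IsPhase C → IsPhase D → IsPhase (C ⊠ D) := by
  rintro ⟨E, E', h1, h2, h3, h4⟩ ⟨F, F', g1, g2, g3, g4⟩
  refine ⟨E ⊠ F, E' ⊠ F', .tensor _ _ h1 g1, .tensor _ _ h2 g2, .tensor h3 g3, ?_⟩
  exact .trans (Derives.scalar_tensor E E' F F') (.trans (.tensor h4 g4) (.tensorEmpty _))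

theorem IsPhase.congr {C D : Diag p 0 0} (h : IsPhase C) (h' : Derives p C D) : IsPhase D := by
  obtain ⟨E, E', h1, h2, h3, h4⟩ := h
  exact ⟨E, E', h1, h2, .trans h'.symm h3, h4⟩

theorem IsPhase.inv {C : Diag p 0 0} (h : IsPhase C) :
    ∃ D : Diag p 0 0, IsPhase D ∧ Derives p (C ⊠ D) Diag.empty := by
  obtain ⟨E, E', h1, h2, h3, h4⟩ := h
  exact ⟨E', ⟨E', E, h2, h1, .refl _, .trans (.scalar_comm E' E) h4⟩,
    .trans (.tensor h3 (.refl _)) h4⟩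

/-- Provable equality up to phases. -/
def PhaseEq {n m n' m' : ℕ} (A : Diag p n m) (B : Diag p n' m') : Prop :=
  ∃ C : Diag p 0 0, IsPhase C ∧ Derives p A (B ⊠ C)

namespace PhaseEq

variable {n m n' m' n'' m'' k k' l l' : ℕ}

theorem of_derives {A : Diag p n m} {B : Diag p n' m'} (h : Derives p A B) : PhaseEq A B :=
  ⟨_, .empty, .trans h (.symm (.tensorEmpty B))⟩

theorem symm {A : Diag p n m} {B : Diag p n' m'} (h : PhaseEq A B) : PhaseEq B A := by
  obtain ⟨C, hC, h⟩ := h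
  obtain ⟨D, hD, h'⟩ := hC.inv
  refine ⟨D, hD, ?_⟩
  refine .trans ?_ (.tensor h.symm (.refl D))
  exact .trans (.trans (.symm (.tensorEmpty B)) (.tensor (.refl B) h'.symm))
    (.symm (.tensorAssoc B C D))

theorem trans {A : Diag p n m} {B : Diag p n' m'} {C : Diag p n'' m''} (h : PhaseEq A B)
    (h' : PhaseEq B C) : PhaseEq A C := by
  obtain ⟨D, hD, h⟩ := h
  obtain ⟨E, hE, h'⟩ := h'
  exact ⟨E ⊠ D, hE.tensor hD, .trans h (.trans (.tensor h' (.refl D)) (.tensorAssoc _ _ _))⟩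

theorem seq {A : Diag p n m} {B : Diag p m' k} {A' : Diag p n' l} {B' : Diag p l' k'}
    (h : m = m') (h' : l = l') (hA : PhaseEq A A') (hB : PhaseEq B B') :
    PhaseEq (.seq A B h) (.seq A' B' h') := by
  obtain ⟨C, hC, hA⟩ := hA
  obtain ⟨D, hD, hB⟩ := hB
  exact ⟨C ⊠ D, hC.tensor hD, .trans (.seq h (by omega) hA hB) (.scalar_seq A' B' C D h')⟩

theorem tensor {A : Diag p n m} {B : Diag p n' m'} {A' : Diag p k l} {B' : Diag p k' l'}
    (hA : PhaseEq A A') (hB : PhaseEq B B') : PhaseEq (A ⊠ B) (A' ⊠ B') := by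
  obtain ⟨C, hC, hA⟩ := hA
  obtain ⟨D, hD, hB⟩ := hB
  exact ⟨C ⊠ D, hC.tensor hD, .trans (.tensor hA hB) (.scalar_tensor A' B' C D)⟩

end PhaseEq

/-- Diagrams of arbitrary arities. -/
structure AnyDiag (p : ℕ) where
  dom : ℕ
  cod : ℕ
  diag : Diag p dom cod

variable (p) in
/-- Diagrams of arbitrary arities up to provable equality and phases. -/
instance anyDiagSetoid : Setoid (AnyDiag p) where
  r A B := A.dom = B.dom ∧ A.cod = B.cod ∧ PhaseEq A.diag B.diag
  iseqv := ⟨fun _ => ⟨rfl, rfl, .of_derives (.refl _)⟩,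
    fun h => ⟨h.1.symm, h.2.1.symm, h.2.2.symm⟩,
    fun h h' => ⟨h.1.trans h'.1, h.2.1.trans h'.2.1, h.2.2.trans h'.2.2⟩⟩

variable (p) in
/-- Classes of diagrams of arbitrary arities up to provable equality and phases. -/
def Cls : Type := Quotient (anyDiagSetoid p)

/-- The class of a diagram. -/
def cls {n m : ℕ} (A : Diag p n m) : Cls p := Quotient.mk _ ⟨n, m, A⟩

theorem cls_eq_cls_iff {n m : ℕ} {A B : Diag p n m} : cls A = cls B ↔ PhaseEq A B :=
  Quotient.eq.trans ⟨fun h => h.2.2, fun h => ⟨rfl, rfl, h⟩⟩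

theorem cls_eq_of_derives {n m n' m' : ℕ} {A : Diag p n m} {B : Diag p n' m'}
    (h : Derives p A B) (hn : n = n' := by first | rfl | omega)
    (hm : m = m' := by first | rfl | omega) : cls A = cls B :=
  Quotient.sound ⟨hn, hm, .of_derives h⟩

/-- Some diagram with the given arities. -/
def discard : (n : ℕ) → Diag p n 0
  | 0 => empty
  | n + 1 => discard n ⊠ gCounit 0 0

/-- Some diagram with the given arities. -/
def create : (n : ℕ) → Diag p 0 n
  | 0 => empty
  | n + 1 => create n ⊠ gUnit 0 0

open Classical in
/-- Sequential composition, with an arbitrary value if the arities do not match. -/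
def AnyDiag.seq (A B : AnyDiag p) : AnyDiag p :=
  if h : A.cod = B.dom then ⟨A.dom, B.cod, .seq A.diag B.diag h⟩
  else ⟨A.dom, B.cod, discard A.dom ⨟ create B.cod⟩

theorem AnyDiag.dom_seq (A B : AnyDiag p) : (A.seq B).dom = A.dom := by
  unfold AnyDiag.seq
  split_ifs <;> rfl

theorem AnyDiag.cod_seq (A B : AnyDiag p) : (A.seq B).cod = B.cod := by
  unfold AnyDiag.seq
  split_ifs <;> rfl

namespace Cls

/-- The number of inputs. -/
def dom : Cls p → ℕ := Quotient.lift AnyDiag.dom fun _ _ h => h.1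

/-- The number of outputs. -/
def cod : Cls p → ℕ := Quotient.lift AnyDiag.cod fun _ _ h => h.2.1

/-- Sequential composition, with an arbitrary value if the arities do not match. -/
def seq : Cls p → Cls p → Cls p :=
  Quotient.map₂ AnyDiag.seq <| by
    rintro ⟨n, m, A⟩ ⟨_, _, A'⟩ ⟨h1, h2, h3⟩ ⟨k, l, B⟩ ⟨_, _, B'⟩ ⟨h1', h2', h3'⟩
    dsimp only at *
    subst h1 h2 h1' h2'
    unfold AnyDiag.seq
    split_ifs with h
    · exact ⟨rfl, rfl, h3.seq _ _ h3'⟩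
    · exact ⟨rfl, rfl, .of_derives (.refl _)⟩

/-- The product is the tensor. With arities bundled, the strict associativity and unit laws are
plain equations, free of transports along sums of arities. -/
instance : Monoid (Cls p) where
  mul := Quotient.map₂ (fun A B => ⟨A.dom + B.dom, A.cod + B.cod, A.diag ⊠ B.diag⟩) <| by
    rintro ⟨n, m, A⟩ ⟨_, _, A'⟩ ⟨h1, h2, h3⟩ ⟨k, l, B⟩ ⟨_, _, B'⟩ ⟨h1', h2', h3'⟩
    dsimp only at *
    subst h1 h2 h1' h2'
    exact ⟨rfl, rfl, h3.tensor h3'⟩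
  one := cls empty
  mul_assoc := by
    rintro ⟨A⟩ ⟨B⟩ ⟨C⟩
    exact cls_eq_of_derives (.tensorAssoc _ _ _) (Nat.add_assoc _ _ _) (Nat.add_assoc _ _ _)
  one_mul := by
    rintro ⟨A⟩
    exact cls_eq_of_derives (.emptyTensor _) (Nat.zero_add _) (Nat.zero_add _)
  mul_one := by
    rintro ⟨A⟩
    exact cls_eq_of_derives (.tensorEmpty _)

end Cls

infixl:60 " ≫ " => Cls.seq

variable {n m n' m' : ℕ}

theorem cls_empty : cls (empty : Diag p 0 0) = 1 := rfl
theorem cls_tensor (A : Diag p n m) (B : Diag p n' m') : cls (A ⊠ B) = cls A * cls B := rfl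
theorem cls_seq (A : Diag p n m) (B : Diag p n' m') (h : m = n') :
    cls (.seq A B h) = cls A ≫ cls B := by
  refine Eq.trans ?_ (congrArg (Quotient.mk _) (dif_pos h).symm)
  rfl

namespace Cls

@[simp] theorem dom_cls (A : Diag p n m) : (cls A).dom = n := (rfl)
@[simp] theorem cod_cls (A : Diag p n m) : (cls A).cod = m := (rfl)
@[simp] theorem dom_one : (1 : Cls p).dom = 0 := (rfl)
@[simp] theorem cod_one : (1 : Cls p).cod = 0 := (rfl)
@[simp] theorem dom_mul (A B : Cls p) : (A * B).dom = A.dom + B.dom := by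
  rcases A with ⟨A⟩; rcases B with ⟨B⟩; rfl
@[simp] theorem cod_mul (A B : Cls p) : (A * B).cod = A.cod + B.cod := by
  rcases A with ⟨A⟩; rcases B with ⟨B⟩; rfl
@[simp] theorem dom_seq (A B : Cls p) : (A ≫ B).dom = A.dom := by
  rcases A with ⟨A⟩; rcases B with ⟨B⟩; exact A.dom_seq B
@[simp] theorem cod_seq (A B : Cls p) : (A ≫ B).cod = B.cod := by
  rcases A with ⟨A⟩; rcases B with ⟨B⟩; exact A.cod_seq B

theorem exists_rep (A : Cls p) : ∃ D : Diag p A.dom A.cod, cls D = A := by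
  rcases A with ⟨A⟩; exact ⟨A.diag, rfl⟩

theorem exists_rep' {A : Cls p} {n m : ℕ} (h : A.dom = n) (h' : A.cod = m) :
    ∃ D : Diag p n m, cls D = A := by
  subst h h'
  exact A.exists_rep

theorem assoc {A B C : Cls p} (h : A.cod = B.dom) (h' : B.cod = C.dom) :
    A ≫ B ≫ C = A ≫ (B ≫ C) := by
  obtain ⟨A', hA⟩ := A.exists_rep
  obtain ⟨B', hB⟩ := B.exists_rep
  obtain ⟨C', hC⟩ := C.exists_rep
  rw [← hA, ← hB, ← hC, ← cls_seq _ _ h, ← cls_seq _ _ h', ← cls_seq _ _ h', ← cls_seq _ _ h]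
  exact cls_eq_of_derives (.seqAssoc _ _ _ _ _)

theorem interchange {A B C D : Cls p} (h : A.cod = B.dom) (h' : C.cod = D.dom) :
    (A * C) ≫ (B * D) = (A ≫ B) * (C ≫ D) := by
  obtain ⟨A', hA⟩ := A.exists_rep
  obtain ⟨B', hB⟩ := B.exists_rep
  obtain ⟨C', hC⟩ := C.exists_rep
  obtain ⟨D', hD⟩ := D.exists_rep
  rw [← hA, ← hB, ← hC, ← hD, ← cls_seq _ _ h, ← cls_seq _ _ h', ← cls_tensor, ← cls_tensor,
    ← cls_tensor, ← cls_seq _ _ (by omega)]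
  exact (cls_eq_of_derives (.interchange _ _ _ _ _ _)).symm

theorem idn_seq {A : Cls p} {n : ℕ} (h : A.dom = n) : cls (idn n) ≫ A = A := by
  obtain ⟨A', hA⟩ := A.exists_rep
  subst h
  rw [← hA]
  exact (cls_seq _ _ rfl).symm.trans (cls_eq_of_derives (.idSeq _))

theorem seq_idn {A : Cls p} {n : ℕ} (h : A.cod = n) : A ≫ cls (idn n) = A := by
  obtain ⟨A', hA⟩ := A.exists_rep
  subst h
  rw [← hA]
  exact (cls_seq _ _ rfl).symm.trans (cls_eq_of_derives (.seqId _))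

theorem scalar_comm {s A : Cls p} (h : s.dom = 0) (h' : s.cod = 0) : s * A = A * s := by
  rcases s with ⟨n, m, s⟩
  obtain rfl : n = 0 := h
  obtain rfl : m = 0 := h'
  rcases A with ⟨A⟩
  exact cls_eq_of_derives (.scalar_comm _ _)

end Cls

/-- A wire. -/
abbrev W : Cls p := cls wire

@[simp] theorem cls_idn_zero : cls (idn 0 : Diag p 0 0) = 1 := rfl
theorem cls_idn_succ (n : ℕ) : cls (idn (n + 1) : Diag p _ _) = cls (idn n) * W := rfl
@[simp] theorem cls_idn_one : cls (idn 1 : Diag p 1 1) = W := one_mul (W : Cls p)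
@[simp] theorem cls_idn_two : cls (idn 2 : Diag p 2 2) = W * W := by
  rw [cls_idn_succ, cls_idn_one]

namespace Cls

theorem one_seq {A : Cls p} (h : A.dom = 0) : 1 ≫ A = A := idn_seq h
theorem seq_one {A : Cls p} (h : A.cod = 0) : A ≫ 1 = A := seq_idn h
theorem W_seq {A : Cls p} (h : A.dom = 1) : W ≫ A = A := by
  rw [← cls_idn_one, idn_seq h]
theorem seq_W {A : Cls p} (h : A.cod = 1) : A ≫ W = A := by
  rw [← cls_idn_one, seq_idn h]
theorem WW_seq {A : Cls p} (h : A.dom = 2) : (W * W) ≫ A = A := by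
  rw [← cls_idn_two, idn_seq h]
theorem seq_WW {A : Cls p} (h : A.cod = 2) : A ≫ (W * W) = A := by
  rw [← cls_idn_two, seq_idn h]

theorem mul_eq_seq_left {A B : Cls p} {n m : ℕ} (h : A.cod = n) (h' : B.dom = m) :
    A * B = (A * cls (idn m)) ≫ (cls (idn n) * B) := by
  rw [interchange (by simpa) (by simpa using h'.symm), seq_idn h, idn_seq h']

theorem scalar_seq {s A B : Cls p} (hs' : s.cod = 0) (h : A.cod = B.dom) :
    (s * A) ≫ B = s * (A ≫ B) := by
  conv_lhs => rw [← one_mul B, interchange (by simpa) h, seq_one hs']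

theorem seq_scalar {s A B : Cls p} (hs : s.dom = 0) (h : A.cod = B.dom) :
    A ≫ (s * B) = s * (A ≫ B) := by
  conv_lhs => rw [← one_mul A, interchange (by simp [hs]) h, one_seq hs]

theorem W_mul_seq {A B : Cls p} (h : A.cod = B.dom) : (W * A) ≫ (W * B) = W * (A ≫ B) := by
  rw [interchange (by simp) h, W_seq rfl]

theorem mul_W_seq {A B : Cls p} (h : A.cod = B.dom) : (A * W) ≫ (B * W) = (A ≫ B) * W := by
  rw [interchange h (by simp), W_seq rfl]

/-- Sliding rule: a factor without outputs may be executed before its neighbour. This and the three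
variants below move effects and states past other diagrams. -/
theorem effect_mul {A B : Cls p} {m : ℕ} (h : A.cod = 0) (h' : B.dom = m) :
    A * B = (A * cls (idn m)) ≫ B := by
  conv_rhs => rw [← one_mul B, interchange (by simpa) (by simp [h']), seq_one h, idn_seq h']

theorem mul_effect {A B : Cls p} {n : ℕ} (h : B.cod = 0) (h' : A.dom = n) :
    A * B = (cls (idn n) * B) ≫ A := by
  conv_rhs => rw [← mul_one A, interchange (by simp [h']) (by simpa), seq_one h, idn_seq h']

theorem state_mul {A B : Cls p} {m : ℕ} (h : A.dom = 0) (h' : B.cod = m) :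
    A * B = B ≫ (A * cls (idn m)) := by
  conv_rhs => rw [← one_mul B, interchange (by simp [h]) (by simp [h']), one_seq h, seq_idn h']

theorem mul_state {A B : Cls p} {n : ℕ} (h : B.dom = 0) (h' : A.cod = n) :
    A * B = A ≫ (cls (idn n) * B) := by
  conv_rhs => rw [← mul_one A, interchange (by simp [h']) (by simp [h]), one_seq h, seq_idn h']

end Cls

theorem cls_eq_one_of_isPhase {C : Diag p 0 0} (h : IsPhase C) : cls C = 1 := by
  refine cls_eq_cls_iff.2 ⟨C, h, .symm (.emptyTensor C)⟩

theorem isPhase_of_cls_eq_one {C : Diag p 0 0} (h : cls C = 1) : IsPhase C := by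
  obtain ⟨D, hD, h⟩ := cls_eq_cls_iff.1 (h.trans cls_empty.symm)
  exact hD.congr (.symm (.trans h (.emptyTensor D)))

/-- An elementary scalar with an elementary inverse up to phases is a phase. -/
theorem cls_eq_one_of_mul_eq_one {C D : Diag p 0 0} (hC : IsElementary p C)
    (hD : IsElementary p D) (h : cls C * cls D = 1) : cls C = 1 := by
  obtain ⟨E, E', h1, h2, h3, h4⟩ := isPhase_of_cls_eq_one (C := C ⊠ D) h
  -- The product of `C` and `D` is only known to be a phase `E`, so the inverse of `C` is `D`
  -- corrected by the inverse of `E`.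
  refine cls_eq_one_of_isPhase ⟨C, D ⊠ E', hC, .tensor _ _ hD h2, .refl _, ?_⟩
  exact .trans (.symm (.tensorAssoc _ _ _)) (.trans (.tensor h3 (.refl _)) h4)

theorem eqUpToScalar_of_cls_eq {A B : Diag p n m} (h : cls A = cls B) : EqUpToScalar p A B := by
  obtain ⟨C, ⟨E, E', h1, h2, h3, h4⟩, h⟩ := cls_eq_cls_iff.1 h
  exact ⟨E, h1, .trans h (.tensor (.refl _) h3)⟩

/-- An elementary scalar that is inverted by elementary scalars. -/
theorem IsElementary.cls_eq_one {C D : Diag p 0 0} (hC : IsElementary p C)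
    (hD : IsElementary p D) (h : Derives p (C ⊠ D) Diag.empty) : cls C = 1 :=
  cls_eq_one_of_isPhase ⟨C, D, hC, hD, .refl _, h⟩

end Quotient
end QupitZX

/-! ### The green Frobenius algebra and bending of wires. -/

namespace QupitZX
open Diag
section Generators

variable {p : ℕ} [Fact p.Prime]

/-- The Hadamard. -/
abbrev H : Cls p := cls had
/-- The antipode. -/
abbrev anti : Cls p := cls rInv
/-- The green comultiplication. -/
abbrev Δ : Cls p := cls gComul
/-- The green multiplication. -/
abbrev M : Cls p := cls gMul
/-- The red multiplication. -/
abbrev N : Cls p := cls rMul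
abbrev cupC : Cls p := cls cup
abbrev capC : Cls p := cls cap
abbrev swapC : Cls p := cls swap
/-- The green unit. -/
abbrev η (x y : ZMod p) : Cls p := cls (gUnit x y)
/-- The green counit. -/
abbrev ε (x y : ZMod p) : Cls p := cls (gCounit x y)
/-- The green phase. -/
abbrev G (x y : ZMod p) : Cls p := cls (green 1 1 x y)

open Cls

theorem cls_cast {n m n' m' : ℕ} (D : Diag p n m) (hn : n = n') (hm : m = m') :
    cls (D.cast hn hm) = cls D := by
  subst hn hm
  rfl

theorem cls_gId : cls gId = (W : Cls p) := cls_eq_of_derives .gElim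

theorem cls_green (m n : ℕ) (x y : ZMod p) :
    cls (green m n x y) = (cls (idn m) * η x y) ≫ cls (gMerge m) ≫ cls (gSplit n) := by
  rw [green, cls_seq, cls_seq, cls_tensor]

theorem cls_gMerge_zero : cls (gMerge 0) = (W : Cls p) := cls_gId
theorem cls_gMerge_succ (m : ℕ) :
    cls (gMerge (m + 1)) = (cls (gMerge m) * W : Cls p) ≫ M := by
  rw [gMerge, cls_seq, cls_tensor]
theorem cls_gMerge_one : cls (gMerge 1) = (M : Cls p) := by
  rw [cls_gMerge_succ, cls_gMerge_zero, WW_seq rfl]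
theorem cls_gSplit_zero : cls (gSplit 0) = (ε 0 0 : Cls p) := rfl
theorem cls_gSplit_one : cls (gSplit 1) = (W : Cls p) := cls_gId
theorem cls_gSplit_succ_succ (m : ℕ) :
    cls (gSplit (m + 2)) = Δ ≫ (cls (gSplit (m + 1)) * W : Cls p) := by
  rw [gSplit, gSplitSucc, cls_seq, cls_tensor]; rfl
theorem cls_gSplit_two : cls (gSplit 2) = (Δ : Cls p) := by
  rw [cls_gSplit_succ_succ, cls_gSplit_one, seq_WW rfl]

theorem W_mul_η_seq_M (x y : ZMod p) : (W * η x y) ≫ M = G x y := by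
  rw [G, cls_green, cls_gMerge_one, cls_gSplit_one, seq_W rfl, cls_idn_one]

theorem G_zero_zero : G 0 0 = (W : Cls p) := (cls_eq_of_derives .gLabel).trans cls_gId

/-- The unit law of the green monoid comes from (G-Elim) together with the rule that the label `(0,
0)` means no label. -/
theorem W_mul_η_zero_seq_M : (W * η 0 0) ≫ M = (W : Cls p) := by
  rw [W_mul_η_seq_M, G_zero_zero]

theorem cls_green_one_zero (x y : ZMod p) : cls (green 1 0 x y) = G x y ≫ ε 0 0 := by
  rw [cls_green, cls_gMerge_one, cls_gSplit_zero, cls_idn_one, W_mul_η_seq_M]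

theorem cls_green_one_two : cls (green 1 2 0 0) = (Δ : Cls p) := by
  rw [cls_green, cls_gMerge_one, cls_gSplit_two, cls_idn_one, W_mul_η_zero_seq_M, W_seq rfl]

theorem cls_green_zero_one (x y : ZMod p) : cls (green 0 1 x y) = η x y := by
  rw [cls_green, cls_gMerge_zero, cls_gSplit_one, cls_idn_zero, seq_W rfl, seq_W rfl, one_mul]

theorem idn_mul_η_seq_gMerge (m : ℕ) :
    (cls (idn (m + 1)) * η 0 0) ≫ cls (gMerge (m + 1)) = (cls (gMerge m) : Cls p) := by
  rw [cls_gMerge_succ, ← assoc (by simp) (by simp), interchange (by simp) (by simp),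
    idn_seq (by simp), seq_W rfl]
  calc cls (gMerge m) * η 0 0 ≫ M
      = (cls (gMerge m) * 1) ≫ (W * η 0 0) ≫ M := by
        rw [interchange (by simp) (by simp), seq_W rfl, one_seq rfl]
    _ = _ := by
      rw [assoc (by simp) (by simp), W_mul_η_zero_seq_M, mul_one, seq_W rfl]

theorem cls_green_succ_zero_zero (m n : ℕ) :
    cls (green (m + 1) n 0 0) = (cls (gMerge m) ≫ cls (gSplit n) : Cls p) := by
  rw [cls_green, idn_mul_η_seq_gMerge]

theorem cls_green_two_one : cls (green 2 1 0 0) = (M : Cls p) := by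
  rw [cls_green_succ_zero_zero, cls_gMerge_one, cls_gSplit_one, seq_W rfl]

theorem cls_green_two_two : cls (green 2 2 0 0) = (M ≫ Δ : Cls p) := by
  rw [cls_green_succ_zero_zero, cls_gMerge_one, cls_gSplit_two]

theorem fusion (m n m' n' : ℕ) (a b c d : ZMod p) :
    (cls (green m (n + 1) a b) * cls (idn m')) ≫ (cls (idn n) * cls (green (1 + m') n' c d)) =
      cls (green (m + m') (n + n') (a + c) (b + d)) := by
  rw [← cls_tensor, ← cls_tensor, ← cls_seq _ _ (by omega)]
  exact cls_eq_of_derives (.fusion m n m' n' a b c d)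

theorem G_seq_G (a b c d : ZMod p) : G a b ≫ G c d = G (a + c) (b + d) := by
  have h : (G a b * 1) ≫ (1 * G c d) = G (a + c) (b + d) := fusion 1 0 0 1 a b c d
  rwa [mul_one, one_mul] at h

theorem η_seq_G (a b c d : ZMod p) : η a b ≫ G c d = η (a + c) (b + d) := by
  have h : (cls (green 0 1 a b) * 1) ≫ (1 * G c d) = cls (green 0 1 (a + c) (b + d)) :=
    fusion 0 0 0 1 a b c d
  rwa [mul_one, one_mul, cls_green_zero_one, cls_green_zero_one] at h

/-- Fusion with a spider that has no outputs. It presents a phase as a comultiplication with one leg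
capped, so facts about phases reduce to facts about `Δ` and effects. -/
theorem Δ_seq_W_mul (x y : ZMod p) : Δ ≫ (W * (G x y ≫ ε 0 0)) = G x y := by
  have h : (cls (green 1 2 0 0) * 1) ≫ (cls (idn 1) * cls (green 1 0 x y)) = G (0 + x) (0 + y) :=
    fusion 1 1 0 0 0 0 x y
  rwa [mul_one, zero_add, zero_add, cls_green_one_two, cls_idn_one, cls_green_one_zero] at h

theorem coassoc : Δ ≫ (W * Δ) = (Δ ≫ (Δ * W) : Cls p) := by
  have h : (cls (green 1 2 0 0) * 1) ≫ (cls (idn 1) * cls (green 1 2 0 0)) =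
      (cls (green 1 3 (0 + 0) (0 + 0)) : Cls p) := fusion 1 1 0 2 0 0 0 0
  rw [mul_one, cls_green_one_two, cls_idn_one, add_zero] at h
  rw [h, cls_green_succ_zero_zero, cls_gMerge_zero, W_seq rfl]
  refine (cls_gSplit_succ_succ 1).trans ?_
  congr 2
  exact cls_gSplit_two

theorem frobenius : M ≫ Δ = ((Δ * W) ≫ (W * M) : Cls p) := by
  have h : (cls (green 1 2 0 0) * cls (idn 1)) ≫ (cls (idn 1) * cls (green 2 1 0 0)) =
      (cls (green 2 2 (0 + 0) (0 + 0)) : Cls p) := fusion 1 1 1 1 0 0 0 0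
  rw [cls_green_one_two, cls_green_two_one, cls_idn_one, add_zero, cls_green_two_two] at h
  exact h.symm

/-! ### Bending -/

theorem snake : (cupC * W) ≫ (W * capC) = (W : Cls p) := by
  rw [← cls_tensor, ← cls_tensor, ← cls_seq _ _ rfl]
  exact cls_eq_of_derives .snake

theorem snake' : (W * cupC) ≫ (capC * W) = (W : Cls p) := by
  rw [← cls_tensor, ← cls_tensor, ← cls_seq _ _ rfl]
  exact cls_eq_of_derives .snake'

theorem cup_swap : cupC ≫ swapC = (cupC : Cls p) := by
  rw [← cls_seq _ _ rfl]
  exact cls_eq_of_derives .cupSwap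

theorem swap_cap : swapC ≫ capC = (capC : Cls p) := by
  rw [← cls_seq _ _ rfl]
  exact cls_eq_of_derives .swapCap

theorem swap_swap : swapC ≫ swapC = (W * W : Cls p) := by
  rw [← cls_seq _ _ rfl, ← cls_idn_two]
  exact cls_eq_of_derives .swapSwap

theorem cls_cups_zero : cls (cups 0) = (1 : Cls p) := rfl

theorem cls_cups_succ (n : ℕ) :
    cls (cups (n + 1)) = (cls (cups n) ≫ (cls (idn n) * (cupC * cls (idn n))) : Cls p) := by
  rw [cups, cls_cast, cls_seq, cls_tensor, cls_tensor]

theorem cls_cups_one : cls (cups 1) = (cupC : Cls p) := by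
  rw [cls_cups_succ, cls_cups_zero, cls_idn_zero, one_seq (by simp), one_mul, mul_one]

theorem cls_cups_two : cls (cups 2) = (cupC ≫ (W * (cupC * W)) : Cls p) := by
  rw [cls_cups_succ, cls_cups_one, cls_idn_one]

theorem cls_bend {n m : ℕ} (D : Diag p n m) :
    cls (bend D) = cls (cups n) ≫ (cls (idn n) * cls D) := by
  rw [bend, cls_seq, cls_tensor]

theorem cls_bend_zero {m : ℕ} (D : Diag p 0 m) : cls (bend D) = cls D := by
  rw [cls_bend, cls_cups_zero, cls_idn_zero, one_mul, one_seq rfl]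

theorem cls_bend_one {m : ℕ} (D : Diag p 1 m) : cls (bend D) = cupC ≫ (W * cls D) := by
  rw [cls_bend, cls_cups_one, cls_idn_one]

theorem cls_bend_two {m : ℕ} (D : Diag p 2 m) :
    cls (bend D) = cupC ≫ (W * ((cupC * W) ≫ (W * cls D))) := by
  rw [cls_bend, cls_cups_two, cls_idn_two, assoc (by simp) (by simp), mul_assoc,
    interchange (by simp) (by simp), W_seq rfl]

/-- Unbending the first leg. -/
theorem unbend {A : Cls p} (h : A.dom = 1) :
    (W * (cupC ≫ (W * A))) ≫ (capC * cls (idn A.cod)) = A := by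
  calc (W * (cupC ≫ (W * A))) ≫ (capC * cls (idn A.cod))
      = (W * cupC) ≫ ((W * W) * A) ≫ (capC * cls (idn A.cod)) := by
        rw [mul_assoc, W_mul_seq (by simp [h])]
    _ = (W * cupC) ≫ ((capC * W) ≫ A) := by
        rw [assoc (by simp [h]) (by simp), interchange (by simp) (by simp), WW_seq rfl,
          seq_idn rfl]
        rw [effect_mul (A := capC) (m := 1) rfl h, cls_idn_one]
    _ = A := by
        rw [← assoc (by simp) (by simp [h]), snake', W_seq h]

theorem eq_of_bend_eq {A B : Cls p} (hA : A.dom = 1) (hB : B.dom = 1) (hc : A.cod = B.cod)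
    (h : cupC ≫ (W * A) = cupC ≫ (W * B)) : A = B := by
  rw [← unbend hA, h, hc, unbend hB]

theorem Δ_eq : Δ = ((cupC * W) ≫ (W * M) : Cls p) := by
  refine eq_of_bend_eq rfl (by simp) (by simp) ?_
  rw [← cls_bend_two, ← cls_bend_one]
  exact (cls_eq_of_derives .gBend).symm

theorem M_eq : M = ((W * Δ) ≫ (capC * W) : Cls p) := by
  symm
  calc (W * Δ) ≫ (capC * W)
      = (W * (cupC * W)) ≫ ((W * W) * M) ≫ (capC * W) := by
        rw [Δ_eq, mul_assoc, W_mul_seq (by simp)]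
    _ = (W * (cupC * W)) ≫ ((capC * (W * W)) ≫ M) := by
        rw [assoc (by simp) (by simp), interchange (by simp) (by simp), WW_seq rfl, seq_W rfl]
        rw [effect_mul (A := capC) (m := 2) rfl rfl, cls_idn_two]
    _ = M := by
        rw [← assoc (by simp) (by simp), ← mul_assoc, ← mul_assoc,
          interchange (by simp) (by simp), snake', W_seq rfl, WW_seq rfl]

/-- Write the outer multiplication as a capped comultiplication, carry the inner one past it by the
Frobenius law, and read the capped comultiplication backwards. -/
theorem M_assoc : (M * W) ≫ M = ((W * M) ≫ M : Cls p) := by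
  symm
  calc (W * M) ≫ M = (W * M) ≫ ((W * Δ) ≫ (capC * W)) := by rw [← M_eq]
    _ = (W * ((Δ * W) ≫ (W * M))) ≫ (capC * W) := by
      rw [← assoc (by simp) (by simp), interchange (by simp) (by simp), W_seq rfl, frobenius]
    _ = ((W * Δ) * W) ≫ (((W * W) * M) ≫ (capC * W)) := by
      rw [← assoc (by simp) (by simp), mul_assoc W W M, mul_assoc W Δ W,
        W_mul_seq (by simp)]
    _ = ((W * Δ) * W) ≫ (((capC * W) * W) ≫ M) := by
      rw [interchange (by simp) (by simp), WW_seq rfl, seq_W rfl]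
      rw [effect_mul (A := capC) (m := 2) rfl rfl, cls_idn_two, mul_assoc capC]
    _ = _ := by
      rw [← assoc (by simp) (by simp), interchange (by simp) (by simp), ← M_eq, W_seq rfl]

theorem Δ_seq_W_mul_ε : Δ ≫ (W * ε 0 0) = (W : Cls p) := by
  have h := Δ_seq_W_mul (0 : ZMod p) 0
  rwa [G_zero_zero, W_seq rfl] at h

/-- The compact structure is the one induced by the green Frobenius algebra, so bending by caps and
bending by green vertices agree. -/
theorem M_seq_ε : M ≫ ε 0 0 = (capC : Cls p) := by
  calc M ≫ ε 0 0 = (W * Δ) ≫ ((capC * W) ≫ (ε 0 0)) := by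
        rw [← assoc (by simp) (by simp), ← M_eq]
    _ = (W * (Δ ≫ (W * ε 0 0))) ≫ capC := by
        have h := effect_mul (A := capC) (B := ε (0 : ZMod p) 0) (m := 1) rfl rfl
        rw [cls_idn_one] at h
        rw [← h, mul_effect (A := capC) (n := 2) rfl rfl, cls_idn_two,
          ← assoc (by simp) (by simp), mul_assoc, W_mul_seq (by simp)]
    _ = capC := by rw [Δ_seq_W_mul_ε, WW_seq rfl]

theorem bend_flex {n m k : ℕ} (g : Gen p n m) (σ : Diag p k k) (hσ : IsPerm σ) (h : n + m = k) :
    cls (bend (gen g)) ≫ cls σ = cls (bend (gen g)) := by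
  rw [← cls_seq _ _ h]
  exact cls_eq_of_derives (.flex g σ hσ h)

theorem Δ_swap : Δ ≫ swapC = (Δ : Cls p) := by
  refine eq_of_bend_eq (by simp) rfl (by simp) ?_
  have h := bend_flex (p := p) .gComul (idn 1 ⊠ swap) (.tensor (.idn 1) .swap) rfl
  rwa [cls_bend_one, cls_tensor, cls_idn_one, assoc (by simp) (by simp),
    interchange (by simp) (by simp), W_seq rfl] at h

theorem bend_Δ_swap : (cupC ≫ (W * Δ)) ≫ (swapC * W) = (cupC ≫ (W * Δ) : Cls p) := by
  have h := bend_flex (p := p) .gComul (swap ⊠ idn 1) (.tensor .swap (.idn 1)) rfl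
  rwa [cls_bend_one, cls_tensor, cls_idn_one] at h

theorem bend_H_swap : (cupC ≫ (W * H)) ≫ swapC = (cupC ≫ (W * H) : Cls p) := by
  have h := bend_flex (p := p) .had swap .swap rfl
  rwa [cls_bend_one] at h

/-- `A` and `B` are transposes of each other. -/
def IsTranspose (A B : Cls p) : Prop := (A * W) ≫ capC = (W * B) ≫ capC

end Generators
end QupitZX

/-! ### Transposition, invisible scalars, and red spiders as Hadamard conjugates of green ones. -/

namespace QupitZX
open Diag
section Red

variable {p : ℕ} [Fact p.Prime]
open Cls

/-! ### Transposition -/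

theorem swap_natural {A : Cls p} (h : A.dom = 1) (h' : A.cod = 1) :
    (A * W) ≫ swapC = swapC ≫ (W * A) := by
  obtain ⟨D, rfl⟩ := exists_rep' h h'
  have e : cls (braid 1) = (swapC : Cls p) := by
    rw [braid, cls_seq, cls_tensor, cls_tensor, cls_idn_zero, one_mul, braid, seq_WW rfl]
  rw [← e, ← cls_tensor, ← cls_tensor, ← cls_seq _ _ rfl, ← cls_seq _ _ rfl]
  exact cls_eq_of_derives (.swapNat D)

theorem swap_natural_state (D : Diag p 0 1) : (cls D * W) ≫ swapC = W * cls D := by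
  have e : cls (braid 1) = (swapC : Cls p) := by
    rw [braid, cls_seq, cls_tensor, cls_tensor, cls_idn_zero, one_mul, braid, seq_WW rfl]
  rw [← e, ← cls_tensor, ← cls_tensor, ← cls_seq _ _ rfl]
  refine (cls_eq_of_derives (.swapNat D)).trans ?_
  rw [cls_seq, braid, cls_tensor, W_seq rfl]

/-- Recover `A` from its bent form, replace that form by the hypothesis, and straighten the wire
that is left. -/
theorem isTranspose_of_cup {A B : Cls p} (hA : A.dom = 1) (hA' : A.cod = 1) (hB : B.dom = 1)
    (hB' : B.cod = 1) (h : cupC ≫ (W * A) = cupC ≫ (B * W)) : IsTranspose A B := by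
  have e := unbend hA
  rw [h, hA', cls_idn_one] at e
  have e1 : (capC * W * W) ≫ capC = ((W * W * capC) ≫ capC : Cls p) := by
    have h1 := effect_mul (A := capC) (B := (capC : Cls p)) (m := 2) rfl rfl
    have h2 := mul_effect (A := capC) (B := (capC : Cls p)) (n := 2) rfl rfl
    rw [cls_idn_two] at h1 h2
    rw [mul_assoc, ← h1, h2]
  have e2 : ((cupC ≫ (B * W)) * W) ≫ (W * capC) = B := by
    have h2 := mul_effect (A := B) (B := (capC : Cls p)) rfl hB
    rw [← mul_W_seq (by simp [hB]), assoc (by simp [hB]) (by simp [hB']), mul_assoc B W W,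
      interchange (A := B) (by simp [hB']) (by simp), seq_W hB', WW_seq rfl, h2, cls_idn_one,
      ← assoc (by simp) (by simp [hB]), snake, W_seq hB]
  rw [IsTranspose, ← e, ← mul_W_seq (by simp [hB']), assoc (by simp [hB']) (by simp), e1,
    ← assoc (by simp [hB']) (by simp), mul_assoc W _ W, mul_assoc W W capC,
    W_mul_seq (by simp [hB']), e2]

theorem W_mul_swap {A : Cls p} (hA : A.dom = 1) (hA' : A.cod = 1) :
    (W * A) ≫ swapC = swapC ≫ (A * W) := by
  rw [← WW_seq (A := (W * A) ≫ swapC) (by simp [hA]), ← swap_swap, assoc (by simp) (by simp [hA]),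
    ← assoc (A := swapC) (B := W * A) (by simp [hA]) (by simp [hA']), ← swap_natural hA hA',
    assoc (by simp [hA']) (by simp), swap_swap, seq_WW (by simp [hA'])]

theorem cup_of_bend_swap {A : Cls p} (hA : A.dom = 1) (hA' : A.cod = 1)
    (h : (cupC ≫ (W * A)) ≫ swapC = cupC ≫ (W * A)) : cupC ≫ (W * A) = cupC ≫ (A * W) := by
  rw [← h, assoc (by simp [hA]) (by simp [hA']), W_mul_swap hA hA', ← assoc (by simp) (by simp [hA]),
    cup_swap]

theorem isTranspose_of_bend_swap {A : Cls p} (hA : A.dom = 1) (hA' : A.cod = 1)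
    (h : (cupC ≫ (W * A)) ≫ swapC = cupC ≫ (W * A)) : IsTranspose A A :=
  isTranspose_of_cup hA hA' hA hA' (cup_of_bend_swap hA hA' h)

theorem isTranspose_H : IsTranspose H (H : Cls p) :=
  isTranspose_of_bend_swap rfl rfl bend_H_swap

/-- A phase is `Δ` with one leg capped, and flexsymmetry allows the other two legs of the bent `Δ`
to be exchanged. -/
theorem isTranspose_G (x y : ZMod p) : IsTranspose (G x y) (G x y) := by
  refine isTranspose_of_bend_swap rfl rfl ?_
  have e : cupC ≫ (W * G x y) =
      (cupC ≫ (W * Δ)) ≫ ((W * W) * (G x y ≫ ε 0 0)) := by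
    conv_lhs => rw [← Δ_seq_W_mul]
    rw [assoc (by simp) (by simp), mul_assoc W W, W_mul_seq (by simp)]
  rw [e]
  conv_rhs => rw [← bend_Δ_swap]
  rw [assoc (B := swapC * W) (by simp) (by simp), assoc (C := swapC) (by simp) (by simp),
    interchange (A := swapC) (by simp) (by simp), seq_WW rfl, W_seq (by simp),
    mul_effect (A := swapC) (n := 2) rfl rfl, cls_idn_two]

theorem isTranspose_states {A A' : Cls p} (hA : A.dom = 1 ∧ A.cod = 1)
    (hA' : A'.dom = 1 ∧ A'.cod = 1) (h : IsTranspose A A') (s t : Diag p 0 1) :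
    ((cls s ≫ A) * cls t) ≫ capC = (cls s * (cls t ≫ A')) ≫ capC := by
  have e : (cls s ≫ A) * cls t = (cls s * cls t) ≫ (A * W) := by
    rw [interchange (by simp [*]) (by simp), seq_W rfl]
  have e' : cls s * (cls t ≫ A') = (cls s * cls t) ≫ (W * A') := by
    rw [interchange (by simp [*]) (by simp [*]), seq_W rfl]
  rw [e, e', assoc (by simp [*]) (by simp [*]), assoc (by simp [*]) (by simp [*]), h]

theorem state_W_cap (D : Diag p 0 1) : (cls D * W) ≫ capC = (W * cls D) ≫ capC := by
  rw [← swap_natural_state, assoc (by simp) (by simp), swap_cap]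

theorem ε_eq (x y : ZMod p) : ε x y = (W * η x y) ≫ capC := by
  have h := unbend (A := ε x y) rfl
  have e : η x y = cupC ≫ (W * ε x y) := by
    rw [← cls_bend_one, η, ← cls_bend_zero]
    exact cls_eq_of_derives (.gUnitBend x y)
  rw [← e] at h
  rw [← h, cod_cls, cls_idn_zero, mul_one]

/-- The red unit. -/
abbrev ηr (x y : ZMod p) : Cls p := cls (rUnit x y)
/-- The red counit. -/
abbrev εr (x y : ZMod p) : Cls p := cls (rCounit x y)

theorem ηr_eq_cup (x y : ZMod p) : ηr x y = cupC ≫ (W * εr x y) := by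
  rw [← cls_bend_one, ηr, ← cls_bend_zero]
  exact cls_eq_of_derives (.rUnitBend x y)

theorem εr_eq (x y : ZMod p) : εr x y = (W * ηr x y) ≫ capC := by
  have h := unbend (A := εr x y) rfl
  rw [← ηr_eq_cup] at h
  rw [← h, cod_cls, cls_idn_zero, mul_one]

theorem G_seq_ε (x y : ZMod p) : G x y ≫ ε 0 0 = ε x y := by
  rw [← W_mul_η_seq_M, assoc (by simp) (by simp), M_seq_ε, ε_eq]

theorem Δ_seq_W_mul_ε' (x y : ZMod p) : Δ ≫ (W * ε x y) = G x y := by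
  rw [← Δ_seq_W_mul, G_seq_ε]

/-- Transposing a green scalar. -/
theorem η_seq_seq_ε {A A' : Cls p} (hA : A.dom = 1 ∧ A.cod = 1)
    (hA' : A'.dom = 1 ∧ A'.cod = 1) (h : IsTranspose A A') (a b c d : ZMod p) :
    η a b ≫ A ≫ ε c d = η c d ≫ A' ≫ ε a b := by
  have e := isTranspose_states hA hA' h (gUnit a b) (gUnit c d)
  have h1 : (η a b ≫ A) * η c d = (η a b ≫ A) ≫ (W * η c d) := by
    rw [mul_state (n := 1) rfl (by simp [*]), cls_idn_one]
  have h2 : η a b * (η c d ≫ A') = (η c d ≫ A') ≫ (η a b * W) := by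
    rw [state_mul (m := 1) rfl (by simp [*]), cls_idn_one]
  rw [h1, h2, assoc (A := η a b ≫ A) (by simp [*]) (by simp),
    assoc (A := η c d ≫ A') (by simp [*]) (by simp), state_W_cap,
    ← ε_eq, ← ε_eq] at e
  exact e

/-! ### Basic scalars -/

omit [Fact p.Prime] in
theorem isElementary_star : IsElementary p star := by
  refine .base _ (Or.inl (Or.inl ?_))
  unfold elemO
  split_ifs <;> simp

omit [Fact p.Prime] in
theorem isElementary_sqrtP : IsElementary p sqrtP := .base _ (Or.inr (Or.inl rfl))

omit [Fact p.Prime] in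
theorem isElementary_sqrtPInv : IsElementary p sqrtPInv :=
  .base _ (Or.inr (Or.inr (Or.inr rfl)))

/-- Elementary with an elementary inverse, by (M-One) here and by (One) for `√p` and `1/√p`; such
scalars are invisible in `Cls`. -/
theorem cls_star : cls (star : Diag p 0 0) = 1 :=
  isElementary_star.cls_eq_one isElementary_star .mOne
theorem cls_sqrtP : cls (sqrtP : Diag p 0 0) = 1 :=
  isElementary_sqrtP.cls_eq_one isElementary_sqrtPInv .one
theorem cls_sqrtPInv : cls (sqrtPInv : Diag p 0 0) = 1 :=
  isElementary_sqrtPInv.cls_eq_one isElementary_sqrtP (.trans (.scalar_comm _ _) .one)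

theorem cls_spow {D : Diag p 0 0} (h : cls D = 1) (k : ℕ) : cls (spow D k) = 1 := by
  induction k with
  | zero => rfl
  | succ k ih => rw [spow, cls_tensor, ih, h, one_mul]

/-! ### Red in terms of green -/

theorem cls_hads_zero : cls (hads 0) = (1 : Cls p) := rfl
theorem cls_hads_succ (n : ℕ) : cls (hads (n + 1)) = (cls (hads n) * H : Cls p) := rfl
theorem cls_hads_one : cls (hads 1) = (H : Cls p) := one_mul (H : Cls p)
theorem cls_hads_two : cls (hads 2) = (H * H : Cls p) := by
  rw [cls_hads_succ, cls_hads_one]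

theorem cls_red (m n : ℕ) (x y : ZMod p) :
    cls (red m n x y) = cls (hads m) ≫ cls (green m n (-x) y) ≫ cls (hads n) := by
  have h := cls_eq_of_derives (.colour m n (-x) y)
  rw [neg_neg] at h
  rw [← h, cls_seq, cls_seq]

/-- The colour rule at the unlabelled `1 → 1` spider, which is the wire in green and the antipode in
red. -/
theorem H_seq_H : H ≫ H = (anti : Cls p) := by
  have h := cls_red 1 1 (0 : ZMod p) 0
  have e : cls (green 1 1 (-0) 0) = (W : Cls p) := by rw [neg_zero]; exact G_zero_zero
  rw [cls_hads_one, e, seq_W rfl] at h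
  rw [← h]
  exact cls_eq_of_derives .rLabel

theorem anti_anti : anti ≫ anti = (W : Cls p) := by
  rw [← cls_seq _ _ rfl]
  exact cls_eq_of_derives .rElim

theorem seq_anti_anti {A : Cls p} (h : A.cod = 1) : A ≫ anti ≫ anti = A := by
  rw [assoc (by simpa) (by simp), anti_anti, seq_W h]

theorem cls_red_one_one (x y : ZMod p) : cls (red 1 1 x y) = H ≫ G (-x) y ≫ H := by
  rw [cls_red, cls_hads_one]

theorem cls_red_def (m n : ℕ) (x y : ZMod p) : cls (red m n x y) =
    (cls (idn m) * (ηr x y ≫ anti)) ≫ cls (rMerge m) ≫ anti ≫ cls (rSplit n) := by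
  rw [red, cls_seq, cls_seq, cls_seq, cls_tensor, cls_seq]

theorem cls_rMerge_zero : cls (rMerge 0) = (anti : Cls p) := rfl
theorem cls_rMerge_succ (m : ℕ) :
    cls (rMerge (m + 1)) = ((cls (rMerge m) ≫ anti) * W : Cls p) ≫ N := by
  rw [rMerge, cls_seq, cls_tensor, cls_seq]
theorem cls_rMerge_one : cls (rMerge 1) = (N : Cls p) := by
  rw [cls_rMerge_succ, cls_rMerge_zero, anti_anti, WW_seq rfl]
theorem cls_rSplit_one : cls (rSplit 1) = (anti : Cls p) := rfl

theorem W_mul_ηr_anti_seq_N : (W * (ηr 0 0 ≫ anti)) ≫ N = (anti : Cls p) := by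
  have h : cls (red 1 1 0 0) = (anti : Cls p) := cls_eq_of_derives .rLabel
  rwa [cls_red_def, cls_rSplit_one, cls_rMerge_one, seq_anti_anti (by simp), cls_idn_one] at h

theorem idn_mul_ηr_seq_rMerge (m : ℕ) :
    (cls (idn (m + 1)) * (ηr 0 0 ≫ anti)) ≫ cls (rMerge (m + 1)) = (cls (rMerge m) : Cls p) := by
  rw [cls_rMerge_succ, ← assoc (by simp) (by simp), interchange (by simp) (by simp),
    idn_seq (by simp), seq_W (by simp), mul_state (B := ηr 0 0 ≫ anti) (n := 1) (by simp) (by simp),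
    cls_idn_one, assoc (by simp) (by simp), W_mul_ηr_anti_seq_N, seq_anti_anti (by simp)]

theorem cls_red_succ_zero_zero (m n : ℕ) :
    cls (red (m + 1) n 0 0) = (cls (rMerge m) ≫ anti ≫ cls (rSplit n) : Cls p) := by
  rw [cls_red_def, idn_mul_ηr_seq_rMerge]

theorem cls_red_succ_one (m : ℕ) :
    cls (red (m + 1) 1 0 0) = (cls (rMerge m) : Cls p) := by
  rw [cls_red_succ_zero_zero, cls_rSplit_one, seq_anti_anti (by simp)]

theorem N_eq : N = ((H * H) ≫ M ≫ H : Cls p) := by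
  have h : cls (red 2 1 0 0) = (cls (rMerge 1) : Cls p) := cls_red_succ_one 1
  rwa [cls_red, cls_hads_one, cls_hads_two, neg_zero, cls_green_two_one, cls_rMerge_one,
    eq_comm] at h

theorem ηr_eq (x y : ZMod p) : ηr x y = η (-x) y ≫ H := by
  have h : cls (red 0 1 x y) = η (-x) y ≫ H := by
    rw [cls_red, cls_hads_one, cls_hads_zero, cls_green_zero_one, one_seq rfl]
  rw [← h, cls_red_def, cls_rMerge_zero, cls_rSplit_one, cls_idn_zero, one_mul,
    seq_anti_anti (by simp), seq_anti_anti (by simp)]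

theorem εr_eq' (x y : ZMod p) : εr x y = H ≫ ε (-x) y := by
  have e : (W * H) ≫ capC = ((H * W) ≫ capC : Cls p) := isTranspose_H.symm
  rw [εr_eq, ηr_eq, ← W_mul_seq (by simp), assoc (by simp) (by simp), e, ε_eq,
    ← assoc (by simp) (by simp), ← assoc (by simp) (by simp), interchange (by simp) (by simp),
    seq_W rfl, W_seq rfl, mul_state (A := H) (n := 1) rfl rfl, cls_idn_one]

end Red
end QupitZX

/-! ### Multipliers as convolution powers of the wire. -/

namespace QupitZX
open Diag
section Multipliers

variable {p : ℕ} [Fact p.Prime]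
open Cls

theorem copy_ηr (a : ZMod p) : ηr a 0 ≫ Δ = ηr a 0 * ηr a 0 := by
  have h := cls_eq_of_derives (.copy a)
  rwa [cls_tensor, cls_sqrtP, one_mul, cls_seq, cls_tensor] at h

theorem bigebra : (Δ * Δ) ≫ (W * (swapC * W)) ≫ (N * N) = (N ≫ Δ : Cls p) := by
  have h := cls_eq_of_derives (Derives.bigebra (p := p))
  rwa [cls_tensor, cls_tensor, cls_sqrtP, cls_spow cls_sqrtP, one_mul, one_mul, cls_seq, cls_seq,
    cls_seq, cls_tensor, cls_tensor, cls_tensor, cls_tensor] at h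

/-- A red counit absorbs parallel edges. -/
theorem multiEdge_seq_εr (a b : ZMod p) (z : (ZMod p)ˣ) :
    cls (multiEdge (z : ZMod p).val) ≫ εr a b =
      εr (-a * (z : ZMod p)⁻¹) (b * ((z : ZMod p)⁻¹) ^ 2) := by
  have h := cls_eq_of_derives (.mElim a b z)
  rwa [cls_tensor, cls_spow cls_sqrtP, one_mul, cls_seq] at h

theorem cls_multiEdge_succ (n : ℕ) :
    cls (multiEdge (n + 1)) = (cls (gSplit (n + 1)) ≫ cls (rMerge n) : Cls p) := by
  have h : cls (green 1 (n + 1) 0 0) = (cls (gMerge 0) ≫ cls (gSplit (n + 1)) : Cls p) :=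
    cls_green_succ_zero_zero 0 (n + 1)
  rw [multiEdge, cls_seq, cls_red_succ_one, h, cls_gMerge_zero, W_seq rfl]

theorem cls_multiEdge_one : cls (multiEdge 1) = (anti : Cls p) := by
  have h := cls_multiEdge_succ (p := p) 0
  rw [cls_gSplit_one, cls_rMerge_zero, W_seq rfl] at h
  exact h

/-- (M-Elim) for `z = 1`: a green and a red vertex joined by a single edge are the antipode. -/
theorem anti_seq_εr (a b : ZMod p) : anti ≫ εr a b = εr (-a) b := by
  have h := multiEdge_seq_εr a b 1
  rw [Units.val_one, ZMod.val_one, cls_multiEdge_one] at h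
  simpa using h

theorem cup_H : cupC ≫ (W * H) = (cupC ≫ (H * W) : Cls p) :=
  cup_of_bend_swap rfl rfl bend_H_swap

theorem cup_anti : cupC ≫ (W * anti) = (cupC ≫ (anti * W) : Cls p) := by
  calc cupC ≫ (W * anti) = cupC ≫ (W * H) ≫ (W * H) := by
        rw [assoc (by simp) (by simp), W_mul_seq (by simp), H_seq_H]
    _ = cupC ≫ (W * H) ≫ (H * W) := by
        have e : (H * W) ≫ (W * H) = ((W * H) ≫ (H * W) : Cls p) := by
          rw [interchange (by simp) (by simp), interchange (by simp) (by simp), W_seq rfl,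
            seq_W rfl]
        rw [assoc (C := H * W) (by simp) (by simp), ← e, ← assoc (by simp) (by simp), ← cup_H]
    _ = _ := by
        rw [cup_H, assoc (by simp) (by simp), mul_W_seq (by simp), H_seq_H]

theorem ηr_seq_anti (a b : ZMod p) : ηr a b ≫ anti = ηr (-a) b := by
  symm
  calc ηr (-a) b = cupC ≫ (W * anti) ≫ (W * εr a b) := by
        rw [ηr_eq_cup, ← anti_seq_εr, ← W_mul_seq (by simp), assoc (by simp) (by simp)]
    _ = cupC ≫ (W * εr a b) ≫ anti := by
        rw [cup_anti, assoc (by simp) (by simp), assoc (by simp) (by simp)]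
        congr 1
        rw [interchange (by simp) (by simp), seq_W rfl, W_seq rfl,
          mul_effect (A := anti) (n := 1) rfl rfl, cls_idn_one]
    _ = _ := by rw [← ηr_eq_cup]

theorem H_H_H_H : H ≫ (H ≫ (H ≫ H)) = (W : Cls p) := by
  rw [H_seq_H, ← assoc rfl rfl, H_seq_H, anti_anti]

theorem seq_H_injective {A B : Cls p} (hA : A.cod = 1) (hB : B.cod = 1) (h : A ≫ H = B ≫ H) :
    A = B := by
  rw [← seq_W hA, ← seq_W hB, ← H_H_H_H, ← assoc (by simpa) (by simp), h,
    assoc (by simpa) (by simp)]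

theorem H_seq_injective {A B : Cls p} (hA : A.dom = 1) (hB : B.dom = 1) (h : H ≫ A = H ≫ B) :
    A = B := by
  have e : H ≫ H ≫ H ≫ H = (W : Cls p) := by
    rw [H_seq_H, assoc (by simp) (by simp), H_seq_H, anti_anti]
  rw [← W_seq hA, ← W_seq hB, ← e, assoc (by simp) (by simp [hA]), h,
    ← assoc (by simp) (by simp [hB])]

theorem η_seq_anti (a b : ZMod p) : η a b ≫ anti = η (-a) b := by
  refine seq_H_injective (by simp) (by simp) ?_
  have h := ηr_seq_anti (-a) b
  rw [ηr_eq, ηr_eq, neg_neg] at h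
  rw [← h, ← H_seq_H]
  simp [assoc]

theorem anti_seq_ε (a b : ZMod p) : anti ≫ ε a b = ε (-a) b := by
  refine H_seq_injective (by simp) (by simp) ?_
  have h := anti_seq_εr (-a) b
  rw [εr_eq', εr_eq', neg_neg] at h
  rw [← h, ← H_seq_H]
  simp [assoc]

theorem W_mul_ηr_seq_N : (W * ηr 0 0) ≫ N = (anti : Cls p) := by
  have h := W_mul_ηr_anti_seq_N (p := p)
  rwa [ηr_seq_anti, neg_zero] at h

theorem W_mul_state_swap (D : Diag p 0 1) : (W * cls D) ≫ swapC = cls D * W := by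
  rw [← swap_natural_state, assoc (by simp) (by simp), swap_swap, seq_WW (by simp)]

/-- The antipode is a homomorphism for the green comultiplication. -/
theorem anti_seq_Δ : anti ≫ Δ = Δ ≫ (anti * anti : Cls p) := by
  -- Plugging the red unit into the second input of the bigebra law turns the red multiplication
  -- into the antipode on one side; on the other side the unit is first copied and then does so
  -- twice.
  have h := congrArg (fun B => (W * ηr (0 : ZMod p) 0) ≫ B) bigebra
  have e : (W * ηr 0 0) ≫ ((Δ * Δ) ≫ (W * (swapC * W)) ≫ (N * N)) =
      (Δ ≫ (anti * anti) : Cls p) := by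
    rw [assoc (by simp) (by simp), ← assoc (by simp) (by simp), interchange (by simp) (by simp),
      W_seq rfl, copy_ηr, mul_state (n := 2) (by simp) (by simp), assoc (by simp) (by simp)]
    congr 1
    rw [← assoc (by simp) (by simp), cls_idn_two, mul_assoc, W_mul_seq (by simp), ← mul_assoc W,
      interchange (A := W * ηr 0 0) (B := swapC) (by simp) (by simp), W_mul_state_swap, seq_W rfl, mul_assoc, ← mul_assoc W,
      interchange (by simp) (by simp), W_mul_ηr_seq_N]
  beta_reduce at h
  rw [e, ← assoc (by simp) (by simp), W_mul_ηr_seq_N] at h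
  exact h.symm

theorem anti_seq_G (x y : ZMod p) : anti ≫ G x y = G (-x) y ≫ anti := by
  rw [← Δ_seq_W_mul_ε', ← assoc (by simp) (by simp), anti_seq_Δ, assoc (by simp) (by simp),
    interchange (by simp) (by simp), seq_W rfl, anti_seq_ε, ← Δ_seq_W_mul_ε',
    assoc (by simp) (by simp), mul_effect (A := anti) (n := 1) rfl rfl, cls_idn_one]

/-! ### Convolution -/

/-- The addition of the group structure. -/
abbrev A : Cls p := N ≫ anti

theorem A_eq : A = ((H * H) ≫ (M ≫ (H ≫ anti)) : Cls p) := by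
  rw [A, N_eq]
  simp [assoc]

theorem H_anti_seq_H : (H ≫ anti) ≫ H = (W : Cls p) := by
  rw [← H_H_H_H, ← H_seq_H]
  simp [assoc]

/-- `A` is the green multiplication conjugated by the Hadamard (with inverse `H ≫ anti`), so it
inherits associativity from `M_assoc`. -/
theorem A_assoc : (A * W) ≫ A = ((W * A) ≫ A : Cls p) := by
  have e1 : (A ≫ H : Cls p) = (H * H) ≫ M := by
    rw [A_eq, assoc (by simp) (by simp), assoc (by simp) (by simp), H_anti_seq_H, seq_W rfl]
  have e2 : (A * W) ≫ (H * H) = ((H * H * H) ≫ (M * W) : Cls p) := by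
    rw [interchange (by simp) (by simp), e1, W_seq rfl, interchange (by simp) (by simp), seq_W rfl]
  have e3 : (W * A) ≫ (H * H) = ((H * (H * H)) ≫ (W * M) : Cls p) := by
    rw [interchange (by simp) (by simp), e1, W_seq rfl, interchange (by simp) (by simp), seq_W rfl]
  calc (A * W) ≫ A = ((A * W) ≫ (H * H)) ≫ (M ≫ (H ≫ anti)) := by
        conv_lhs => rw [A_eq]
        rw [assoc (by simp) (by simp), A_eq]
    _ = (H * (H * H)) ≫ (((W * M) ≫ M) ≫ (H ≫ anti)) := by
        rw [e2, ← M_assoc]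
        simp [assoc, mul_assoc]
    _ = ((W * A) ≫ (H * H)) ≫ (M ≫ (H ≫ anti)) := by
        rw [e3]
        simp [assoc]
    _ = (W * A) ≫ A := by
        conv_rhs => rw [A_eq]
        rw [assoc (by simp) (by simp), A_eq]

/-- Convolution of endomorphisms. -/
abbrev conv (f g : Cls p) : Cls p := Δ ≫ (f * g) ≫ A

/-- The zero multiplier. -/
abbrev Z : Cls p := ε 0 0 ≫ ηr 0 0

theorem cls_natMult_zero : cls (natMult 0) = (Z : Cls p) := by
  rw [natMult, cls_tensor, cls_sqrtPInv, one_mul, cls_seq]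

theorem cls_natMult_succ (k : ℕ) : cls (natMult (k + 1)) = conv (cls (natMult k) : Cls p) W := by
  rw [natMult, cls_tensor, cls_sqrtP, one_mul, cls_seq, cls_seq, cls_seq, cls_tensor,
    assoc (by simp) (by simp)]

/-- Coassociativity of `Δ` on one end and associativity of `A` on the other. -/
theorem conv_assoc {f g h : Cls p} (hf : f.dom = 1 ∧ f.cod = 1) (hg : g.dom = 1 ∧ g.cod = 1)
    (hh : h.dom = 1 ∧ h.cod = 1) : conv (conv f g) h = conv f (conv g h) := by
  have e1 : conv f g * h = (Δ * W) ≫ ((f * g * h) ≫ (A * W)) := by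
    rw [interchange (by simp [*]) (by simp [*]), interchange (by simp [*]) (by simp [*]),
      seq_W hh.2, W_seq hh.1, ← assoc (by simp [*]) (by simp [*])]
  have e2 : f * conv g h = (W * Δ) ≫ ((f * (g * h)) ≫ (W * A)) := by
    rw [interchange (A := f) (by simp [*]) (by simp [*]),
      interchange (A := W) (by simp [*]) (by simp [*]),
      seq_W hf.2, W_seq hf.1, ← assoc (by simp [*]) (by simp [*])]
  unfold conv at e1 e2 ⊢
  rw [e1, e2, assoc (by simp [*]) (by simp [*]), assoc (by simp [*]) (by simp [*]),
    assoc (by simp [*]) (by simp [*]), A_assoc, ← assoc (by simp [*]) (by simp [*]), ← coassoc,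
    mul_assoc]
  simp [assoc, *]

theorem swap_seq_ε_mul_W (x y : ZMod p) : swapC ≫ (W * ε x y) = ε x y * W := by
  have e : cls (braid 1) = (swapC : Cls p) := by
    rw [braid, cls_seq, cls_tensor, cls_tensor, cls_idn_zero, one_mul, braid, seq_WW rfl]
  rw [← e, ← cls_tensor, ← cls_tensor, ← cls_seq _ _ rfl]
  refine (cls_eq_of_derives (Derives.swapNat (gCounit x y)).symm).trans ?_
  rw [cls_seq, braid, cls_tensor, seq_W (by simp)]

theorem Δ_seq_ε_mul_W : Δ ≫ (ε 0 0 * W) = (W : Cls p) := by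
  rw [← swap_seq_ε_mul_W, ← assoc (by simp) (by simp), Δ_swap, Δ_seq_W_mul_ε]

theorem η_mul_W_seq_M : (η 0 0 * W) ≫ M = (W : Cls p) := by
  have e : η 0 0 * Δ = (Δ ≫ (η 0 0 * W * W) : Cls p) := by
    rw [state_mul (m := 2) rfl rfl, cls_idn_two, mul_assoc]
  rw [M_eq, ← assoc (by simp) (by simp), interchange (by simp) (by simp), seq_W rfl, W_seq rfl, e,
    assoc (by simp) (by simp), mul_W_seq (by simp), state_W_cap, ← ε_eq, Δ_seq_ε_mul_W]

theorem ηr_mul_W_seq_A : (ηr 0 0 * W) ≫ A = (W : Cls p) := by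
  have e : ηr 0 0 ≫ H = (η 0 0 : Cls p) := by
    rw [ηr_eq, assoc (by simp) (by simp), H_seq_H, η_seq_anti, neg_zero, neg_zero]
  have e' : η 0 0 * H = (H ≫ (η 0 0 * W) : Cls p) := by
    rw [state_mul (m := 1) rfl rfl, cls_idn_one]
  rw [A_eq, ← assoc (by simp) (by simp), interchange (by simp) (by simp), e, W_seq rfl, e',
    assoc (by simp) (by simp), ← assoc (B := M) (by simp) (by simp), η_mul_W_seq_M,
    W_seq (by simp), H_seq_H.symm]
  exact H_H_H_H

theorem Z_conv {f : Cls p} (hf : f.dom = 1 ∧ f.cod = 1) : conv Z f = f := by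
  have e : Z * f = (ε 0 0 * W) ≫ (f ≫ (ηr 0 0 * W)) := by
    have h := state_mul (A := ηr (0 : ZMod p) 0) (m := 1) rfl hf.2
    rw [cls_idn_one] at h
    rw [← h, interchange (by simp) (by simp [*]), W_seq hf.1]
  rw [conv, e, assoc (by simp [*]) (by simp [*]), assoc (by simp [*]) (by simp [*]),
    assoc (by simp [*]) (by simp [*]), ηr_mul_W_seq_A, seq_W hf.2,
    ← assoc (by simp [*]) (by simp [*]), Δ_seq_ε_mul_W, W_seq hf.1]

theorem cls_natMult_one : cls (natMult 1) = (W : Cls p) := by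
  rw [cls_natMult_succ, cls_natMult_zero, Z_conv (by simp)]

/-- Multipliers are convolution powers of the wire. A positive second summand lets the induction
start at the wire itself. -/
theorem cls_natMult_add (k l : ℕ) :
    cls (natMult (k + (l + 1))) = (conv (cls (natMult k)) (cls (natMult (l + 1))) : Cls p) := by
  induction l with
  | zero => rw [zero_add, cls_natMult_one, cls_natMult_succ]
  | succ l ih =>
    rw [← add_assoc, cls_natMult_succ, ih, conv_assoc (by simp) (by simp) (by simp),
      ← cls_natMult_succ]

/-- Links the two descriptions of a multiplier: the axioms speak of parallel edges, the definition
is an iterated convolution. -/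
theorem cls_multiEdge_anti (n : ℕ) :
    cls (multiEdge (n + 1)) ≫ anti = (cls (natMult (n + 1)) : Cls p) := by
  induction n with
  | zero => rw [cls_multiEdge_one, anti_anti, cls_natMult_one]
  | succ n ih =>
    rw [cls_natMult_succ, ← ih, cls_multiEdge_succ, cls_multiEdge_succ, cls_gSplit_succ_succ,
      cls_rMerge_succ, conv, assoc (A := cls (gSplit (n + 1))) (by simp) (by simp),
      ← mul_W_seq (A := cls (gSplit (n + 1))) (by simp)]
    simp [assoc]

theorem cls_natMult_self : cls (natMult p) = (Z : Cls p) := by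
  obtain ⟨n, hn⟩ := Nat.exists_eq_succ_of_ne_zero (Fact.out : p.Prime).ne_zero
  have h := cls_eq_of_derives (.char (p := p))
  rw [cls_tensor, cls_spow cls_sqrtP, one_mul, cls_seq] at h
  have e := cls_multiEdge_anti (p := p) n
  rw [← Nat.succ_eq_add_one, ← hn, h, assoc (by simp) (by simp), ηr_seq_anti, neg_zero] at e
  exact e.symm

/-- By (Char) the multiplier `p` is the left unit `Z` of convolution, so copies of `p` can be peeled
off. The nonzero remainder keeps the last summand positive, as `cls_natMult_add` requires. -/
theorem cls_natMult_mod (k : ℕ) (hk : k % p ≠ 0) :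
    cls (natMult k) = (cls (natMult (k % p)) : Cls p) := by
  obtain ⟨l, hl⟩ := Nat.exists_eq_succ_of_ne_zero hk
  conv_lhs => rw [← Nat.div_add_mod k p]
  generalize k / p = j
  induction j with
  | zero => rw [mul_zero, zero_add]
  | succ j ih =>
    have e : p * (j + 1) + k % p = p + ((p * j + l) + 1) := by
      rw [hl, Nat.succ_eq_add_one]; ring
    rw [e, cls_natMult_add, cls_natMult_self, Z_conv (by simp), ← ih, hl]; rfl

/-! ### Multipliers are homomorphisms -/

theorem A_seq_Δ : A ≫ Δ = ((Δ * Δ) ≫ ((W * (swapC * W)) ≫ (A * A)) : Cls p) := by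
  rw [A, assoc (by simp) (by simp), anti_seq_Δ, ← assoc (by simp) (by simp), ← bigebra,
    assoc (by simp) (by simp), assoc (by simp) (by simp), interchange (by simp) (by simp)]

theorem Δ_seq_Δ_mul_Δ_seq_swap :
    Δ ≫ ((Δ * Δ) ≫ (W * (swapC * W))) = (Δ ≫ (Δ * Δ) : Cls p) := by
  have e : Δ ≫ (Δ * Δ) = (Δ ≫ (W * (Δ ≫ (Δ * W))) : Cls p) := by
    have h := mul_eq_seq_left (A := Δ) (B := (Δ : Cls p)) (n := 2) (m := 1) rfl rfl
    rw [cls_idn_one, cls_idn_two] at h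
    rw [h, ← assoc (by simp) (by simp), ← coassoc, assoc (by simp) (by simp), mul_assoc,
      W_mul_seq (by simp), coassoc]
  rw [← assoc (by simp) (by simp), e, assoc (by simp) (by simp), W_mul_seq (by simp),
    assoc (by simp) (by simp), mul_W_seq (by simp), Δ_swap]

theorem mul_seq_swap {f g : Cls p} (hf : f.dom = 1 ∧ f.cod = 1) (hg : g.dom = 1 ∧ g.cod = 1) :
    (f * g) ≫ swapC = swapC ≫ (g * f) := by
  have e : f * g = (f * W) ≫ (W * g) := by
    rw [interchange (by simp [*]) (by simp [*]), W_seq hg.1, seq_W hf.2]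
  have e' : g * f = (W * f) ≫ (g * W) := by
    rw [interchange (by simp [*]) (by simp [*]), W_seq hg.1, seq_W hf.2]
  rw [e, e', assoc (by simp [*]) (by simp [*]), W_mul_swap hg.1 hg.2,
    ← assoc (by simp [*]) (by simp [*]), swap_natural hf.1 hf.2, assoc (by simp [*]) (by simp [*])]

/-- By the bigebra law `A` is compatible with `Δ` up to a swap of the two middle wires, and
cocommutativity of `Δ` absorbs that swap. -/
theorem conv_seq_Δ {f g : Cls p} (hf : f.dom = 1 ∧ f.cod = 1) (hg : g.dom = 1 ∧ g.cod = 1)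
    (hf' : f ≫ Δ = Δ ≫ (f * f)) (hg' : g ≫ Δ = Δ ≫ (g * g)) :
    conv f g ≫ Δ = Δ ≫ (conv f g * conv f g) := by
  have e : (f * g) ≫ (Δ * Δ) = (Δ * Δ) ≫ ((f * f) * (g * g)) := by
    rw [interchange (by simp [*]) (by simp [*]), interchange (by simp [*]) (by simp [*]), hf', hg']
  have e' : ((f * f) * (g * g)) ≫ (W * (swapC * W)) = (W * (swapC * W)) ≫ ((f * g) * (f * g)) := by
    have h : (f * f) * (g * g) = f * ((f * g) * g) := by simp only [mul_assoc]
    have h' : (f * g) * (f * g) = f * ((g * f) * g) := by simp only [mul_assoc]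
    rw [h, h', interchange (by simp [*]) (by simp [*]), interchange (by simp [*]) (by simp [*]),
      interchange (by simp [*]) (by simp [*]), interchange (by simp [*]) (by simp [*]),
      mul_seq_swap hf hg, W_seq hf.1, W_seq hg.1, seq_W hf.2, seq_W hg.2]
  calc conv f g ≫ Δ = Δ ≫ ((f * g) ≫ ((Δ * Δ) ≫ ((W * (swapC * W)) ≫ (A * A)))) := by
        rw [conv, assoc (C := Δ) (by simp [*]) (by simp [*]), A_seq_Δ]
        simp [assoc, hf, hg]
    _ = Δ ≫ ((Δ * Δ) ≫ ((((f * f) * (g * g)) ≫ (W * (swapC * W))) ≫ (A * A))) := by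
        rw [← assoc (A := f * g) (by simp [*]) (by simp [*]), e]
        simp [assoc, hf, hg]
    _ = (Δ ≫ ((Δ * Δ) ≫ (W * (swapC * W)))) ≫ (((f * g) * (f * g)) ≫ (A * A)) := by
        rw [e']
        simp [assoc, hf, hg]
    _ = Δ ≫ ((Δ * Δ) ≫ (((f * g) * (f * g)) ≫ (A * A))) := by
        rw [Δ_seq_Δ_mul_Δ_seq_swap]
        simp [assoc, hf, hg]
    _ = _ := by
        rw [interchange (by simp [*]) (by simp [*]), interchange (by simp [*]) (by simp [*])]
        simp [assoc, hf, hg]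

theorem Z_seq_Δ : Z ≫ Δ = Δ ≫ (Z * Z : Cls p) := by
  have e : ε 0 0 * ε 0 0 = ((W * ε 0 0) ≫ ε 0 0 : Cls p) := by
    rw [mul_effect (B := ε 0 0) (n := 1) rfl rfl, cls_idn_one]
  rw [Z, assoc (by simp) (by simp), copy_ηr, ← interchange (by simp) (by simp), e,
    assoc (A := W * ε 0 0) (by simp) (by simp), ← assoc (A := Δ) (by simp) (by simp),
    Δ_seq_W_mul_ε, W_seq (by simp)]

theorem natMult_seq_Δ (k : ℕ) :
    cls (natMult k) ≫ Δ = Δ ≫ (cls (natMult k) * cls (natMult k) : Cls p) := by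
  induction k with
  | zero => rw [cls_natMult_zero, Z_seq_Δ]
  | succ k ih =>
    rw [cls_natMult_succ, conv_seq_Δ (by simp) (by simp) ih]
    rw [W_seq rfl, seq_WW rfl]

theorem seq_conv {f g h : Cls p} (hf : f.dom = 1 ∧ f.cod = 1) (hg : g.dom = 1 ∧ g.cod = 1)
    (hh : h.dom = 1 ∧ h.cod = 1) (hf' : f ≫ Δ = Δ ≫ (f * f)) :
    f ≫ conv g h = conv (f ≫ g) (f ≫ h) := by
  rw [conv, conv, ← interchange (by simp [*]) (by simp [*]), ← assoc (by simp [*]) (by simp [*]),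
    ← assoc (A := f) (by simp [*]) (by simp [*]), hf']
  simp [assoc, *]

/-- Precomposition with a comonoid homomorphism distributes over convolution, so a product of
multipliers is an iterated sum. -/
theorem natMult_seq_natMult (k l : ℕ) (hk : 0 < k) :
    cls (natMult k) ≫ cls (natMult (l + 1)) = (cls (natMult (k * (l + 1))) : Cls p) := by
  obtain ⟨j, rfl⟩ := Nat.exists_eq_succ_of_ne_zero hk.ne'
  induction l with
  | zero => rw [zero_add, mul_one, cls_natMult_one, seq_W (by simp)]
  | succ l ih =>
    rw [cls_natMult_succ (l + 1), seq_conv (by simp) (by simp) (by simp) (natMult_seq_Δ _), ih,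
      seq_W (by simp), mul_add _ (l + 1) 1, mul_one, cls_natMult_add]

/-- The multiplier with an invertible label. -/
abbrev mul' (z : (ZMod p)ˣ) : Cls p := cls (mult (z : ZMod p))

theorem val_units_pos (z : (ZMod p)ˣ) : 0 < (z : ZMod p).val :=
  Nat.pos_of_ne_zero fun h => z.ne_zero ((ZMod.val_eq_zero _).1 h)

theorem mul'_one : mul' 1 = (W : Cls p) := by
  rw [mul', mult, Units.val_one, ZMod.val_one, cls_natMult_one]

theorem mul'_seq_mul' (z w : (ZMod p)ˣ) : mul' z ≫ mul' w = mul' (z * w) := by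
  obtain ⟨l, hl⟩ := Nat.exists_eq_succ_of_ne_zero (val_units_pos w).ne'
  have e : ((z * w : (ZMod p)ˣ) : ZMod p).val = ((z : ZMod p).val * (w : ZMod p).val) % p := by
    rw [Units.val_mul, ZMod.val_mul]
  rw [mul', mul', mul', mult, mult, mult, e, ← cls_natMult_mod, hl]
  · exact natMult_seq_natMult _ _ (val_units_pos z)
  · rw [← e]
    exact (val_units_pos _).ne'

theorem mul'_seq_Δ (z : (ZMod p)ˣ) : mul' z ≫ Δ = Δ ≫ (mul' z * mul' z) := natMult_seq_Δ _

theorem mul'_eq (z : (ZMod p)ˣ) : mul' z = cls (multiEdge (z : ZMod p).val) ≫ anti := by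
  obtain ⟨l, hl⟩ := Nat.exists_eq_succ_of_ne_zero (val_units_pos z).ne'
  rw [mul', mult, hl]
  exact (cls_multiEdge_anti l).symm

theorem mul'_seq_εr (z : (ZMod p)ˣ) (a b : ZMod p) :
    mul' z ≫ εr a b = εr (a * (z : ZMod p)⁻¹) (b * ((z : ZMod p)⁻¹) ^ 2) := by
  rw [mul'_eq, assoc (by simp) (by simp), anti_seq_εr, multiEdge_seq_εr, neg_neg]

/-- The value of a green dot with quadratic label. -/
abbrev dot (y : ZMod p) : Cls p := cls (gDot 0 y)

theorem dot_mul_mul' (z : (ZMod p)ˣ) :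
    dot (z : ZMod p)⁻¹ * mul' z =
      H ≫ G 0 (z : ZMod p)⁻¹ ≫ (H ≫ G 0 z ≫ H) ≫ G 0 (z : ZMod p)⁻¹ := by
  have h := cls_eq_of_derives (.multRule z)
  rw [cls_tensor, cls_tensor, cls_tensor, cls_spow cls_sqrtP, cls_spow cls_sqrtP, one_mul, one_mul,
    cls_seq, cls_seq, cls_seq, cls_seq, ← mul'_eq, cls_red_one_one] at h
  rw [h, neg_zero]

end Multipliers
end QupitZX

/-! ### The scalars `Ω(x, z)` are phases. -/

namespace QupitZX
open Diag
section Scalars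

variable {p : ℕ} [Fact p.Prime]
open Cls

/-- Red Pauli states are copied by `Δ`, hence they are eigenstates of all green phases; the
eigenvalue is a scalar diagram. -/
theorem ηr_seq_G (c x y : ZMod p) : ηr c 0 ≫ G x y = (ηr c 0 ≫ ε x y) * ηr c 0 := by
  rw [← Δ_seq_W_mul_ε', ← assoc (by simp) (by simp), copy_ηr, interchange (by simp) (by simp),
    seq_W rfl, scalar_comm (s := ηr c 0 ≫ ε x y) (by simp) (by simp)]

theorem ε_add (a b c d : ZMod p) : ε (a + c) (b + d) = G a b ≫ ε c d := by
  rw [← G_seq_ε, ← G_seq_G, assoc (by simp) (by simp), G_seq_ε]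

theorem ηr_seq_ε_add (e a b c d : ZMod p) :
    ηr e 0 ≫ ε (a + c) (b + d) = (ηr e 0 ≫ ε a b) * (ηr e 0 ≫ ε c d) := by
  rw [ε_add, ← assoc (by simp) (by simp), ηr_seq_G, scalar_seq (by simp) (by simp)]

theorem ηr_seq_ε_zero : ηr 0 0 ≫ ε 0 0 = (1 : Cls p) := by
  have h := cls_sqrtP (p := p)
  have e : cls (rCounit 0 0) = H ≫ ε (-0 : ZMod p) 0 := εr_eq' 0 0
  rw [sqrtP, cls_seq, e] at h
  rw [← h, ηr_eq, neg_zero, assoc (by simp) (by simp)]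

/-- The value of a green and a red dot joined by a wire. -/
abbrev lam (c x : ZMod p) : Cls p := ηr c 0 ≫ ε x 0

/-- The Hadamard is its own transpose, so the two dots at its ends may be exchanged. -/
theorem lam_swap (c x : ZMod p) : lam c x = lam (-x) (-c) := by
  rw [lam, lam, ηr_eq, ηr_eq, neg_neg,
    η_seq_seq_ε (by simp) (by simp) isTranspose_H]

theorem cls_omegaDot (x z : ZMod p) : cls (omegaDot x z) = lam (-x) (-z) := by
  have e : cls (rCounit z 0) = H ≫ ε (-z) 0 := εr_eq' z 0
  rw [omegaDot, cls_seq, lam, ηr_eq, e, neg_neg, assoc (by simp) (by simp)]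

theorem lam_add (c x y : ZMod p) : lam c (x + y) = lam c x * lam c y := by
  have h := ηr_seq_ε_add c x 0 y 0
  rwa [add_zero] at h

/-- Additivity in the second label makes this scalar idempotent; additivity in the first label,
obtained through `lam_swap`, makes it invertible. -/
theorem lam_zero (c : ZMod p) : lam c 0 = 1 := by
  have h1 : lam c 0 * lam c 0 = lam c 0 := by rw [← lam_add, add_zero]
  have h2 : lam c 0 * lam (-c) 0 = 1 := by
    rw [lam_swap, lam_swap (-c), ← lam_add, neg_neg, neg_zero, neg_add_cancel]
    exact ηr_seq_ε_zero
  calc lam c 0 = lam c 0 * lam c 0 * lam (-c) 0 := by rw [mul_assoc, h2, mul_one]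
    _ = 1 := by rw [h1, h2]

/-- Only the scalars `Ω(s,1) ⊗ 1/√p` with `s ≠ 0` are elementary by definition. They have the value
`lam (-s) (-1)`, and the labels `s` and `-s` are inverse to each other. -/
theorem lam_neg_one (c : ZMod p) : lam c (-1) = 1 := by
  by_cases hc : c = 0
  · rw [hc, lam_swap, neg_zero, lam_zero]
  have h : ∀ x : (ZMod p)ˣ, IsElementary p (omegaDot (x : ZMod p) 1 ⊠ sqrtPInv) := fun x =>
    .base _ (Or.inl (Or.inr (Or.inr ⟨x, rfl⟩)))
  have e : ∀ x : ZMod p, cls (omegaDot x 1 ⊠ sqrtPInv) = lam (-x) (-1) := fun x => by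
    rw [cls_tensor, cls_sqrtPInv, mul_one, cls_omegaDot]
  have h1 := cls_eq_one_of_mul_eq_one (h (-Units.mk0 c hc)) (h (Units.mk0 c hc))
  simp only [Units.val_neg, Units.val_mk0] at h1
  rw [e, e, neg_neg] at h1
  refine h1 ?_
  rw [lam_swap, lam_swap (-c), ← lam_add, neg_neg c, neg_add_cancel, lam_zero]

theorem lam_eq_one (c x : ZMod p) : lam c x = 1 := by
  have h : ∀ n : ℕ, lam c (-(n : ZMod p)) = 1 := fun n => by
    induction n with
    | zero => rw [Nat.cast_zero, neg_zero, lam_zero]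
    | succ n ih => rw [Nat.cast_succ, neg_add, lam_add, ih, lam_neg_one, one_mul]
  have e := h (-x).val
  rwa [ZMod.natCast_zmod_val, neg_neg] at e

theorem cls_omegaDot_eq_one (x z : ZMod p) : cls (omegaDot x z) = 1 := by
  rw [cls_omegaDot, lam_eq_one]

theorem shear (a c d : ZMod p) : G a 0 ≫ (H ≫ G (-c) d ≫ H) ≫ G a 0 =
    H ≫ G (-(c + a * d)) d ≫ H := by
  have h := cls_eq_of_derives (.shear a c d)
  rwa [cls_tensor, cls_tensor, cls_omegaDot_eq_one, cls_omegaDot_eq_one, one_mul, one_mul, cls_seq,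
    cls_seq, cls_red_one_one, cls_red_one_one] at h

/-- Since `⋆` is invisible, (Gauss) says that all nondegenerate Gauss sums coincide. -/
theorem dot_unit (z : (ZMod p)ˣ) : dot (z : ZMod p) = cls gaussUnit := by
  have h := cls_eq_of_derives (.gauss z)
  rwa [cls_tensor, cls_spow cls_star, one_mul] at h

theorem dot_eq (y : ZMod p) : dot y = η 0 y ≫ ε 0 0 := by
  rw [dot, gDot, cls_seq]

end Scalars

/-! ### The group of invertible one-wire diagrams, and Gauss sums as phases. -/

section Wires

open Cls

variable (p : ℕ) [Fact p.Prime]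

/-- Classes of diagrams with one input and one output. -/
def Endo : Type := {A : Cls p // A.dom = 1 ∧ A.cod = 1}

variable {p}

instance : Monoid (Endo p) where
  mul A B := ⟨A.1 ≫ B.1, by simp [A.2, B.2]⟩
  one := ⟨W, by simp⟩
  mul_assoc A B C := Subtype.ext (Cls.assoc (by simp [A.2, B.2]) (by simp [B.2, C.2]))
  one_mul A := Subtype.ext (Cls.W_seq A.2.1)
  mul_one A := Subtype.ext (Cls.seq_W A.2.2)

theorem Endo.val_mul (A B : Endo p) : (A * B).1 = A.1 ≫ B.1 := rfl
/-- The class of a diagram with one input and one output. -/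
def endo (A : Diag p 1 1) : Endo p := ⟨cls A, by simp⟩

theorem endo_seq (A B : Diag p 1 1) : endo (A ⨟ B) = endo A * endo B := Subtype.ext (cls_seq _ _ _)

/-- A scalar next to a wire. -/
def scalarEndo (D : Diag p 0 0) : Endo p := ⟨cls D * W, by simp⟩

theorem scalarEndo_mul (D : Diag p 0 0) (A : Endo p) : (scalarEndo D * A).1 = cls D * A.1 := by
  rw [Endo.val_mul, scalarEndo, Cls.scalar_seq (by simp) (by simp [A.2]), Cls.W_seq A.2.1]

theorem scalarEndo_comm (D : Diag p 0 0) (A : Endo p) : scalarEndo D * A = A * scalarEndo D := by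
  refine Subtype.ext ?_
  rw [scalarEndo_mul, Endo.val_mul, scalarEndo, Cls.seq_scalar (by simp) (by simp [A.2]),
    Cls.seq_W A.2.2]

theorem endo_had_pow : endo had * endo had * (endo had * endo had) = (1 : Endo p) := by
  refine Subtype.ext ?_
  show (H ≫ H) ≫ (H ≫ H) = (W : Cls p)
  rw [H_seq_H, anti_anti]

/-- The Hadamard as a unit. -/
def hU : (Endo p)ˣ where
  val := endo had
  inv := endo had * (endo had * endo had)
  val_inv := by rw [← endo_had_pow, mul_assoc]
  inv_val := by rw [← endo_had_pow, mul_assoc, mul_assoc, mul_assoc]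

theorem endo_green_mul (a b c d : ZMod p) :
    endo (green 1 1 a b) * endo (green 1 1 c d) = endo (green 1 1 (a + c) (b + d)) :=
  Subtype.ext (G_seq_G a b c d)

theorem endo_green_zero : endo (green 1 1 0 0) = (1 : Endo p) := Subtype.ext G_zero_zero

/-- The green phase as a unit. -/
def gU (x y : ZMod p) : (Endo p)ˣ where
  val := endo (green 1 1 x y)
  inv := endo (green 1 1 (-x) (-y))
  val_inv := by rw [endo_green_mul, add_neg_cancel, add_neg_cancel, endo_green_zero]
  inv_val := by rw [endo_green_mul, neg_add_cancel, neg_add_cancel, endo_green_zero]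

/-- The multiplier as a unit. -/
def mU (z : (ZMod p)ˣ) : (Endo p)ˣ where
  val := endo (mult (z : ZMod p))
  inv := endo (mult (z⁻¹ : (ZMod p)ˣ))
  val_inv := Subtype.ext ((mul'_seq_mul' z z⁻¹).trans (by rw [mul_inv_cancel, mul'_one]; rfl))
  inv_val := Subtype.ext ((mul'_seq_mul' z⁻¹ z).trans (by rw [inv_mul_cancel, mul'_one]; rfl))

theorem hU_pow : (hU : (Endo p)ˣ) * hU * (hU * hU) = 1 := Units.ext endo_had_pow

theorem gU_mul (a b c d : ZMod p) : gU a b * gU c d = gU (a + c) (b + d) :=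
  Units.ext (endo_green_mul a b c d)

theorem gU_zero : gU 0 0 = (1 : (Endo p)ˣ) := Units.ext endo_green_zero

theorem gU_inv (a b : ZMod p) : (gU a b)⁻¹ = gU (-a) (-b) := by
  rw [inv_eq_iff_mul_eq_one, gU_mul, add_neg_cancel, add_neg_cancel, gU_zero]

theorem gU_zero_inv (b : ZMod p) : (gU 0 b)⁻¹ = gU 0 (-b) := by rw [gU_inv, neg_zero]

theorem mU_mul (z w : (ZMod p)ˣ) : mU z * mU w = mU (z * w) :=
  Units.ext (Subtype.ext (mul'_seq_mul' z w))

theorem hU_hU_gU (x y : ZMod p) : hU * hU * gU x y = gU (-x) y * (hU * hU) := by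
  refine Units.ext (Subtype.ext ?_)
  show (H ≫ H) ≫ G x y = G (-x) y ≫ (H ≫ H)
  rw [H_seq_H, anti_seq_G]

theorem shearU (a c d : ZMod p) : gU a 0 * (hU * gU (-c) d * hU) * gU a 0 =
    hU * gU (-(c + a * d)) d * hU := Units.ext (Subtype.ext (shear a c d))

theorem scalarEndo_mul_mU (z : (ZMod p)ˣ) :
    scalarEndo (gDot 0 (z : ZMod p)⁻¹) * (mU z).1 =
      ((hU * gU 0 (z : ZMod p)⁻¹ * (hU * gU 0 z * hU) * gU 0 (z : ZMod p)⁻¹ : (Endo p)ˣ) : Endo p) := by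
  refine Subtype.ext ?_
  rw [scalarEndo_mul]
  exact dot_mul_mul' z

theorem mU_one : mU 1 = (1 : (Endo p)ˣ) := by
  have h := mU_mul (1 : (ZMod p)ˣ) 1
  rw [mul_one] at h
  exact mul_eq_left.1 h

/-- To be read with `h` the Hadamard, `s = G(0,1)`, `m` the multiplier `-1` and `t` the central
scalar `Γ(0,1)`; `ht` and `htm` are then (Mult) for `z = 1` and `z = -1`. After a cyclic shift of
the first word the product telescopes, because `h²` commutes with `s` and `h⁴ = 1`. -/
theorem mul_mul_eq_of_braid {Γ : Type*} [Group Γ] {h s m t : Γ} (ha : h * h * s = s * (h * h))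
    (h4 : h * h * (h * h) = 1) (ht : t = h * s * (h * s * h) * s)
    (htm : t * m = h * s⁻¹ * (h * s⁻¹ * h) * s⁻¹) (hth : t * h = h * t) : t * m * t = h * h := by
  have h1 : t = s * h * s * h * s * h := by
    refine mul_left_cancel (a := h) ?_
    rw [← hth, ht]
    simp only [mul_assoc]
  calc t * m * t = h * s⁻¹ * h * (s⁻¹ * (h * h * s)) * h * s * h := by
        rw [htm]
        conv_lhs => rw [h1]
        group
    _ = h * s⁻¹ * (h * h * (h * h)) * s * h := by
        rw [ha]
        group
    _ = h * h := by
        rw [h4]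
        group

/-- As `t` commutes with `m`, the previous identity reads `t² m = h²`; squaring it gives `t⁴ = 1`.
-/
theorem pow_four_eq_one_of_braid {Γ : Type*} [Group Γ] {h s m t : Γ} (ha : h * h * s = s * (h * h))
    (h4 : h * h * (h * h) = 1) (ht : t = h * s * (h * s * h) * s)
    (htm : t * m = h * s⁻¹ * (h * s⁻¹ * h) * s⁻¹) (hth : t * h = h * t) (hmt : t * m = m * t)
    (hm : m * m = 1) : t ^ 4 = 1 := by
  have h3 : t * t * m = h * h := by
    rw [← mul_mul_eq_of_braid ha h4 ht htm hth, mul_assoc, hmt, ← mul_assoc, hmt]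
  calc t ^ 4 = t * t * (t * t) * (m * m) := by
        rw [hm, pow_succ, pow_succ, pow_two]
        simp only [mul_assoc, mul_one]
    _ = t * t * m * (t * t * m) := by
      have : t * t * m = m * (t * t) := by rw [mul_assoc, hmt, ← mul_assoc, hmt, mul_assoc]
      rw [mul_assoc _ m (t * t * m), ← mul_assoc m, ← mul_assoc m, mul_assoc m t t, ← this]
      simp only [mul_assoc]
    _ = 1 := by rw [h3, h4]

/-- When all Gauss sums agree, the instances `z = 1` and `z = -1` of (Mult) contain the same central
scalar, as the braid argument needs. -/
theorem gauss_pow_four (h : ∀ z : (ZMod p)ˣ, cls (gDot 0 (z : ZMod p)) = cls (gDot 0 (1 : ZMod p))) :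
    scalarEndo (gDot 0 (1 : ZMod p)) ^ 4 = 1 := by
  have h1 := scalarEndo_mul_mU (1 : (ZMod p)ˣ)
  have h2 := scalarEndo_mul_mU (-1 : (ZMod p)ˣ)
  have e : scalarEndo (gDot 0 (((-1 : (ZMod p)ˣ) : ZMod p)⁻¹)) =
      scalarEndo (gDot 0 (1 : ZMod p)) := by
    refine Subtype.ext (congrArg (· * W) ?_)
    rw [← Units.val_inv_eq_inv_val]
    exact h _
  rw [mU_one, Units.val_one, inv_one, Units.val_one, mul_one] at h1
  rw [e, Units.val_neg, Units.val_one, inv_neg, inv_one, ← gU_zero_inv] at h2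
  set t : (Endo p)ˣ := hU * gU 0 1 * (hU * gU 0 1 * hU) * gU 0 1 with ht
  have hc : ∀ A : (Endo p)ˣ, t * A = A * t := fun A => Units.ext <| by
    have e2 : (t : Endo p) * A = A * t := by rw [← h1, scalarEndo_comm]
    exact e2
  rw [h1] at h2 ⊢
  rw [← Units.val_pow_eq_pow_val, pow_four_eq_one_of_braid (h := hU) (s := gU 0 1) (m := mU (-1)) _
    hU_pow ht _ (hc _) (hc _) _, Units.val_one]
  · rw [hU_hU_gU, neg_zero]
  · exact Units.ext h2
  · rw [mU_mul, neg_one_mul, neg_neg, mU_one]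

/-- Quadratic Gauss sums are phases. -/
theorem dot_eq_one (z : (ZMod p)ˣ) : dot (z : ZMod p) = 1 := by
  by_cases h : p % 4 = 1
  · rw [dot_unit, gaussUnit, if_pos h, cls_tensor, cls_spow cls_star, cls_sqrtP, one_mul]
  · have h0 : ∀ z : (ZMod p)ˣ, dot (z : ZMod p) = dot 1 := fun z => by
      rw [dot_unit, gaussUnit, if_neg h]
    rw [h0]
    have h4 := congrArg Subtype.val (gauss_pow_four h0)
    have e : ∀ A : Endo p, (scalarEndo (gDot 0 1) * A).1 = dot 1 * A.1 := scalarEndo_mul _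
    rw [pow_succ', pow_succ', pow_two, e, e, e, scalarEndo] at h4
    -- Closing the wire by a red unit and a green counit, whose composite is 1, turns an identity of
    -- scalars beside a wire into one of scalars.
    have h5 := congrArg (fun A => ηr 0 0 ≫ A ≫ ε 0 0) h4
    simp only [← mul_assoc] at h5
    have h6 : (dot 1 * dot 1 * dot 1 * dot 1 : Cls p) = 1 := by
      rw [seq_scalar (by simp) (by simp), scalar_seq (by simp) (by simp)] at h5
      have e2 : (1 : Endo p).1 = W := rfl
      rw [e2, seq_W (by simp), ηr_seq_ε_zero, mul_one] at h5
      exact h5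
    have he : IsElementary p (imag p) := by
      refine .base _ (Or.inl (Or.inl ?_))
      rw [elemO, if_neg h]
      simp
    have h7 : cls (imag p) = dot 1 := by
      rw [imag, cls_tensor, cls_sqrtPInv, mul_one]
    rw [← h7]
    -- The inverse of `ι` is its own cube, which is again elementary.
    refine cls_eq_one_of_mul_eq_one he (.tensor _ _ he (.tensor _ _ he he)) ?_
    rw [cls_tensor, cls_tensor, h7, ← h6]
    simp only [mul_assoc]

end Wires
end QupitZX

/-! ### The Euler decomposition and the action of multipliers on quadratic phases. -/

namespace QupitZX
open Diag
section Squares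

variable {p : ℕ} [Fact p.Prime]
open Cls

/-- (Mult) after the Gauss sum in it has become 1: the Euler decomposition of a multiplier, on which
all later relations rest. -/
theorem mU_eq (z : (ZMod p)ˣ) :
    mU z = hU * gU 0 (z : ZMod p)⁻¹ * (hU * gU 0 z * hU) * gU 0 (z : ZMod p)⁻¹ := by
  have h := scalarEndo_mul_mU z
  have e : scalarEndo (gDot 0 (z : ZMod p)⁻¹) = 1 := by
    refine Subtype.ext ?_
    have h' := dot_eq_one z⁻¹
    rw [Units.val_inv_eq_inv_val] at h'
    show dot _ * W = W
    rw [h', one_mul]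
  rw [e, one_mul] at h
  exact Units.ext h

theorem mul'_eq_seq (z : (ZMod p)ˣ) :
    mul' z = H ≫ G 0 (z : ZMod p)⁻¹ ≫ (H ≫ G 0 z ≫ H) ≫ G 0 (z : ZMod p)⁻¹ :=
  congrArg (fun A : (Endo p)ˣ => A.1.1) (mU_eq z)

theorem seq_εr_of_isTranspose {B B' : Cls p} (hB : B.dom = 1 ∧ B.cod = 1)
    (hB' : B'.dom = 1 ∧ B'.cod = 1) (h : IsTranspose B B') (x y : ZMod p) :
    B ≫ εr x y = (W * (ηr x y ≫ B')) ≫ capC := by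
  have e : B ≫ (W * ηr x y) = (W * ηr x y) ≫ (B * W) := by
    rw [interchange (by simp [hB]) (by simp), W_seq hB.1, seq_W rfl,
      mul_state (n := 1) rfl hB.2, cls_idn_one]
  rw [εr_eq, ← assoc (by simp [hB]) (by simp), e, assoc (by simp [hB]) (by simp [hB]), h,
    ← assoc (by simp [hB']) (by simp [hB']), W_mul_seq (by simp [hB'])]

theorem ε_zero_eq (y : ZMod p) : η 0 0 ≫ ε 0 y = dot y := by
  rw [dot_eq, ← G_seq_ε, ← assoc (by simp) (by simp), η_seq_G, zero_add, zero_add]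

/-- The value of a green quadratic dot joined to a red dot. -/
abbrev kap (y : ZMod p) : Cls p := ηr 0 0 ≫ ε 0 y

theorem kap_add (x y : ZMod p) : kap (x + y) = kap x * kap y := by
  have h := ηr_seq_ε_add 0 0 x 0 y
  rwa [add_zero] at h

theorem kap_natCast (n : ℕ) : kap (n : ZMod p) = kap 1 ^ n := by
  induction n with
  | zero => rw [Nat.cast_zero, pow_zero]; exact ηr_seq_ε_zero
  | succ n ih => rw [Nat.cast_succ, kap_add, ih, pow_succ]

theorem G_seq_εr (y : ZMod p) : G 0 y ≫ εr 0 0 = kap y * εr 0 0 := by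
  have e : W * (kap y * ηr 0 0) = kap y * (W * ηr 0 0) := by
    have h := scalar_comm (s := kap y) (A := (W : Cls p)) (by simp) (by simp)
    rw [← mul_assoc, ← h, mul_assoc]
  rw [seq_εr_of_isTranspose (by simp) (by simp) (isTranspose_G 0 y), ηr_seq_G, e,
    scalar_seq (by simp) (by simp), ← εr_eq]

theorem H_seq_ε_zero : H ≫ ε 0 0 = (εr 0 0 : Cls p) := by rw [εr_eq', neg_zero]

theorem H_seq_εr_zero : H ≫ εr 0 0 = (ε 0 0 : Cls p) := by
  rw [← H_seq_ε_zero, ← assoc (by simp) (by simp), H_seq_H, anti_seq_ε, neg_zero]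

/-- Evaluate the Euler decomposition of the multiplier 1 between a green unit and a red counit. The
first and last phases each meet a red dot and contribute one factor; the middle one leaves `Γ(0,1) =
1`. -/
theorem kap_one_sq : kap 1 * kap 1 = (1 : Cls p) := by
  have h := mul'_eq_seq (1 : (ZMod p)ˣ)
  rw [mul'_one, Units.val_one, inv_one] at h
  have e1 : η 0 0 ≫ εr 0 0 = (1 : Cls p) := by
    rw [← H_seq_ε_zero, ← assoc (by simp) (by simp), ← ηr_seq_ε_zero, ηr_eq, neg_zero]
  have e2 : η 0 0 ≫ H = (ηr 0 0 : Cls p) := by rw [ηr_eq, neg_zero]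
  have e3 : ηr 0 0 ≫ H = (η 0 0 : Cls p) := by
    rw [← e2, assoc (by simp) (by simp), H_seq_H, η_seq_anti, neg_zero]
  have e4 : η 0 0 ≫ (G 0 1 ≫ ε 0 0) = (1 : Cls p) := by
    rw [G_seq_ε, ε_zero_eq]
    exact dot_eq_one 1
  have e5 : (W : Cls p) = H ≫ (G 0 1 ≫ (H ≫ (G 0 1 ≫ (H ≫ G 0 1)))) := by
    rw [h]
    simp [assoc]
  symm
  calc 1 = (η 0 0 ≫ W) ≫ (εr 0 0 : Cls p) := by rw [seq_W (by simp), e1]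
    _ = (η 0 0 ≫ H) ≫ (G 0 1 ≫ (H ≫ (G 0 1 ≫ (H ≫ (G 0 1 ≫ εr 0 0))))) := by
      rw [e5]
      simp [assoc]
    _ = (ηr 0 0 ≫ G 0 1) ≫ (H ≫ (G 0 1 ≫ (kap 1 * (H ≫ εr 0 0)))) := by
      rw [e2, G_seq_εr, seq_scalar (by simp) (by simp)]
      simp [assoc]
    _ = kap 1 * (kap 1 * (ηr 0 0 ≫ (H ≫ (G 0 1 ≫ ε 0 0)))) := by
      rw [ηr_seq_G, H_seq_εr_zero, seq_scalar (by simp) (by simp), seq_scalar (by simp) (by simp),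
        seq_scalar (by simp) (by simp), scalar_seq (by simp) (by simp)]
    _ = kap 1 * kap 1 := by
      rw [← assoc (by simp) (by simp), e3, e4, mul_one]

/-- `kap` turns sums into products, so `kap 1` has `p`-th power `kap 0 = 1`. Its square is 1 as well
and `p` is odd. -/
theorem kap_eq_one (hp : p ≠ 2) (y : ZMod p) : kap y = 1 := by
  have h1 : kap (1 : ZMod p) = 1 := by
    obtain ⟨k, hk⟩ := ((Fact.out : p.Prime).odd_of_ne_two hp)
    have h := kap_natCast (p := p) p
    have e : kap (1 : ZMod p) ^ p = kap 1 ^ (2 * k + 1) := congrArg _ hk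
    rw [ZMod.natCast_self, e, pow_succ, pow_mul, pow_two, kap_one_sq, one_pow, one_mul] at h
    rw [← h]
    exact ηr_seq_ε_zero
  rw [← ZMod.natCast_zmod_val y, kap_natCast, h1, one_pow]

theorem G_seq_εr_zero (hp : p ≠ 2) (y : ZMod p) : G 0 y ≫ εr 0 0 = εr 0 0 := by
  rw [G_seq_εr, kap_eq_one hp, one_mul]

/-- Apply the Euler decomposition to the plain red counit. The multiplier fixes it and the last
phase is absorbed; cancelling the first Hadamard and phase leaves a conversion of quadratic effects
between the colours that inverts the label. -/
theorem εr_units (hp : p ≠ 2) (z : (ZMod p)ˣ) : εr 0 (z : ZMod p) = ε 0 (-(z : ZMod p)⁻¹) := by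
  have h := mul'_seq_εr z 0 0
  have h' := mul'_eq_seq z
  rw [zero_mul, zero_mul] at h
  generalize (z : ZMod p)⁻¹ = t at h' ⊢
  rw [h', assoc (by simp) (by simp), G_seq_εr_zero hp,
    assoc (by simp) (by simp), assoc (by simp) (by simp), assoc (by simp) (by simp),
    assoc (by simp) (by simp), H_seq_εr_zero, ← H_seq_ε_zero] at h
  have h1 := H_seq_injective (by simp) (by simp) h
  have h2 := congrArg (fun B => G 0 (-t) ≫ B) h1
  beta_reduce at h2
  rw [← assoc (by simp) (by simp), G_seq_G, add_zero, neg_add_cancel, G_zero_zero,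
    W_seq (by simp), G_seq_ε, G_seq_ε] at h2
  rw [εr_eq', neg_zero]
  exact h2

/-- A nonzero green quadratic label is converted to red, where (M-Elim) rescales it by `w⁻²`, and
converted back; the inversion turns this into `w²`. -/
theorem mul'_seq_ε (hp : p ≠ 2) (w : (ZMod p)ˣ) (y : ZMod p) (hy : y ≠ 0) :
    mul' w ≫ ε 0 y = ε 0 ((w : ZMod p) ^ 2 * y) := by
  have h := mul'_seq_εr w 0 (-y⁻¹)
  rw [zero_mul] at h
  have h1 := εr_units hp (-(Units.mk0 y hy)⁻¹)
  have h2 := εr_units hp (-(Units.mk0 y hy)⁻¹ * (w⁻¹) ^ 2)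
  simp only [Units.val_neg, Units.val_inv_eq_inv_val, Units.val_mk0, Units.val_mul,
    Units.val_pow_eq_pow_val, inv_neg, inv_inv, neg_neg, neg_mul, mul_inv, inv_pow] at h1 h2
  rw [h1, neg_mul, inv_pow, h2] at h
  rw [h, mul_comm]

/-- The phase is a capped `Δ`, the multiplier is copied by `Δ`, and one of the copies acts on the
effect through `mul'_seq_ε`. -/
theorem mU_mul_gU (hp : p ≠ 2) (w : (ZMod p)ˣ) (y : ZMod p) :
    mU w * gU 0 y = gU 0 ((w : ZMod p) ^ 2 * y) * mU w := by
  by_cases hy : y = 0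
  · rw [hy, mul_zero, gU_zero, mul_one, one_mul]
  refine Units.ext (Subtype.ext ?_)
  show mul' w ≫ G 0 y = G 0 _ ≫ mul' w
  rw [← Δ_seq_W_mul_ε', ← Δ_seq_W_mul_ε', ← assoc (by simp) (by simp), mul'_seq_Δ,
    assoc (by simp) (by simp), interchange (by simp) (by simp), seq_W rfl, mul'_seq_ε hp w y hy,
    assoc (by simp) (by simp), mul_effect (A := mul' w) (n := 1) rfl rfl, cls_idn_one]

end Squares
end QupitZX

/-! ### Relations of the affine `SL₂(ℤ_p)` and existence of normal forms. -/

namespace QupitZX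
open Diag
section CliffordRelations

variable {p : ℕ} [Fact p.Prime]

/-- The Hadamard conjugate of a green phase: a red phase without its antipode. -/
def rU (u v : ZMod p) : (Endo p)ˣ := hU * gU (-u) v * hU⁻¹

theorem rU_mul (a b c d : ZMod p) : rU a b * rU c d = rU (a + c) (b + d) := by
  have h : hU * gU (-a) b * hU⁻¹ * (hU * gU (-c) d * hU⁻¹) =
      hU * (gU (-a) b * gU (-c) d) * hU⁻¹ := by group
  rw [rU, rU, h, gU_mul, ← neg_add]; rfl

theorem rU_inv (a b : ZMod p) : (rU a b)⁻¹ = rU (-a) (-b) := by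
  rw [inv_eq_iff_mul_eq_one, rU_mul, add_neg_cancel, add_neg_cancel, rU, neg_zero, gU_zero]
  group

theorem hU_hU_mul (x y : ZMod p) : gU x y * (hU * hU) = hU * hU * gU (-x) y := by
  rw [hU_hU_gU, neg_neg]

theorem hU_mul_gU (x y : ZMod p) : hU * gU x y = rU (-x) y * hU := by
  rw [rU, neg_neg]; group

theorem hU_mul_rU (x y : ZMod p) : hU * rU x y = gU x y * hU := by
  have h : hU * rU x y = hU * hU * gU (-x) y * hU⁻¹ := by rw [rU]; group
  rw [h, ← hU_hU_mul]; group

theorem rU_mul_hU_hU (x y : ZMod p) : rU x y * (hU * hU) = hU * hU * rU (-x) y := by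
  rw [mul_assoc hU hU, hU_mul_rU, ← mul_assoc hU, hU_mul_gU, neg_neg, mul_assoc]

theorem red_eq (u v : ZMod p) : hU * gU (-u) v * hU = rU u v * (hU * hU) := by
  rw [rU]; group

/-- (Shear) once the antipode `hU * hU` hidden in a red phase is moved to the right end; crossing it
changes the sign of the last green label. -/
theorem gU_mul_rU (x c d : ZMod p) : gU x 0 * rU c d = rU (c + x * d) d * gU x 0 := by
  have h := shearU x c d
  rw [red_eq, red_eq, mul_assoc, mul_assoc, hU_hU_gU, ← mul_assoc, ← mul_assoc] at h
  have h' := mul_right_cancel h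
  rw [← h', mul_assoc _ (gU (-x) 0), gU_mul, neg_add_cancel, add_zero, gU_zero, mul_one]

theorem rU_mul_gU (x c d : ZMod p) : rU x 0 * gU c d = gU (c - x * d) d * rU x 0 := by
  refine mul_left_cancel (a := hU) ?_
  rw [← mul_assoc, ← mul_assoc, hU_mul_rU, hU_mul_gU, mul_assoc, mul_assoc, hU_mul_gU, hU_mul_rU,
    ← mul_assoc, ← mul_assoc, gU_mul_rU, neg_sub, neg_add_eq_sub]

theorem gU_eq_mul (x y : ZMod p) : gU x y = gU x 0 * gU 0 y := by rw [gU_mul, add_zero, zero_add]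

theorem gU_zero_mul_rU (y u : ZMod p) : gU 0 y * rU u 0 = gU (u * y) 0 * rU u 0 * gU 0 y := by
  have h := rU_mul_gU u (u * y) y
  rw [sub_self] at h
  rw [← h, gU_eq_mul, ← mul_assoc, rU_mul_gU, mul_zero, sub_zero]

/-- The braid identity again, now with the Gauss sum `t` equal to 1. -/
theorem mU_neg_one : mU (-1) = (hU * hU : (Endo p)ˣ) := by
  have h1 := mU_eq (1 : (ZMod p)ˣ)
  have h2 := mU_eq (-1 : (ZMod p)ˣ)
  rw [mU_one, Units.val_one, inv_one] at h1
  rw [Units.val_neg, Units.val_one, inv_neg, inv_one, ← gU_zero_inv] at h2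
  have h := mul_mul_eq_of_braid (h := (hU : (Endo p)ˣ)) (s := gU 0 1) (m := mU (-1)) (t := 1)
    (by rw [hU_hU_gU, neg_zero]) hU_pow h1 (by rw [one_mul, h2]) (by rw [one_mul, mul_one])
  rwa [one_mul, mul_one] at h

/-- The linear phase is pushed leftwards through the Euler word. Each Hadamard changes its colour
and each quadratic phase it crosses in red splits off a green linear phase; the unwanted terms
cancel because `a * b = 1`. -/
theorem mU_mul_gU_zero (w : (ZMod p)ˣ) (x : ZMod p) :
    mU w * gU x 0 = gU ((w : ZMod p) * x) 0 * mU w := by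
  have e1 : ∀ y : ZMod p, gU 0 y * gU x 0 = gU x 0 * gU 0 y := fun y => by
    rw [gU_mul, gU_mul, add_comm, add_comm y]
  rw [mU_eq w]
  have hw : (w : ZMod p) * (w : ZMod p)⁻¹ = 1 := mul_inv_cancel₀ w.ne_zero
  generalize (w : ZMod p)⁻¹ = b at hw ⊢
  generalize (w : ZMod p) = a at hw ⊢
  have e2 : gU (-x * a) 0 * rU (-x) 0 = rU (-x) 0 * gU (-x * a) 0 := by
    rw [rU_mul_gU, mul_zero, sub_zero]
  calc hU * gU 0 b * (hU * gU 0 a * hU) * gU 0 b * gU x 0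
      = hU * gU 0 b * hU * gU 0 a * (hU * gU x 0) * gU 0 b := by
        rw [mul_assoc _ _ (gU x 0), e1]; simp only [mul_assoc]
    _ = hU * gU 0 b * hU * (gU 0 a * rU (-x) 0) * hU * gU 0 b := by
        rw [hU_mul_gU x]; simp only [mul_assoc]
    _ = hU * gU 0 b * (hU * rU (-x) 0) * gU (-x * a) 0 * gU 0 a * hU * gU 0 b := by
        rw [gU_zero_mul_rU, e2]; simp only [mul_assoc]
    _ = hU * (gU 0 b * gU (-x) 0) * (hU * gU (-x * a) 0) * gU 0 a * hU * gU 0 b := by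
        rw [hU_mul_rU]; simp only [mul_assoc]
    _ = hU * gU (-x) 0 * (gU 0 b * rU (x * a) 0) * hU * gU 0 a * hU * gU 0 b := by
        rw [hU_mul_gU (-x * a), neg_mul, neg_neg, gU_mul, add_comm, add_comm b, ← gU_mul (-x) 0 0]
        simp only [mul_assoc]
    _ = hU * (gU (-x) 0 * gU (x * a * b) 0) * rU (x * a) 0 * gU 0 b * hU * gU 0 a * hU *
          gU 0 b := by
        rw [gU_zero_mul_rU]; simp only [mul_assoc]
    _ = (hU * rU (x * a) 0) * gU 0 b * hU * gU 0 a * hU * gU 0 b := by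
        rw [mul_assoc x, hw, mul_one, gU_mul, neg_add_cancel, add_zero, gU_zero, mul_one]
    _ = _ := by
        rw [hU_mul_rU, mul_comm x]; simp only [mul_assoc]

/-- The Euler decomposition solved for its tail. It is the `SL₂` identity rewriting shear · Weyl
element as opposite shear · diagonal · shear, which drives the reduction to normal form. -/
theorem gU_mul_hU (z : (ZMod p)ˣ) : gU 0 (z : ZMod p) * hU =
    rU 0 (-((z⁻¹ : (ZMod p)ˣ) : ZMod p)) * mU (-z) * gU 0 (-((z⁻¹ : (ZMod p)ˣ) : ZMod p)) := by
  have h := mU_eq z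
  rw [← Units.val_inv_eq_inv_val, hU_mul_gU, neg_zero] at h
  have e : mU (-z) = hU * hU * mU z := by
    rw [← mU_neg_one, mU_mul, neg_one_mul]
  have e' := rU_mul_hU_hU (0 : ZMod p) (-((z⁻¹ : (ZMod p)ˣ) : ZMod p))
  rw [neg_zero] at e'
  rw [e, ← mul_assoc (rU _ _), e', h, ← gU_zero_inv]
  have e2 := rU_inv (0 : ZMod p) ((z⁻¹ : (ZMod p)ˣ) : ZMod p)
  rw [neg_zero] at e2
  have e3 := hU_pow (p := p)
  rw [← e2, ← one_mul (gU 0 (z : ZMod p) * hU), ← e3]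
  group

variable (hp : p ≠ 2)
include hp

/-- The Euler words of `z` and `z⁻¹` are shifts of one alternating word. Appending `H G(0,z)` to the
first exposes the second as a suffix, and `mU_mul_gU` moves the leftover phase across. -/
theorem mU_mul_hU (z : (ZMod p)ˣ) : mU z * hU = hU * mU z⁻¹ := by
  have h1 := mU_eq z
  have h2 := mU_eq z⁻¹
  have e : ((z⁻¹ : (ZMod p)ˣ) : ZMod p)⁻¹ = z := by rw [← Units.val_inv_eq_inv_val, inv_inv]
  have e' := mU_mul_gU hp z⁻¹ (z : ZMod p)
  rw [e] at h2
  rw [← Units.val_inv_eq_inv_val] at h1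
  have e2 : ((z⁻¹ : (ZMod p)ˣ) : ZMod p) ^ 2 * z = (z⁻¹ : (ZMod p)ˣ) := by
    rw [pow_two, mul_assoc, Units.inv_mul, mul_one]
  rw [e2] at e'
  refine mul_right_cancel (b := gU 0 (z : ZMod p)) ?_
  rw [mul_assoc hU, e', h2]
  conv_lhs => rw [h1]
  simp only [mul_assoc]

theorem mU_mul_gU' (w : (ZMod p)ˣ) (x y : ZMod p) :
    mU w * gU x y = gU ((w : ZMod p) * x) ((w : ZMod p) ^ 2 * y) * mU w := by
  rw [gU_eq_mul x, ← mul_assoc, mU_mul_gU_zero, mul_assoc, mU_mul_gU hp, ← mul_assoc, gU_mul,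
    add_zero, zero_add]

/-- The last clause records that linear phases stay linear, which is what lets a multiplier pass the
phase `gU s 0`. -/
theorem gU_mul_mU (w : (ZMod p)ˣ) (x y : ZMod p) :
    ∃ x' y', gU x y * mU w = mU w * gU x' y' ∧ (y = 0 → y' = 0) := by
  refine ⟨((w⁻¹ : (ZMod p)ˣ) : ZMod p) * x, ((w⁻¹ : (ZMod p)ˣ) : ZMod p) ^ 2 * y, ?_, fun h => by
    rw [h, mul_zero]⟩
  rw [mU_mul_gU' hp, ← mul_assoc, ← mul_assoc, ← mul_pow, Units.mul_inv, one_pow, one_mul, one_mul]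

theorem rU_mul_mU (w : (ZMod p)ˣ) (x y : ZMod p) : ∃ x' y', rU x y * mU w = mU w * rU x' y' := by
  obtain ⟨x', y', h, -⟩ := gU_mul_mU hp w⁻¹ (-x) y
  refine ⟨-x', y', ?_⟩
  have e := mU_mul_hU hp w
  have e' : hU⁻¹ * mU w = mU w⁻¹ * hU⁻¹ := by
    rw [inv_mul_eq_iff_eq_mul, ← mul_assoc, ← e]; group
  rw [rU, rU, neg_neg, mul_assoc, e', ← mul_assoc, mul_assoc hU, h, ← mul_assoc, ← e]
  group

/-! ### Normal forms -/

/-- Products of a multiplier, a red phase, a green phase and possibly a Hadamard. -/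
def IsNormal (X : (Endo p)ˣ) : Prop :=
  (∃ w u v s t, X = mU w * rU u v * gU s t) ∨ ∃ w u v s, X = mU w * rU u v * gU s 0 * hU

/-- Brings a multiplier that has appeared in the middle of a word back to the front. -/
theorem isNormal_lower_mul_mU (w w' : (ZMod p)ˣ) (u v s t : ZMod p) :
    ∃ u' v' s', mU w * rU u v * gU s 0 * mU w' * gU 0 t = mU (w * w') * rU u' v' * gU s' t := by
  obtain ⟨s', y', h, hy⟩ := gU_mul_mU hp w' s 0
  obtain ⟨u', v', h'⟩ := rU_mul_mU hp w' u v
  refine ⟨u', v', s', ?_⟩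
  rw [mul_assoc _ _ (mU w'), h, hy rfl, mul_assoc (mU w), ← mul_assoc (rU u v), h', ← mU_mul,
    gU_eq_mul s' t]
  simp only [mul_assoc]

omit hp in
theorem IsNormal.mul_gU {X : (Endo p)ˣ} (h : IsNormal X) (x y : ZMod p) :
    IsNormal (X * gU x y) := by
  rcases h with ⟨w, u, v, s, t, rfl⟩ | ⟨w, u, v, s, rfl⟩
  · exact Or.inl ⟨w, u, v, s + x, t + y, by rw [mul_assoc, gU_mul]⟩
  -- The Hadamard turns the new phase red; shearing it past `gU s 0` adds `s * y` to its linear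
  -- label.
  · refine Or.inr ⟨w, u + (-x + s * y), v + y, s, ?_⟩
    rw [mul_assoc, hU_mul_gU, ← mul_assoc, mul_assoc _ _ (rU _ _), gU_mul_rU, ← mul_assoc,
      mul_assoc _ (rU u v), rU_mul]

/-- Exchange of Bruhat cells: a Hadamard sends `t = 0` to the second family, `t ≠ 0` remains in the
big cell by `gU_mul_hU`, and a second Hadamard completes the multiplier `-1`. -/
theorem IsNormal.mul_hU {X : (Endo p)ˣ} (h : IsNormal X) : IsNormal (X * hU) := by
  rcases h with ⟨w, u, v, s, t, rfl⟩ | ⟨w, u, v, s, rfl⟩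
  · by_cases ht : t = 0
    · exact Or.inr ⟨w, u, v, s, by rw [ht]⟩
    · have e := gU_mul_hU (Units.mk0 t ht)
      rw [Units.val_mk0] at e
      generalize (-(((Units.mk0 t ht)⁻¹ : (ZMod p)ˣ) : ZMod p)) = c at e
      obtain ⟨u', v', s', h'⟩ :=
        isNormal_lower_mul_mU hp w (-Units.mk0 t ht) (u + (0 + s * c)) (v + c) s c
      refine Or.inl ⟨_, u', v', s', _, Eq.trans ?_ h'⟩
      rw [gU_eq_mul s t, mul_assoc, mul_assoc _ _ hU, e, ← rU_mul u v, ← mul_assoc (mU w),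
        mul_assoc _ (rU (0 + s * c) c), ← gU_mul_rU]
      simp only [mul_assoc]
  · obtain ⟨u', v', s', h'⟩ := isNormal_lower_mul_mU hp w (-1) u v s 0
    refine Or.inl ⟨_, u', v', s', _, Eq.trans ?_ h'⟩
    rw [mU_neg_one, gU_zero, mul_one, mul_assoc]

/-- By the Euler decomposition multipliers are words in Hadamards and green phases, so stability
under these two kinds of generators suffices. -/
theorem IsNormal.mul_endo {A : Diag p 1 1} (hA : IsC1 p A) :
    ∃ Y : (Endo p)ˣ, Y.1 = endo A ∧ ∀ X : (Endo p)ˣ, IsNormal X → IsNormal (X * Y) := by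
  have hm : ∀ (w : (ZMod p)ˣ) (X : (Endo p)ˣ), IsNormal X → IsNormal (X * mU w) := by
    intro w X hX
    rw [mU_eq w]
    simp only [← mul_assoc]
    exact (((((hX.mul_hU hp).mul_gU _ _).mul_hU hp).mul_gU _ _).mul_hU hp).mul_gU _ _
  induction hA with
  | wire => exact ⟨1, rfl, fun X hX => by rwa [mul_one]⟩
  | redPhase x y =>
    refine ⟨hU * gU (-x) y * hU, Subtype.ext (cls_red_one_one x y).symm, fun X hX => ?_⟩
    simp only [← mul_assoc]
    exact ((hX.mul_hU hp).mul_gU _ _).mul_hU hp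
  | greenPhase x y => exact ⟨gU x y, rfl, fun X hX => hX.mul_gU x y⟩
  | mult w => exact ⟨mU w, rfl, hm w⟩
  | hbox w =>
    refine ⟨mU w * hU, (endo_seq _ _).symm, fun X hX => ?_⟩
    rw [← mul_assoc]
    exact (hm w X hX).mul_hU hp
  | seq A B _ _ hA hB =>
    obtain ⟨Y, hY, hY'⟩ := hA
    obtain ⟨Y', hY1, hY1'⟩ := hB
    refine ⟨Y * Y', by rw [Units.val_mul, hY, hY1, endo_seq], fun X hX => ?_⟩
    rw [← mul_assoc]
    exact hY1' _ (hY' X hX)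

/-- Every single-qupit Clifford diagram has a normal form. -/
theorem exists_normalForm {A : Diag p 1 1} (hA : IsC1 p A) :
    ∃ N : NormalForm p, EqUpToScalar p A N.toDiag := by
  obtain ⟨Y, hY, h⟩ := IsNormal.mul_endo hp hA
  have h1 : IsNormal (1 : (Endo p)ˣ) := by
    refine Or.inl ⟨1, 0, 0, 0, 0, ?_⟩
    rw [mU_one, gU_zero, rU, neg_zero, gU_zero]
    group
  have hN := h 1 h1
  rw [one_mul] at hN
  have hr : ∀ u v : ZMod p, endo (red 1 1 u v) = ((rU u v * (hU * hU) : (Endo p)ˣ) : Endo p) :=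
    fun u v => by
      rw [← red_eq]
      exact Subtype.ext (cls_red_one_one u v)
  have key : ∀ N : NormalForm p, endo A = endo N.toDiag → EqUpToScalar p A N.toDiag :=
    fun N h => eqUpToScalar_of_cls_eq (congrArg Subtype.val h)
  rcases hN with ⟨w, u, v, s, t, e⟩ | ⟨w, u, v, s, e⟩
  -- A diagrammatic red phase carries an extra antipode, which is the multiplier `-1`; moving it to
  -- the front changes the signs of `u` and `w`.
  · refine ⟨.first s t (-u) v (-w), key _ ?_⟩
    rw [← hY, e, NormalForm.toDiag, endo_seq, endo_seq, hr]
    refine congrArg Units.val (?_ : _ = mU (-w) * (rU (-u) v * (hU * hU)) * gU s t)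
    rw [rU_mul_hU_hU, neg_neg, ← mU_neg_one, ← mul_assoc (mU (-w)), mU_mul, mul_neg, mul_one,
      neg_neg]
  -- The final `G(0,1); R(0,1)` equals a Hadamard up to antipodes and the phase `rU 0 (-1)`. The
  -- shift `v + 1` compensates that phase, `u + s` compensates moving it past `gU s 0`, and the
  -- antipodes account for `-s`.
  · refine ⟨.second (-s) (u + s) (v + 1) w, key _ ?_⟩
    rw [← hY, e, NormalForm.toDiag, endo_seq, endo_seq, endo_seq, hr, hr]
    refine congrArg Units.val
      (?_ : _ = mU w * (rU (u + s) (v + 1) * (hU * hU)) * gU (-s) 1 * (rU 0 1 * (hU * hU)))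
    have e1 := mU_eq (1 : (ZMod p)ˣ)
    rw [mU_one, Units.val_one, inv_one] at e1
    have e3 : rU 0 1 * (hU * hU) = (hU * gU 0 1 * hU : (Endo p)ˣ) := by rw [← red_eq, neg_zero]
    have e4 : rU 0 (-1) * hU = (hU * (gU 0 1)⁻¹ : (Endo p)ˣ) := by
      rw [gU_zero_inv, hU_mul_gU, neg_zero]
    -- With `x = G(0,1)`, the Euler relation for the multiplier 1 gives `x h x h = h⁻¹ x⁻¹`, and
    -- `h⁻¹ = h³`.
    have e2 : gU 0 1 * (rU 0 1 * (hU * hU)) = (hU * hU) * (rU 0 (-1) * hU : (Endo p)ˣ) := by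
      rw [e3, e4]
      generalize gU (0 : ZMod p) 1 = x at e1 ⊢
      have e5 : x * (hU * x * hU) = hU⁻¹ * (hU * x * (hU * x * hU) * x) * x⁻¹ := by group
      have e6 : (hU⁻¹ : (Endo p)ˣ) = hU * hU * hU := by
        rw [inv_eq_iff_mul_eq_one, ← hU_pow (p := p)]
        simp only [mul_assoc]
      rw [e5, ← e1, e6]
      simp only [mul_assoc, one_mul]
    have e7 := hU_pow (p := p)
    rw [gU_eq_mul (-s) 1, mul_assoc _ _ (rU 0 1 * _), mul_assoc (gU (-s) 0) (gU 0 1), e2]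
    have e8 : hU * hU * gU (-s) 0 * (hU * hU) = (gU s 0 : (Endo p)ˣ) := by
      rw [hU_hU_gU, neg_neg, mul_assoc, e7, mul_one]
    calc mU w * rU u v * gU s 0 * hU
        = mU w * (rU (u + s) (v + 1) * rU (0 + s * -1) (-1)) * gU s 0 * hU := by
          rw [rU_mul]
          congr 4 <;> ring
      _ = mU w * rU (u + s) (v + 1) * (gU s 0 * rU 0 (-1)) * hU := by
          rw [gU_mul_rU]
          simp only [mul_assoc]
      _ = mU w * rU (u + s) (v + 1) * (hU * hU * gU (-s) 0 * (hU * hU)) * rU 0 (-1) * hU := by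
          rw [e8]
          simp only [mul_assoc]
      _ = _ := by simp only [mul_assoc]

end CliffordRelations
end QupitZX

/-! ### A scalar-blind model: relations on phase space, bending and flexsymmetry. -/

namespace QupitZX
open Diag
section Semantics

variable {p : ℕ}

/-! ### Affine relational semantics -/

/-- Phase space points: a position and a momentum. -/
abbrev Pt (p : ℕ) : Type := ZMod p × ZMod p

/-- The affine relation between phase space points of inputs and outputs of a generator. -/
def Gen.sem : {n m : ℕ} → Gen p n m → List (Pt p) → List (Pt p) → Prop
  | _, _, .gId, l, l' => ∃ v, l = [v] ∧ l' = [v]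
  | _, _, .rInv, l, l' => ∃ v : Pt p, l = [v] ∧ l' = [(-v.1, -v.2)]
  | _, _, .had, l, l' => ∃ v : Pt p, l = [v] ∧ l' = [(-v.2, v.1)]
  | _, _, .gUnit x y, l, l' => l = [] ∧ ∃ q, l' = [(q, 2⁻¹ * x + y * q)]
  | _, _, .rUnit x y, l, l' => l = [] ∧ ∃ t, l' = [(2⁻¹ * x - y * t, t)]
  | _, _, .gCounit x y, l, l' => l' = [] ∧ ∃ q, l = [(q, -(2⁻¹ * x + y * q))]
  | _, _, .rCounit x y, l, l' => l' = [] ∧ ∃ t, l = [(2⁻¹ * x - y * t, -t)]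
  | _, _, .gMul, l, l' => ∃ q a b, l = [(q, a), (q, b)] ∧ l' = [(q, a + b)]
  | _, _, .rMul, l, l' => ∃ a b t, l = [(a, t), (b, t)] ∧ l' = [(-(a + b), -t)]
  | _, _, .gComul, l, l' => ∃ q a b, l = [(q, a + b)] ∧ l' = [(q, a), (q, b)]
  | _, _, .rComul, l, l' => ∃ a b t, l = [(-(a + b), -t)] ∧ l' = [(a, t), (b, t)]
  | _, _, .star, l, l' => l = [] ∧ l' = []

/-- The affine relation between phase space points of inputs and outputs of a diagram. -/
def Diag.sem : {n m : ℕ} → Diag p n m → List (Pt p) → List (Pt p) → Prop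
  | _, _, .gen g, l, l' => g.sem l l'
  | _, _, .empty, l, l' => l = [] ∧ l' = []
  | _, _, .wire, l, l' => ∃ v, l = [v] ∧ l' = [v]
  | _, _, .swap, l, l' => ∃ v w, l = [v, w] ∧ l' = [w, v]
  | _, _, .cup, l, l' => l = [] ∧ ∃ v : Pt p, l' = [v, (v.1, -v.2)]
  | _, _, .cap, l, l' => l' = [] ∧ ∃ v : Pt p, l = [v, (v.1, -v.2)]
  | _, _, .seq A B _, l, l' => ∃ k, A.sem l k ∧ B.sem k l'
  | _, _, .tensor A B, l, l' =>
    ∃ a b a' b', l = a ++ b ∧ l' = a' ++ b' ∧ A.sem a a' ∧ B.sem b b'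

/-- Arities are not part of the type of a list; knowing them is what makes the splitting of a
concatenation in a tensor product unique. -/
theorem Diag.sem_length {n m : ℕ} {A : Diag p n m} {l l' : List (Pt p)} (h : A.sem l l') :
    l.length = n ∧ l'.length = m := by
  induction A generalizing l l' with
  | gen g =>
    cases g <;> simp only [Diag.sem, Gen.sem] at h <;> (obtain h := h) <;> grind
  | empty => simp_all [Diag.sem]
  | wire => simp only [Diag.sem] at h; grind
  | swap => simp only [Diag.sem] at h; grind
  | cup => simp only [Diag.sem] at h; grind
  | cap => simp only [Diag.sem] at h; grind
  | seq A B _ hA hB =>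
    obtain ⟨k, h1, h2⟩ := h
    exact ⟨(hA h1).1, (hB h2).2⟩
  | tensor A B hA hB =>
    obtain ⟨a, b, a', b', rfl, rfl, h1, h2⟩ := h
    simp [(hA h1).1, (hA h1).2, (hB h2).1, (hB h2).2]

theorem exists_eq_append_singleton {α : Type*} {n : ℕ} {l : List α} (h : l.length = n + 1) :
    ∃ a v, l = a ++ [v] := by
  rcases List.eq_nil_or_concat l with rfl | ⟨a, v, rfl⟩
  · simp at h
  · exact ⟨a, v, List.concat_eq_append⟩

theorem sem_seq {n m m' k : ℕ} (A : Diag p n m) (B : Diag p m' k) (h : m = m')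
    (l l' : List (Pt p)) : (Diag.seq A B h).sem l l' ↔ ∃ k, A.sem l k ∧ B.sem k l' := Iff.rfl

theorem sem_tensor {n m n' m' : ℕ} (A : Diag p n m) (B : Diag p n' m') (l l' : List (Pt p)) :
    (A ⊠ B).sem l l' ↔
      ∃ a b a' b', l = a ++ b ∧ l' = a' ++ b' ∧ A.sem a a' ∧ B.sem b b' := Iff.rfl

theorem sem_tensor_append {n m n' m' : ℕ} {A : Diag p n m} {B : Diag p n' m'}
    {a b a' b' : List (Pt p)} (ha : a.length = n) (ha' : a'.length = m) :
    (A ⊠ B).sem (a ++ b) (a' ++ b') ↔ A.sem a a' ∧ B.sem b b' := by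
  refine ⟨?_, fun h => ⟨a, b, a', b', rfl, rfl, h.1, h.2⟩⟩
  rintro ⟨c, d, c', d', h, h', h1, h2⟩
  obtain ⟨rfl, rfl⟩ := List.append_inj h (ha.trans (Diag.sem_length h1).1.symm)
  obtain ⟨rfl, rfl⟩ := List.append_inj h' (ha'.trans (Diag.sem_length h1).2.symm)
  exact ⟨h1, h2⟩

theorem sem_cast {n m n' m' : ℕ} (D : Diag p n m) (hn : n = n') (hm : m = m') :
    (D.cast hn hm).sem = D.sem := by
  subst hn hm; rfl

theorem sem_gId (l l' : List (Pt p)) : gId.sem l l' ↔ ∃ v, l = [v] ∧ l' = [v] := Iff.rfl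

theorem sem_wire (l l' : List (Pt p)) : (wire : Diag p 1 1).sem l l' ↔ ∃ v, l = [v] ∧ l' = [v] :=
  Iff.rfl

theorem sem_idn (n : ℕ) (l l' : List (Pt p)) : (idn n).sem l l' ↔ l = l' ∧ l.length = n := by
  induction n generalizing l l' with
  | zero =>
    simp only [idn, Diag.sem, List.length_eq_zero_iff]
    exact ⟨fun h => ⟨h.1.trans h.2.symm, h.1⟩, fun h => ⟨h.2, h.1 ▸ h.2⟩⟩
  | succ n ih =>
    rw [idn, sem_tensor]
    constructor
    · rintro ⟨a, b, a', b', rfl, rfl, h1, v, rfl, rfl⟩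
      obtain ⟨rfl, h⟩ := (ih _ _).1 h1
      simp [h]
    · rintro ⟨rfl, h⟩
      obtain ⟨a, v, rfl⟩ := exists_eq_append_singleton h
      exact ⟨a, [v], a, [v], rfl, rfl, (ih _ _).2 ⟨rfl, by simpa using h⟩, v, rfl, rfl⟩

theorem sem_hads (n : ℕ) (l l' : List (Pt p)) :
    (hads n).sem l l' ↔ l' = l.map (fun v => (-v.2, v.1)) ∧ l.length = n := by
  induction n generalizing l l' with
  | zero =>
    simp only [hads, Diag.sem, List.length_eq_zero_iff]
    constructor
    · rintro ⟨rfl, rfl⟩; simp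
    · rintro ⟨rfl, rfl⟩; simp
  | succ n ih =>
    rw [hads, sem_tensor]
    constructor
    · rintro ⟨a, b, a', b', rfl, rfl, h1, v, rfl, rfl⟩
      obtain ⟨rfl, h⟩ := (ih _ _).1 h1
      simp [h]
    · rintro ⟨rfl, h⟩
      obtain ⟨a, v, rfl⟩ := exists_eq_append_singleton h
      exact ⟨a, [v], _, [(-v.2, v.1)], rfl, by simp, (ih _ _).2 ⟨rfl, by simpa using h⟩, v, rfl, rfl⟩

theorem sem_braid (n : ℕ) (l l' : List (Pt p)) :
    (braid n).sem l l' ↔ ∃ a v, l = a ++ [v] ∧ l' = v :: a ∧ a.length = n := by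
  induction n generalizing l l' with
  | zero =>
    rw [braid, sem_wire]
    constructor
    · rintro ⟨v, rfl, rfl⟩; exact ⟨[], v, rfl, rfl, rfl⟩
    · rintro ⟨a, v, rfl, rfl, h⟩
      obtain rfl := List.length_eq_zero_iff.1 h
      exact ⟨v, rfl, rfl⟩
  | succ n ih =>
    rw [braid, sem_seq]
    constructor
    · rintro ⟨k, ⟨a, b, a', b', rfl, rfl, h1, v, w, rfl, rfl⟩, c, d, c', d', h, rfl, h2, u, rfl, rfl⟩
      obtain ⟨rfl, ha⟩ := (sem_idn _ _ _).1 h1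
      obtain ⟨a', x, rfl, rfl, ha'⟩ := (ih _ _).1 h2
      have h' : (a ++ [w]) ++ [v] = (a' ++ [x]) ++ [u] := by simpa using h
      obtain ⟨h4, h5⟩ := List.append_inj' h' rfl
      obtain ⟨rfl, h3⟩ := List.append_inj' h4 rfl
      obtain rfl : v = u := by simpa using h5
      obtain rfl : w = x := by simpa using h3
      exact ⟨a ++ [v], w, by simp, by simp, by simp [ha]⟩
    · rintro ⟨a, w, rfl, rfl, h⟩
      obtain ⟨a, v, rfl⟩ := exists_eq_append_singleton h
      have ha : a.length = n := by simpa using h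
      refine ⟨a ++ [w, v], ⟨a, [v, w], a, [w, v], by simp, rfl, (sem_idn _ _ _).2 ⟨rfl, ha⟩, v, w,
        rfl, rfl⟩, a ++ [w], [v], w :: a, [v], by simp, by simp, (ih _ _).2 ⟨a, w, rfl, rfl, ha⟩, v,
        rfl, rfl⟩

/-- Reversal of the momentum. -/
def Pt.flip (v : Pt p) : Pt p := (v.1, -v.2)

theorem Pt.flip_flip (v : Pt p) : v.flip.flip = v := by simp [Pt.flip]

theorem sem_cups (n : ℕ) (l l' : List (Pt p)) :
    (cups n).sem l l' ↔ l = [] ∧ ∃ a, l' = a ++ (a.map Pt.flip).reverse ∧ a.length = n := by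
  induction n generalizing l l' with
  | zero =>
    simp only [cups, Diag.sem, List.length_eq_zero_iff]
    constructor
    · rintro ⟨rfl, rfl⟩; exact ⟨rfl, [], rfl, rfl⟩
    · rintro ⟨rfl, a, rfl, rfl⟩; simp
  | succ n ih =>
    rw [cups, sem_cast, sem_seq]
    constructor
    · rintro ⟨k, h1, a, b, a', b', rfl, rfl, h2, c, d, c', d', rfl, rfl, ⟨rfl, v, rfl⟩, h3⟩
      obtain ⟨rfl, e, he, he'⟩ := (ih _ _).1 h1
      obtain ⟨rfl, ha⟩ := (sem_idn _ _ _).1 h2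
      obtain ⟨rfl, hd⟩ := (sem_idn _ _ _).1 h3
      obtain ⟨rfl, h4⟩ := List.append_inj he (ha.trans he'.symm)
      refine ⟨rfl, a ++ [v], ?_, by simp [ha]⟩
      rw [List.nil_append] at h4
      simp [h4, Pt.flip]
    · rintro ⟨rfl, a, rfl, h⟩
      obtain ⟨a, v, rfl⟩ := exists_eq_append_singleton h
      have ha : a.length = n := by simpa using h
      refine ⟨_, (ih _ _).2 ⟨rfl, a, rfl, ha⟩, a, _, a, [v, v.flip] ++ (a.map Pt.flip).reverse, rfl,
        by simp, (sem_idn _ _ _).2 ⟨rfl, ha⟩, [], _, _, _, by simp, rfl, ⟨rfl, v, rfl⟩,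
        (sem_idn _ _ _).2 ⟨rfl, by simp [ha]⟩⟩

/-- Nested cups reverse the order of the inputs, and each cup reverses a momentum. -/
theorem sem_bend {n m : ℕ} (D : Diag p n m) (l l' : List (Pt p)) :
    (bend D).sem l l' ↔ l = [] ∧ ∃ a b, l' = (a.map Pt.flip).reverse ++ b ∧ D.sem a b := by
  have e : ∀ a : List (Pt p), (((a.map Pt.flip).reverse).map Pt.flip).reverse = a := fun a => by
    simp [Function.comp_def, Pt.flip_flip]
  rw [bend, sem_seq]
  constructor
  · rintro ⟨k, h, a, b, a', b', rfl, rfl, h1, h2⟩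
    obtain ⟨rfl, c, he, he'⟩ := (sem_cups _ _ _).1 h
    obtain ⟨rfl, ha⟩ := (sem_idn _ _ _).1 h1
    obtain ⟨rfl, rfl⟩ := List.append_inj he (ha.trans he'.symm)
    exact ⟨rfl, _, b', by rw [e], h2⟩
  · rintro ⟨rfl, a, b, rfl, h⟩
    have ha : a.length = n := (Diag.sem_length h).1
    exact ⟨_, (sem_cups _ _ _).2 ⟨rfl, _, rfl, by simp [ha]⟩, _, _, _, b, rfl, rfl,
      (sem_idn _ _ _).2 ⟨rfl, by simp [ha]⟩, by rwa [e]⟩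

/-! ### Permutations of wires -/

/-- Soundness of flexsymmetry needs only this and the surjectivity below, not the permutation
itself. -/
theorem IsPerm.sem_perm {n : ℕ} {σ : Diag p n n} (hσ : IsPerm σ) {l l' : List (Pt p)}
    (h : σ.sem l l') : l.Perm l' := by
  induction hσ generalizing l l' with
  | idn n => rw [((sem_idn _ _ _).1 h).1]
  | swap => obtain ⟨v, w, rfl, rfl⟩ := h; exact List.Perm.swap _ _ _
  | seq _ _ hA hB => obtain ⟨k, h1, h2⟩ := h; exact (hA h1).trans (hB h2)
  | tensor _ _ hA hB =>
    obtain ⟨a, b, a', b', rfl, rfl, h1, h2⟩ := h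
    exact (hA h1).append (hB h2)

theorem IsPerm.exists_sem {n : ℕ} {σ : Diag p n n} (hσ : IsPerm σ) {l' : List (Pt p)}
    (h : l'.length = n) : ∃ l, σ.sem l l' := by
  induction hσ generalizing l' with
  | idn n => exact ⟨l', (sem_idn _ _ _).2 ⟨rfl, h⟩⟩
  | swap =>
    obtain ⟨v, w, rfl⟩ := List.length_eq_two.1 h
    exact ⟨_, w, v, rfl, rfl⟩
  | seq _ _ hA hB =>
    obtain ⟨k, hk⟩ := hB h
    obtain ⟨l, hl⟩ := hA (Diag.sem_length hk).1
    exact ⟨l, k, hl, hk⟩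
  | @tensor n m A B _ _ hA hB =>
    obtain ⟨a, ha⟩ := hA (l' := l'.take n) (by simp [h])
    obtain ⟨b, hb⟩ := hB (l' := l'.drop n) (by simp [h])
    exact ⟨a ++ b, a, b, _, _, rfl, (List.take_append_drop n l').symm, ha, hb⟩

/-- The legs of a bent green vertex have equal positions and momenta of sum zero. -/
def GreenLegs (l : List (Pt p)) : Prop := (∃ q, ∀ v ∈ l, v.1 = q) ∧ (l.map Prod.snd).sum = 0

/-- The legs of a bent red vertex have equal momenta and positions of sum zero. -/
def RedLegs (l : List (Pt p)) : Prop := (∃ t, ∀ v ∈ l, v.2 = t) ∧ (l.map Prod.fst).sum = 0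

theorem GreenLegs.perm {l l' : List (Pt p)} (h : l.Perm l') (hl : GreenLegs l) : GreenLegs l' := by
  obtain ⟨⟨q, hq⟩, hs⟩ := hl
  exact ⟨⟨q, fun v hv => hq v (h.mem_iff.2 hv)⟩, by rw [← (h.map Prod.snd).sum_eq, hs]⟩

theorem RedLegs.perm {l l' : List (Pt p)} (h : l.Perm l') (hl : RedLegs l) : RedLegs l' := by
  obtain ⟨⟨q, hq⟩, hs⟩ := hl
  exact ⟨⟨q, fun v hv => hq v (h.mem_iff.2 hv)⟩, by rw [← (h.map Prod.fst).sum_eq, hs]⟩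

/-- Written on bent legs, the relation is symmetric and is shared with the comultiplication, which
covers both the bending rule and flexsymmetry. -/
theorem sem_bend_gMul (l l' : List (Pt p)) :
    (bend (gMul : Diag p 2 1)).sem l l' ↔ l = [] ∧ l'.length = 3 ∧ GreenLegs l' := by
  rw [sem_bend]
  refine and_congr_right fun _ => ⟨?_, ?_⟩
  · rintro ⟨a, b, rfl, q, x, y, rfl, rfl⟩
    simp [GreenLegs, Pt.flip]
  · rintro ⟨h, ⟨q, hq⟩, hs⟩
    obtain ⟨⟨a, x⟩, ⟨b, y⟩, ⟨c, z⟩, rfl⟩ := List.length_eq_three.1 h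
    simp only [List.forall_mem_cons, List.map_cons, List.sum_cons, List.map_nil, List.sum_nil] at hq hs
    obtain ⟨rfl, rfl, rfl, -⟩ := hq
    refine ⟨_, _, ?_, c, -y, -x, rfl, rfl⟩
    simp only [Pt.flip, List.map_cons, List.map_nil, List.reverse_cons, List.reverse_nil, neg_neg,
      List.nil_append, List.cons_append]
    rw [show z = -y + -x by linear_combination hs]

theorem sem_bend_gComul (l l' : List (Pt p)) :
    (bend (gComul : Diag p 1 2)).sem l l' ↔ l = [] ∧ l'.length = 3 ∧ GreenLegs l' := by
  rw [sem_bend]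
  refine and_congr_right fun _ => ⟨?_, ?_⟩
  · rintro ⟨a, b, rfl, q, x, y, rfl, rfl⟩
    simp [GreenLegs, Pt.flip]
  · rintro ⟨h, ⟨q, hq⟩, hs⟩
    obtain ⟨⟨a, x⟩, ⟨b, y⟩, ⟨c, z⟩, rfl⟩ := List.length_eq_three.1 h
    simp only [List.forall_mem_cons, List.map_cons, List.sum_cons, List.map_nil, List.sum_nil] at hq hs
    obtain ⟨rfl, rfl, rfl, -⟩ := hq
    refine ⟨_, _, ?_, c, y, z, rfl, rfl⟩
    simp only [Pt.flip, List.map_cons, List.map_nil, List.reverse_cons, List.reverse_nil,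
      List.nil_append, List.cons_append]
    rw [show x = -(y + z) by linear_combination hs]

theorem sem_bend_rMul (l l' : List (Pt p)) :
    (bend (rMul : Diag p 2 1)).sem l l' ↔ l = [] ∧ l'.length = 3 ∧ RedLegs l' := by
  rw [sem_bend]
  refine and_congr_right fun _ => ⟨?_, ?_⟩
  · rintro ⟨a, b, rfl, q, x, y, rfl, rfl⟩
    simp [RedLegs, Pt.flip]
  · rintro ⟨h, ⟨q, hq⟩, hs⟩
    obtain ⟨⟨a, x⟩, ⟨b, y⟩, ⟨c, z⟩, rfl⟩ := List.length_eq_three.1 h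
    simp only [List.forall_mem_cons, List.map_cons, List.sum_cons, List.map_nil, List.sum_nil] at hq hs
    obtain ⟨rfl, rfl, rfl, -⟩ := hq
    refine ⟨_, _, ?_, b, a, -z, rfl, rfl⟩
    simp only [Pt.flip, List.map_cons, List.map_nil, List.reverse_cons, List.reverse_nil, neg_neg,
      List.nil_append, List.cons_append]
    rw [show c = -(b + a) by linear_combination hs]

theorem sem_bend_rComul (l l' : List (Pt p)) :
    (bend (rComul : Diag p 1 2)).sem l l' ↔ l = [] ∧ l'.length = 3 ∧ RedLegs l' := by
  rw [sem_bend]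
  refine and_congr_right fun _ => ⟨?_, ?_⟩
  · rintro ⟨a, b, rfl, q, x, y, rfl, rfl⟩
    simp [RedLegs, Pt.flip]
  · rintro ⟨h, ⟨q, hq⟩, hs⟩
    obtain ⟨⟨a, x⟩, ⟨b, y⟩, ⟨c, z⟩, rfl⟩ := List.length_eq_three.1 h
    simp only [List.forall_mem_cons, List.map_cons, List.sum_cons, List.map_nil, List.sum_nil] at hq hs
    obtain ⟨rfl, rfl, rfl, -⟩ := hq
    refine ⟨_, _, ?_, b, c, z, rfl, rfl⟩
    simp only [Pt.flip, List.map_cons, List.map_nil, List.reverse_cons, List.reverse_nil, neg_neg,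
      List.nil_append, List.cons_append]
    rw [show a = -(b + c) by linear_combination hs]

theorem perm_pair {α : Type*} {a b : α} {l : List α} (h : [a, b].Perm l) :
    l = [a, b] ∨ l = [b, a] := by
  obtain ⟨c, d, rfl⟩ := List.length_eq_two.1 h.length_eq.symm
  have hc : c = a ∨ c = b := by simpa using h.mem_iff.2 (List.mem_cons_self (a := c))
  rcases hc with rfl | rfl
  · have := h.cons_inv
    simp at this
    simp [this]
  · have := (List.Perm.swap _ _ _).trans h |>.cons_inv
    simp at this
    simp [this]

/-- With three legs the relation is visibly symmetric (`GreenLegs`, `RedLegs`); with two legs only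
the transposition has to be checked; with at most one there is nothing to permute. -/
theorem sem_bend_perm {n m : ℕ} (g : Gen p n m) {k l l' : List (Pt p)} (h : l.Perm l')
    (hl : (bend (gen g)).sem k l) : (bend (gen g)).sem k l' := by
  have two : n + m = 2 → (∀ a b : Pt p, (bend (gen g)).sem k [a, b] → (bend (gen g)).sem k [b, a]) →
      (bend (gen g)).sem k l' := fun h2 hg => by
    obtain ⟨a, b, rfl⟩ := List.length_eq_two.1 ((Diag.sem_length hl).2.trans h2)
    rcases perm_pair h with rfl | rfl
    · exact hl
    · exact hg _ _ hl
  have le_one : n + m ≤ 1 → (bend (gen g)).sem k l' := fun h1 => by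
    have hlen : l.length ≤ 1 := (Diag.sem_length hl).2.trans_le h1
    have e : l' = l := by
      rcases l with _ | ⟨a, _ | ⟨b, l⟩⟩
      · exact h.nil_eq.symm
      · exact List.singleton_perm.1 h |>.symm
      · simp at hlen
    rwa [e]
  cases g with
  | gId =>
    refine two rfl fun a b hab => ?_
    obtain ⟨rfl, _, _, h', v, rfl, rfl⟩ := (sem_bend _ _ _).1 hab
    obtain ⟨rfl, rfl⟩ : a = v.flip ∧ b = v := by simpa using h'
    exact (sem_bend _ _ _).2 ⟨rfl, _, _, by simp [Pt.flip_flip], b.flip, rfl, rfl⟩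
  | rInv =>
    refine two rfl fun a b hab => ?_
    obtain ⟨rfl, _, _, h', v, rfl, rfl⟩ := (sem_bend _ _ _).1 hab
    obtain ⟨rfl, rfl⟩ : a = v.flip ∧ b = (-v.1, -v.2) := by simpa using h'
    exact (sem_bend _ _ _).2 ⟨rfl, _, _, by simp [Pt.flip], (-v.1, v.2), rfl, rfl⟩
  | had =>
    refine two rfl fun a b hab => ?_
    obtain ⟨rfl, _, _, h', v, rfl, rfl⟩ := (sem_bend _ _ _).1 hab
    obtain ⟨rfl, rfl⟩ : a = v.flip ∧ b = (-v.2, v.1) := by simpa using h'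
    exact (sem_bend _ _ _).2 ⟨rfl, _, _, by simp [Pt.flip], (-v.2, -v.1), rfl, rfl⟩
  | gUnit => exact le_one le_rfl
  | rUnit => exact le_one le_rfl
  | gCounit => exact le_one le_rfl
  | rCounit => exact le_one le_rfl
  | star => exact le_one (Nat.zero_le _)
  | gMul =>
    obtain ⟨h1, h2, h3⟩ := (sem_bend_gMul _ _).1 hl
    exact (sem_bend_gMul _ _).2 ⟨h1, h.length_eq ▸ h2, h3.perm h⟩
  | rMul =>
    obtain ⟨h1, h2, h3⟩ := (sem_bend_rMul _ _).1 hl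
    exact (sem_bend_rMul _ _).2 ⟨h1, h.length_eq ▸ h2, h3.perm h⟩
  | gComul =>
    obtain ⟨h1, h2, h3⟩ := (sem_bend_gComul _ _).1 hl
    exact (sem_bend_gComul _ _).2 ⟨h1, h.length_eq ▸ h2, h3.perm h⟩
  | rComul =>
    obtain ⟨h1, h2, h3⟩ := (sem_bend_rComul _ _).1 hl
    exact (sem_bend_rComul _ _).2 ⟨h1, h.length_eq ▸ h2, h3.perm h⟩

end Semantics
end QupitZX

/-! ### Denotations of spiders, scalars and multipliers. -/

namespace QupitZX
open Diag
section Soundness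

variable {p : ℕ}

/-! ### Spiders -/

theorem sem_gMerge (m : ℕ) (l l' : List (Pt p)) : (gMerge m).sem l l' ↔
    l.length = m + 1 ∧ ∃ q, (∀ v ∈ l, v.1 = q) ∧ l' = [(q, (l.map Prod.snd).sum)] := by
  induction m generalizing l l' with
  | zero =>
    rw [gMerge, sem_gId]
    constructor
    · rintro ⟨v, rfl, rfl⟩; simp
    · rintro ⟨h, q, hq, rfl⟩
      obtain ⟨v, rfl⟩ := List.length_eq_one_iff.1 h
      obtain rfl : v.1 = q := by simpa using hq
      exact ⟨v, by simp⟩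
  | succ m ih =>
    rw [gMerge, sem_seq]
    constructor
    · rintro ⟨k, ⟨a, b, a', b', rfl, rfl, h1, v, rfl, rfl⟩, q, x, y, h, rfl⟩
      obtain ⟨h2, q', h3, rfl⟩ := (ih _ _).1 h1
      obtain ⟨⟨rfl, rfl⟩, rfl⟩ : (q' = q ∧ _ = x) ∧ v = (q, y) := by simpa using h
      refine ⟨by simp [h2], q', fun v hv => ?_, by simp⟩
      rcases List.mem_append.1 hv with h | h
      · exact h3 _ h
      · rw [List.mem_singleton.1 h]
    · rintro ⟨h, q, hq, rfl⟩
      obtain ⟨a, v, rfl⟩ := exists_eq_append_singleton h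
      have hv : v.1 = q := hq v (by simp)
      refine ⟨[(q, (a.map Prod.snd).sum), v], ⟨a, [v], [_], [v], rfl, rfl, (ih _ _).2
        ⟨by simpa using h, q, fun v hv => hq v (by simp [hv]), rfl⟩, v, rfl, rfl⟩, q, (a.map Prod.snd).sum,
        v.2, ?_, ?_⟩
      · rw [← hv]
      · simp

theorem sem_gSplit (n : ℕ) (l l' : List (Pt p)) : (gSplit n).sem l l' ↔
    l'.length = n ∧ ∃ q, (∀ v ∈ l', v.1 = q) ∧ l = [(q, (l'.map Prod.snd).sum)] := by
  rcases n with _ | n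
  · rw [List.length_eq_zero_iff]
    refine and_congr_right ?_
    rintro rfl
    simp
  rw [gSplit]
  induction n generalizing l l' with
  | zero =>
    rw [gSplitSucc, sem_gId]
    constructor
    · rintro ⟨v, rfl, rfl⟩; simp
    · rintro ⟨h, q, hq, rfl⟩
      obtain ⟨v, rfl⟩ := List.length_eq_one_iff.1 h
      obtain rfl : v.1 = q := by simpa using hq
      exact ⟨v, by simp⟩
  | succ m ih =>
    rw [gSplitSucc, sem_seq]
    constructor
    · rintro ⟨k, ⟨q, x, y, rfl, rfl⟩, a, b, a', b', h, rfl, h1, v, rfl, rfl⟩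
      obtain ⟨h2, q', h3, rfl⟩ := (ih _ _).1 h1
      obtain ⟨⟨rfl, rfl⟩, rfl⟩ : (q = q' ∧ x = _) ∧ (q, y) = v := by simpa using h
      refine ⟨by simp [h2], q, fun v hv => ?_, by simp⟩
      rcases List.mem_append.1 hv with h | h
      · exact h3 _ h
      · rw [List.mem_singleton.1 h]
    · rintro ⟨h, q, hq, rfl⟩
      obtain ⟨a, v, rfl⟩ := exists_eq_append_singleton h
      have hv : v.1 = q := hq v (by simp)
      refine ⟨[(q, (a.map Prod.snd).sum), v], ⟨q, (a.map Prod.snd).sum, v.2, by simp, by rw [← hv]⟩,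
        [_], [v], a, [v], rfl, rfl, (ih _ _).2
        ⟨by simpa using h, q, fun v hv => hq v (by simp [hv]), rfl⟩, v, rfl, rfl⟩

/-- The legs share one position, and momentum is conserved up to a kick `2⁻¹ x + y q`, the
derivative of the exponent `2⁻¹ (x q + y q²)` of the phase. -/
theorem sem_green (m n : ℕ) (x y : ZMod p) (l l' : List (Pt p)) : (green m n x y).sem l l' ↔
    l.length = m ∧ l'.length = n ∧ ∃ q, (∀ v ∈ l, v.1 = q) ∧ (∀ v ∈ l', v.1 = q) ∧
      (l'.map Prod.snd).sum = (l.map Prod.snd).sum + (2⁻¹ * x + y * q) := by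
  rw [green, sem_seq]
  constructor
  · rintro ⟨k, ⟨k', ⟨a, b, a', b', rfl, rfl, h1, rfl, q, rfl⟩, h2⟩, h3⟩
    obtain ⟨rfl, ha⟩ := (sem_idn _ _ _).1 h1
    obtain ⟨h4, q', h5, rfl⟩ := (sem_gMerge _ _ _).1 h2
    obtain ⟨h6, q'', h7, h8⟩ := (sem_gSplit _ _ _).1 h3
    obtain rfl : q = q' := h5 (q, 2⁻¹ * x + y * q) (by simp)
    obtain ⟨rfl, h9⟩ : q = q'' ∧ _ = _ := by simpa using h8
    exact ⟨by simp [ha], h6, q, fun v hv => h5 v (by simpa using Or.inl (by simpa using hv)), h7,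
      by simpa using h9.symm⟩
  · rintro ⟨h1, h2, q, h3, h4, h5⟩
    refine ⟨[(q, (l'.map Prod.snd).sum)], ⟨l ++ [(q, 2⁻¹ * x + y * q)], ⟨l, [], l, _, by simp, rfl,
      (sem_idn _ _ _).2 ⟨rfl, h1⟩, rfl, q, rfl⟩, (sem_gMerge _ _ _).2 ⟨by simp [h1], q, ?_, ?_⟩⟩,
      (sem_gSplit _ _ _).2 ⟨h2, q, h4, rfl⟩⟩
    · intro v hv
      rcases List.mem_append.1 hv with h | h
      · exact h3 _ h
      · rw [List.mem_singleton.1 h]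
    · simp [h5]

theorem sem_rMerge (m : ℕ) (l l' : List (Pt p)) : (rMerge m).sem l l' ↔
    l.length = m + 1 ∧ ∃ t, (∀ v ∈ l, v.2 = t) ∧ l' = [(-(l.map Prod.fst).sum, -t)] := by
  induction m generalizing l l' with
  | zero =>
    constructor
    · rintro ⟨v, rfl, rfl⟩; simp
    · rintro ⟨h, q, hq, rfl⟩
      obtain ⟨v, rfl⟩ := List.length_eq_one_iff.1 h
      obtain rfl : v.2 = q := by simpa using hq
      exact ⟨v, by simp⟩
  | succ m ih =>
    rw [rMerge, sem_seq]
    constructor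
    · rintro ⟨k, ⟨a, b, a', b', rfl, rfl, ⟨_, h1, w, rfl, rfl⟩, v, rfl, rfl⟩, x, y, t, h, rfl⟩
      obtain ⟨h2, t', h3, h4⟩ := (ih _ _).1 h1
      obtain rfl : w = _ := by simpa using h4
      obtain ⟨⟨rfl, rfl⟩, rfl⟩ : (_ = x ∧ t' = t) ∧ v = (y, t) := by simpa using h
      refine ⟨by simp [h2], t', fun v hv => ?_, by simp⟩
      rcases List.mem_append.1 hv with h | h
      · exact h3 _ h
      · rw [List.mem_singleton.1 h]
    · rintro ⟨h, t, ht, rfl⟩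
      obtain ⟨a, v, rfl⟩ := exists_eq_append_singleton h
      have hv : v.2 = t := ht v (by simp)
      refine ⟨[((a.map Prod.fst).sum, t), v], ⟨a, [v], [_], [v], rfl, rfl, ⟨_, (ih _ _).2
        ⟨by simpa using h, t, fun v hv => ht v (by simp [hv]), rfl⟩, _, rfl, by simp⟩, v, rfl, rfl⟩,
        (a.map Prod.fst).sum, v.1, t, ?_, ?_⟩
      · rw [← hv]
      · simp

theorem sem_rSplit (n : ℕ) (l l' : List (Pt p)) : (rSplit n).sem l l' ↔
    l'.length = n ∧ ∃ t, (∀ v ∈ l', v.2 = t) ∧ l = [(-(l'.map Prod.fst).sum, -t)] := by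
  rcases n with _ | n
  · rw [List.length_eq_zero_iff]
    refine and_congr_right ?_
    rintro rfl
    simp
  rw [rSplit]
  induction n generalizing l l' with
  | zero =>
    constructor
    · rintro ⟨v, rfl, rfl⟩; simp
    · rintro ⟨h, q, hq, rfl⟩
      obtain ⟨v, rfl⟩ := List.length_eq_one_iff.1 h
      obtain rfl : v.2 = q := by simpa using hq
      exact ⟨(-v.1, -v.2), by simp⟩
  | succ m ih =>
    rw [rSplitSucc, sem_seq]
    constructor
    · rintro ⟨k, ⟨x, y, t, rfl, rfl⟩, a, b, a', b', h, rfl, ⟨_, ⟨w, rfl, rfl⟩, h1⟩, v, rfl, rfl⟩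
      obtain ⟨h2, t', h3, h4⟩ := (ih _ _).1 h1
      obtain ⟨h5, h6⟩ : w.1 = _ ∧ w.2 = t' := by simpa using h4
      obtain ⟨rfl, rfl⟩ : (x, t) = w ∧ (y, t) = v := by simpa using h
      obtain rfl : t = t' := h6
      obtain rfl : x = _ := h5
      refine ⟨by simp [h2], t, fun v hv => ?_, by simp⟩
      rcases List.mem_append.1 hv with h | h
      · exact h3 _ h
      · rw [List.mem_singleton.1 h]
    · rintro ⟨h, t, ht, rfl⟩
      obtain ⟨a, v, rfl⟩ := exists_eq_append_singleton h
      have hv : v.2 = t := ht v (by simp)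
      refine ⟨[((a.map Prod.fst).sum, t), v], ⟨(a.map Prod.fst).sum, v.1, t, by simp, by rw [← hv]⟩,
        [_], [v], a, [v], rfl, rfl, ⟨_, ⟨_, rfl, rfl⟩, (ih _ _).2
        ⟨by simpa using h, t, fun v hv => ht v (by simp [hv]), rfl⟩⟩, v, rfl, rfl⟩

theorem sem_red (m n : ℕ) (x y : ZMod p) (l l' : List (Pt p)) : (red m n x y).sem l l' ↔
    l.length = m ∧ l'.length = n ∧ ∃ t, (∀ v ∈ l, v.2 = t) ∧ (∀ v ∈ l', v.2 = -t) ∧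
      (l'.map Prod.fst).sum = -(l.map Prod.fst).sum + (2⁻¹ * x + y * t) := by
  rw [red, sem_seq]
  constructor
  · rintro ⟨k, ⟨k', ⟨k'', ⟨a, b, a', b', rfl, rfl, h1, _, ⟨rfl, t, rfl⟩, w', h0, rfl⟩, h2⟩, w, rfl,
      rfl⟩, h3⟩
    obtain rfl : _ = w' := by simpa using h0
    obtain ⟨rfl, ha⟩ := (sem_idn _ _ _).1 h1
    obtain ⟨h4, t', h5, h5'⟩ := (sem_rMerge _ _ _).1 h2
    obtain ⟨h6, t'', h7, h8⟩ := (sem_rSplit _ _ _).1 h3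
    obtain rfl : -t = t' := h5 (-(2⁻¹ * x - y * t), -t) (by simp)
    obtain rfl : w = _ := by simpa using h5'
    obtain ⟨h9, h10⟩ : _ = _ ∧ _ = _ := by simpa using h8
    subst h10
    refine ⟨by simp [ha], h6, -t, fun v hv => h5 v (by simpa using Or.inl (by simpa using hv)),
      fun v hv => by simp [h7 v hv], ?_⟩
    simp only [List.append_nil]
    linear_combination h9
  · rintro ⟨h1, h2, t, h3, h4, h5⟩
    refine ⟨[(-(l'.map Prod.fst).sum, t)], ⟨[((l'.map Prod.fst).sum, -t)],
      ⟨l ++ [(-(2⁻¹ * x + y * t), t)], ⟨l, [], l, _, by simp, rfl,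
      (sem_idn _ _ _).2 ⟨rfl, h1⟩, _, ⟨rfl, -t, rfl⟩, _, rfl, ?_⟩,
      (sem_rMerge _ _ _).2 ⟨by simp [h1], t, ?_, ?_⟩⟩, _, rfl, by simp⟩,
      (sem_rSplit _ _ _).2 ⟨h2, -t, h4, by simp⟩⟩
    · simp [add_comm]
    · intro v hv
      rcases List.mem_append.1 hv with h | h
      · exact h3 _ h
      · rw [List.mem_singleton.1 h]
    · simp [h5, add_comm]

/-! ### Scalars -/

/-- A scalar denotes a truth value, so one that is true has no effect beside another diagram. -/
theorem sem_scalar_tensor {s : Diag p 0 0} (hs : s.sem [] []) {n m : ℕ} (A : Diag p n m)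
    (l l' : List (Pt p)) : (s ⊠ A).sem l l' ↔ A.sem l l' := by
  have h := sem_tensor_append (A := s) (B := A) (a := []) (a' := []) (b := l) (b' := l') rfl rfl
  exact h.trans (and_iff_right hs)

theorem sem_tensor_scalar {s : Diag p 0 0} (hs : s.sem [] []) {n m : ℕ} (A : Diag p n m)
    (l l' : List (Pt p)) : (A ⊠ s).sem l l' ↔ A.sem l l' := by
  constructor
  · rintro ⟨a, b, a', b', rfl, rfl, h1, h2⟩
    obtain ⟨h3, h4⟩ := Diag.sem_length h2
    obtain rfl := List.length_eq_zero_iff.1 h3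
    obtain rfl := List.length_eq_zero_iff.1 h4
    simpa using h1
  · exact fun h => ⟨l, [], l', [], by simp, by simp, h, hs⟩

theorem sem_spow {s : Diag p 0 0} (hs : s.sem [] []) (k : ℕ) : (spow s k).sem [] [] := by
  induction k with
  | zero => exact ⟨rfl, rfl⟩
  | succ k ih => exact (sem_scalar_tensor ih _ _ _).2 hs

theorem sem_star : (star : Diag p 0 0).sem [] [] := ⟨rfl, rfl⟩

theorem sem_omegaDot (x z : ZMod p) : (omegaDot x z).sem [] [] :=
  ⟨[(2⁻¹ * z, 2⁻¹ * x)], ⟨rfl, 2⁻¹ * z, by simp⟩, rfl, -(2⁻¹ * x), by simp⟩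

theorem sem_sqrtP : (sqrtP : Diag p 0 0).sem [] [] := sem_omegaDot 0 0

theorem sem_gDot_zero (y : ZMod p) : (gDot 0 y).sem [] [] :=
  ⟨[(0, 0)], ⟨rfl, 0, by simp⟩, rfl, 0, by simp⟩

theorem sem_sqrtPInv : (sqrtPInv : Diag p 0 0).sem [] [] :=
  ⟨[(0, 0), (0, 0), (0, 0)], ⟨[(0, 0), (0, 0), (0, 0)], (sem_green _ _ _ _ _ _).2 ⟨rfl, rfl, 0, by simp⟩,
    [(0, 0)], [(0, 0), (0, 0)], [(0, 0)], [(0, 0), (0, 0)], rfl, rfl, ⟨(0, 0), rfl, by simp⟩,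
    (sem_idn _ _ _).2 ⟨rfl, rfl⟩⟩, (sem_red _ _ _ _ _ _).2 ⟨rfl, rfl, 0, by simp⟩⟩

theorem sem_gaussUnit : (gaussUnit : Diag p 0 0).sem [] [] := by
  unfold gaussUnit
  split_ifs
  · exact (sem_scalar_tensor (sem_spow sem_star _) _ _ _).2 sem_sqrtP
  · exact sem_gDot_zero 1

/-- Elementary scalars are true in the model, so equality up to them implies equality of
denotations. -/
theorem IsElementary.sem {C : Diag p 0 0} (hC : IsElementary p C) : C.sem [] [] := by
  have hi : (imag p).sem [] [] := (sem_scalar_tensor (sem_gDot_zero 1) _ _ _).2 sem_sqrtPInv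
  induction hC with
  | base D hD =>
    rcases hD with (hD | hD) | hD
    · unfold elemO at hD
      split_ifs at hD
      · rcases hD with rfl | rfl
        exacts [⟨rfl, rfl⟩, sem_star]
      · rcases hD with rfl | rfl | rfl | rfl
        exacts [⟨rfl, rfl⟩, hi, sem_star, (sem_scalar_tensor sem_star _ _ _).2 hi]
    · rcases hD with rfl | ⟨s, rfl⟩
      exacts [⟨rfl, rfl⟩, (sem_scalar_tensor (sem_omegaDot _ _) _ _ _).2 sem_sqrtPInv]
    · rcases hD with rfl | rfl | rfl
      exacts [sem_sqrtP, ⟨rfl, rfl⟩, sem_sqrtPInv]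
  | tensor D E _ _ hD hE => exact (sem_scalar_tensor hD _ _ _).2 hE

/-! ### Diagrams with one input and one output -/

theorem sem_green_one_one (x y : ZMod p) (l l' : List (Pt p)) : (green 1 1 x y).sem l l' ↔
    ∃ v : Pt p, l = [v] ∧ l' = [(v.1, v.2 + (2⁻¹ * x + y * v.1))] := by
  rw [sem_green]
  constructor
  · rintro ⟨h1, h2, q, h3, h4, h5⟩
    obtain ⟨v, rfl⟩ := List.length_eq_one_iff.1 h1
    obtain ⟨w, rfl⟩ := List.length_eq_one_iff.1 h2
    refine ⟨v, rfl, ?_⟩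
    simp at h3 h4 h5
    rw [h3, ← h5, ← h4]
  · rintro ⟨v, rfl, rfl⟩
    exact ⟨rfl, rfl, v.1, by simp⟩

theorem sem_red_one_one (x y : ZMod p) (l l' : List (Pt p)) : (red 1 1 x y).sem l l' ↔
    ∃ v : Pt p, l = [v] ∧ l' = [(-v.1 + (2⁻¹ * x + y * v.2), -v.2)] := by
  rw [sem_red]
  constructor
  · rintro ⟨h1, h2, q, h3, h4, h5⟩
    obtain ⟨v, rfl⟩ := List.length_eq_one_iff.1 h1
    obtain ⟨w, rfl⟩ := List.length_eq_one_iff.1 h2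
    refine ⟨v, rfl, ?_⟩
    simp at h3 h4 h5
    rw [h3, ← h5, ← h4]
  · rintro ⟨v, rfl, rfl⟩
    exact ⟨rfl, rfl, v.2, by simp⟩

/-- All `k` edges carry the same point: the green end fixes the position and the red end the
momentum. The sums at the two ends then produce the factors `k`. -/
theorem sem_multiEdge (k : ℕ) (l l' : List (Pt p)) : (multiEdge k).sem l l' ↔
    ∃ q t : ZMod p, l = [(q, (k : ZMod p) * t)] ∧ l' = [(-((k : ZMod p) * q), -t)] := by
  rw [multiEdge, sem_seq]
  constructor
  · rintro ⟨j, h1, h2⟩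
    obtain ⟨h3, h4, q, h5, h6, h7⟩ := (sem_green _ _ _ _ _ _).1 h1
    obtain ⟨h8, h9, t, h10, h11, h12⟩ := (sem_red _ _ _ _ _ _).1 h2
    obtain ⟨v, rfl⟩ := List.length_eq_one_iff.1 h3
    obtain ⟨w, rfl⟩ := List.length_eq_one_iff.1 h9
    have hj : j = List.replicate k (q, t) :=
      List.eq_replicate_iff.2 ⟨h4, fun b hb => Prod.ext (h6 b hb) (h10 b hb)⟩
    subst hj
    refine ⟨q, t, ?_, ?_⟩
    · simp at h5 h7
      rw [h7, ← h5]
    · simp at h11 h12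
      rw [← h12, ← h11]
  · rintro ⟨q, t, rfl, rfl⟩
    refine ⟨List.replicate k (q, t), (sem_green _ _ _ _ _ _).2 ⟨rfl, by simp, q, by simp,
      fun v hv => ?_, by simp⟩, (sem_red _ _ _ _ _ _).2 ⟨by simp, rfl, t, fun v hv => ?_, by simp,
      by simp⟩⟩
    · rw [(List.mem_replicate.1 hv).2]
    · rw [(List.mem_replicate.1 hv).2]

theorem sem_natMult (k : ℕ) (l l' : List (Pt p)) : (natMult k).sem l l' ↔
    ∃ q t : ZMod p, l = [(q, (k : ZMod p) * t)] ∧ l' = [((k : ZMod p) * q, t)] := by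
  induction k generalizing l l' with
  | zero =>
    rw [natMult, sem_scalar_tensor sem_sqrtPInv]
    constructor
    · rintro ⟨k, ⟨rfl, q, rfl⟩, -, t, rfl⟩
      exact ⟨q, t, by simp⟩
    · rintro ⟨q, t, rfl, rfl⟩
      exact ⟨[], ⟨rfl, q, by simp⟩, rfl, t, by simp⟩
  | succ k ih =>
    rw [natMult, sem_scalar_tensor sem_sqrtP]
    constructor
    · rintro ⟨_, ⟨_, ⟨_, ⟨q, x, y, rfl, rfl⟩, a, b, a', b', h, rfl, h1, v, rfl, rfl⟩, x', y', t, h',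
        rfl⟩, w, h'', rfl⟩
      obtain ⟨q', t', rfl, rfl⟩ := (ih _ _).1 h1
      simp at h h' h''
      obtain ⟨⟨rfl, rfl⟩, rfl⟩ := h
      obtain ⟨⟨rfl, rfl⟩, h⟩ := h'
      obtain ⟨rfl, rfl⟩ := Prod.mk.inj h
      subst h''
      exact ⟨q, y, by simp [add_mul], by simp [add_mul]⟩
    · rintro ⟨q, t, rfl, rfl⟩
      exact ⟨_, ⟨_, ⟨_, ⟨q, k * t, t, by simp [add_mul], rfl⟩, [_], [_], [_], [_], rfl, rfl,
        (ih _ _).2 ⟨q, t, rfl, rfl⟩, (q, t), rfl, rfl⟩, _, _, _, rfl, rfl⟩, _, rfl,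
        by simp [add_mul]⟩

end Soundness
end QupitZX

/-! ### Soundness of the axioms, and separation and counting of normal forms. -/

namespace QupitZX
open Diag
section Uniqueness

variable {p : ℕ}

theorem sem_fusion (m n m' n' : ℕ) (a b c d : ZMod p) (l l' : List (Pt p)) :
    ((green m (n + 1) a b ⊠ idn m') ⨟ (idn n ⊠ green (1 + m') n' c d)).sem l l' ↔
      (green (m + m') (n + n') (a + c) (b + d)).sem l l' := by
  rw [sem_seq, sem_green]
  constructor
  · rintro ⟨k, ⟨e, f, e', f', rfl, rfl, h1, h2⟩, g, h, g', h', hk, rfl, h3, h4⟩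
    obtain ⟨rfl, hf⟩ := (sem_idn _ _ _).1 h2
    obtain ⟨rfl, hg⟩ := (sem_idn _ _ _).1 h3
    obtain ⟨h5, h6, q, h7, h8, h9⟩ := (sem_green _ _ _ _ _ _).1 h1
    obtain ⟨h10, h11, q', h12, h13, h14⟩ := (sem_green _ _ _ _ _ _).1 h4
    obtain ⟨e', v, rfl⟩ := exists_eq_append_singleton h6
    rw [List.append_assoc] at hk
    obtain ⟨rfl, rfl⟩ := List.append_inj hk ((by simpa using h6 : e'.length = n).trans hg.symm)
    obtain rfl : v.1 = q := h8 v (by simp)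
    obtain rfl : v.1 = q' := h12 v (by simp)
    refine ⟨by simp [h5, hf], by simp [hg, h11], v.1, ?_, ?_, ?_⟩
    · intro w hw
      rcases List.mem_append.1 hw with hw | hw
      · exact h7 _ hw
      · exact h12 _ (by simp [hw])
    · intro w hw
      rcases List.mem_append.1 hw with hw | hw
      · exact h8 _ (by simp [hw])
      · exact h13 _ hw
    · simp at h9 h14 ⊢
      linear_combination h9 + h14
  · rintro ⟨h1, h2, q, h3, h4, h5⟩
    have e1 : l = l.take m ++ l.drop m := (List.take_append_drop m l).symm
    have e2 : l' = l'.take n ++ l'.drop n := (List.take_append_drop n l').symm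
    generalize l.take m = e, hf : l.drop m = f at e1
    generalize hg' : l'.take n = g, l'.drop n = h at e2
    have hf' : f.length = m' := by rw [← hf]; simp [h1]
    have hg : g.length = n := by rw [← hg']; simp [h2]
    clear hf hg'
    subst e1 e2
    have he : e.length = m := by rw [List.length_append] at h1; omega
    have hh : h.length = n' := by rw [List.length_append] at h2; omega
    simp only [List.mem_append] at h3 h4
    simp only [List.map_append, List.sum_append] at h5
    -- The point on the connecting edge: its position is the common one, its momentum is forced by
    -- the balance at the first spider.
    refine ⟨g ++ ([(q, (e.map Prod.snd).sum + (2⁻¹ * a + b * q) - (g.map Prod.snd).sum)] ++ f),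
      ⟨e, f, _, f, rfl, (List.append_assoc _ _ _).symm, (sem_green _ _ _ _ _ _).2
        ⟨he, by simp [hg], q, fun v hv => h3 v (Or.inl hv), fun v hv => ?_, by simp⟩,
        (sem_idn _ _ _).2 ⟨rfl, hf'⟩⟩, g, _, g, h, rfl, rfl, (sem_idn _ _ _).2 ⟨rfl, hg⟩,
        (sem_green _ _ _ _ _ _).2 ⟨by simp [hf', add_comm], hh, q, fun v hv => ?_,
          fun v hv => h4 v (Or.inr hv), ?_⟩⟩
    · rcases List.mem_append.1 hv with hv | hv
      · exact h4 _ (Or.inl hv)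
      · rw [List.mem_singleton.1 hv]
    · rcases List.mem_append.1 hv with hv | hv
      · rw [List.mem_singleton.1 hv]
      · exact h3 _ (Or.inr hv)
    · simp
      linear_combination h5

theorem sem_colour (m n : ℕ) (a b : ZMod p) (l l' : List (Pt p)) :
    (hads m ⨟ green m n a b ⨟ hads n).sem l l' ↔ (red m n (-a) b).sem l l' := by
  have e1 : ∀ k : List (Pt p),
      (k.map (Prod.snd ∘ fun v : Pt p => (-v.2, v.1))).sum = (k.map Prod.fst).sum := fun k => rfl
  have e2 : ∀ k : List (Pt p), (k.map (Prod.fst ∘ fun v : Pt p => (-v.2, v.1))).sum =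
      -(k.map Prod.snd).sum := fun k => by
    induction k with
    | nil => simp
    | cons v k ih =>
      simp only [List.map_cons, List.sum_cons, ih, Function.comp_apply]
      ring
  rw [sem_seq, sem_red]
  constructor
  · rintro ⟨k, ⟨k', h1, h2⟩, h3⟩
    obtain ⟨rfl, h4⟩ := (sem_hads _ _ _).1 h1
    obtain ⟨rfl, h5⟩ := (sem_hads _ _ _).1 h3
    obtain ⟨h6, h7, q, h8, h9, h10⟩ := (sem_green _ _ _ _ _ _).1 h2
    rw [List.forall_mem_map] at h8
    refine ⟨h4, by simp [h5], -q, fun v hv => ?_, ?_, ?_⟩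
    · rw [← h8 v hv, neg_neg]
    · rw [List.forall_mem_map, neg_neg]
      exact h9
    · rw [List.map_map, e2]
      rw [List.map_map, e1] at h10
      linear_combination -h10
  · rintro ⟨h1, h2, t, h3, h4, h5⟩
    have e3 : ∀ k : List (Pt p), (k.map fun v : Pt p => (v.2, -v.1)).map (fun v => (-v.2, v.1)) = k :=
      fun k => by simp [Function.comp_def]
    refine ⟨l'.map fun v => (v.2, -v.1), ⟨l.map fun v => (-v.2, v.1), (sem_hads _ _ _).2 ⟨rfl, h1⟩,
      (sem_green _ _ _ _ _ _).2 ⟨by simp [h1], by simp [h2], -t, ?_, ?_, ?_⟩⟩,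
      (sem_hads _ _ _).2 ⟨(e3 l').symm, by simp [h2]⟩⟩
    · rw [List.forall_mem_map]
      exact fun v hv => by rw [h3 v hv]
    · rw [List.forall_mem_map]
      exact h4
    · have e4 := e2 (l'.map fun v => (v.2, -v.1))
      rw [← List.map_map, e3] at e4
      have e5 := e1 l
      rw [← List.map_map] at e5
      rw [e5]
      linear_combination e4 - h5

variable [Fact p.Prime]

theorem sem_multiEdge_val (x : ZMod p) (l l' : List (Pt p)) : (multiEdge x.val).sem l l' ↔
    ∃ q t : ZMod p, l = [(q, x * t)] ∧ l' = [(-(x * q), -t)] := by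
  have h := sem_multiEdge x.val l l'
  rwa [ZMod.natCast_zmod_val] at h

theorem sem_multRule {x y : ZMod p} (h : x * y = 1) (l l' : List (Pt p)) :
    (multiEdge x.val ⨟ rInv).sem l l' ↔
      (had ⨟ green 1 1 0 y ⨟ red 1 1 0 x ⨟ green 1 1 0 y).sem l l' := by
  constructor
  · rintro ⟨k, h1, v, rfl, rfl⟩
    obtain ⟨q, t, rfl, h'⟩ := (sem_multiEdge_val _ _ _).1 h1
    obtain rfl := (List.cons.inj h').1
    refine ⟨_, ⟨_, ⟨_, ⟨_, rfl, rfl⟩, (sem_green_one_one _ _ _ _).2 ⟨_, rfl, rfl⟩⟩,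
      (sem_red_one_one _ _ _ _).2 ⟨_, rfl, rfl⟩⟩, (sem_green_one_one _ _ _ _).2 ⟨_, rfl, ?_⟩⟩
    simp only [List.cons.injEq, Prod.mk.injEq, and_true]
    constructor
    · linear_combination x * t * h
    · linear_combination (x * y * t - t - q) * h
  · rintro ⟨_, ⟨_, ⟨_, ⟨v, rfl, rfl⟩, h1⟩, h2⟩, h3⟩
    obtain ⟨_, h', rfl⟩ := (sem_green_one_one _ _ _ _).1 h1
    obtain rfl := (List.cons.inj h').1
    obtain ⟨_, h', rfl⟩ := (sem_red_one_one _ _ _ _).1 h2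
    obtain rfl := (List.cons.inj h').1
    obtain ⟨_, h', rfl⟩ := (sem_green_one_one _ _ _ _).1 h3
    obtain rfl := (List.cons.inj h').1
    refine ⟨_, (sem_multiEdge_val _ _ _).2 ⟨v.1, y * v.2, ?_, rfl⟩, _, rfl, ?_⟩
    · rw [← mul_assoc, h, one_mul]
    · simp only [List.cons.injEq, Prod.mk.injEq, and_true]
      constructor
      · linear_combination -v.2 * h
      · linear_combination (v.1 - y * v.2) * h

theorem sem_mElim (a b : ZMod p) {x y : ZMod p} (h : x * y = 1) (l l' : List (Pt p)) :
    (multiEdge x.val ⨟ rCounit a b).sem l l' ↔ (rCounit (-a * y) (b * y ^ 2)).sem l l' := by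
  constructor
  · rintro ⟨k, h1, rfl, t, h2⟩
    obtain ⟨q, t', rfl, rfl⟩ := (sem_multiEdge_val _ _ _).1 h1
    simp only [List.cons.injEq, Prod.mk.injEq, and_true, neg_inj] at h2
    obtain ⟨h2, rfl⟩ := h2
    refine ⟨rfl, -(x * t'), ?_⟩
    simp only [List.cons.injEq, Prod.mk.injEq, and_true, neg_neg]
    linear_combination -y * h2 - (q + b * y * t') * h
  · rintro ⟨rfl, t, rfl⟩
    refine ⟨_, (sem_multiEdge_val _ _ _).2
      ⟨2⁻¹ * (-a * y) - b * y ^ 2 * t, -(y * t), ?_, rfl⟩, rfl, -(y * t), ?_⟩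
    rotate_left
    · simp only [List.cons.injEq, Prod.mk.injEq, and_true]
      linear_combination (2⁻¹ * a + b * y * t) * h
    · rw [mul_neg x, ← mul_assoc x, h, one_mul]

omit [Fact p.Prime] in
theorem sem_scalar {s : Diag p 0 0} (hs : s.sem [] []) (l l' : List (Pt p)) :
    s.sem l l' ↔ l = [] ∧ l' = [] :=
  ⟨fun h => ⟨List.length_eq_zero_iff.1 (Diag.sem_length h).1,
    List.length_eq_zero_iff.1 (Diag.sem_length h).2⟩, fun h => h.1 ▸ h.2 ▸ hs⟩

theorem two_ne_zero_of_ne_two (hp : p ≠ 2) : (2 : ZMod p) ≠ 0 := fun h => by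
  have h2 : ((2 : ℕ) : ZMod p) = 0 := by exact_mod_cast h
  rw [ZMod.natCast_eq_zero_iff] at h2
  exact hp ((Nat.prime_dvd_prime_iff_eq Fact.out Nat.prime_two).1 h2)

/-- The two ends would need momentum `2⁻¹ z = 0`, impossible for odd `p`. Both sides of (Zero) are
therefore empty relations. -/
theorem not_sem_gDot (hp : p ≠ 2) (z : (ZMod p)ˣ) (l l' : List (Pt p)) :
    ¬ (gDot (z : ZMod p) 0).sem l l' := by
  rintro ⟨_, ⟨rfl, q, rfl⟩, rfl, q', h⟩
  simp at h
  exact two_ne_zero_of_ne_two hp h.2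

omit [Fact p.Prime] in
theorem sem_empty : (Diag.empty : Diag p 0 0).sem [] [] := ⟨rfl, rfl⟩

/-- Induction on derivations. Structural rules regroup lists; in the coloured rules every scalar
except that of (Zero) is true and disappears, leaving affine identities over `ZMod p`. -/
theorem Derives.sem_iff {n m n' m' : ℕ} {A : Diag p n m} {B : Diag p n' m'} (hp : p ≠ 2)
    (h : Derives p A B) : ∀ l l', A.sem l l' ↔ B.sem l l' := by
  induction h with
  | refl A => exact fun _ _ => Iff.rfl
  | symm _ ih => exact fun l l' => (ih l l').symm
  | trans _ _ ih1 ih2 => exact fun l l' => (ih1 l l').trans (ih2 l l')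
  | seq h h' _ _ ih1 ih2 =>
    exact fun l l' => exists_congr fun k => and_congr (ih1 l k) (ih2 k l')
  | tensor _ _ ih1 ih2 =>
    exact fun l l' => exists_congr fun a => exists_congr fun b => exists_congr fun a' =>
      exists_congr fun b' => and_congr_right fun _ => and_congr_right fun _ =>
        and_congr (ih1 a a') (ih2 b b')
  | seqAssoc A B C h h' =>
    intro l l'
    constructor
    · rintro ⟨k, ⟨k', h1, h2⟩, h3⟩; exact ⟨k', h1, k, h2, h3⟩
    · rintro ⟨k, h1, k', h2, h3⟩; exact ⟨k', ⟨k, h1, h2⟩, h3⟩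
  | idSeq A =>
    intro l l'
    constructor
    · rintro ⟨k, h1, h2⟩
      rwa [((sem_idn _ _ _).1 h1).1]
    · exact fun h => ⟨l, (sem_idn _ _ _).2 ⟨rfl, (Diag.sem_length h).1⟩, h⟩
  | seqId A =>
    intro l l'
    constructor
    · rintro ⟨k, h1, h2⟩
      rwa [← ((sem_idn _ _ _).1 h2).1]
    · exact fun h => ⟨l', h, (sem_idn _ _ _).2 ⟨rfl, (Diag.sem_length h).2⟩⟩
  | tensorAssoc A B C =>
    intro l l'
    constructor
    · rintro ⟨_, c, _, c', rfl, rfl, ⟨a, b, a', b', rfl, rfl, h1, h2⟩, h3⟩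
      exact ⟨a, b ++ c, a', b' ++ c', by simp, by simp, h1, b, c, b', c', rfl, rfl, h2, h3⟩
    · rintro ⟨a, _, a', _, rfl, rfl, h1, b, c, b', c', rfl, rfl, h2, h3⟩
      exact ⟨a ++ b, c, a' ++ b', c', by simp, by simp, ⟨a, b, a', b', rfl, rfl, h1, h2⟩, h3⟩
  | emptyTensor A => exact sem_scalar_tensor (s := .empty) sem_empty A
  | tensorEmpty A => exact sem_tensor_scalar (s := .empty) sem_empty A
  | interchange A B C D h h' =>
    intro l l'
    constructor
    · rintro ⟨a, b, a', b', rfl, rfl, ⟨k, h1, h2⟩, k', h3, h4⟩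
      exact ⟨k ++ k', ⟨a, b, k, k', rfl, rfl, h1, h3⟩, k, k', a', b', rfl, rfl, h2, h4⟩
    · rintro ⟨_, ⟨a, b, k, k', rfl, rfl, h1, h3⟩, j, j', a', b', hk, rfl, h2, h4⟩
      obtain ⟨rfl, rfl⟩ := List.append_inj hk
        ((Diag.sem_length h1).2.trans (h.trans (Diag.sem_length h2).1.symm))
      exact ⟨a, b, a', b', rfl, rfl, ⟨k, h1, h2⟩, k', h3, h4⟩
  | swapSwap =>
    intro l l'
    rw [sem_idn]
    constructor
    · rintro ⟨_, ⟨v, w, rfl, rfl⟩, v', w', h, rfl⟩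
      simp at h
      simp [h]
    · rintro ⟨rfl, h⟩
      obtain ⟨v, w, rfl⟩ := List.length_eq_two.1 h
      exact ⟨_, ⟨v, w, rfl, rfl⟩, w, v, rfl, rfl⟩
  | swapNat D =>
    intro l l'
    constructor
    · rintro ⟨_, ⟨a, _, a', _, rfl, rfl, h1, v, rfl, rfl⟩, h2⟩
      obtain ⟨b, w, h3, rfl, h4⟩ := (sem_braid _ _ _).1 h2
      obtain ⟨rfl, h5⟩ := List.append_inj' h3 rfl
      obtain rfl : v = w := by simpa using h5
      exact ⟨v :: a, (sem_braid _ _ _).2 ⟨a, v, rfl, rfl, (Diag.sem_length h1).1⟩, [v], a, [v], a',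
        rfl, rfl, ⟨v, rfl, rfl⟩, h1⟩
    · rintro ⟨_, h1, _, b, _, b', h2, rfl, ⟨v, rfl, rfl⟩, h3⟩
      obtain ⟨a, w, rfl, rfl, h4⟩ := (sem_braid _ _ _).1 h1
      obtain ⟨rfl, rfl⟩ : w = v ∧ a = b := by simpa using h2
      exact ⟨b' ++ [w], ⟨a, [w], b', [w], rfl, rfl, h3, w, rfl, rfl⟩,
        (sem_braid _ _ _).2 ⟨b', w, rfl, rfl, (Diag.sem_length h3).2⟩⟩
  | snake =>
    intro l l'
    rw [sem_wire]
    constructor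
    · rintro ⟨_, ⟨_, _, _, _, rfl, rfl, ⟨rfl, v, rfl⟩, w, rfl, rfl⟩, _, _, _, _, h, rfl, ⟨x, rfl, rfl⟩,
        rfl, y, rfl⟩
      simp at h
      obtain ⟨rfl, rfl, rfl⟩ := h
      exact ⟨_, rfl, by simp⟩
    · rintro ⟨v, rfl, rfl⟩
      exact ⟨[v, (v.1, -v.2), v], ⟨[], [v], [v, _], [v], rfl, rfl, ⟨rfl, v, rfl⟩, v, rfl, rfl⟩,
        [v], [_, _], [v], [], rfl, rfl, ⟨v, rfl, rfl⟩, rfl, (v.1, -v.2), by simp⟩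
  | snake' =>
    intro l l'
    rw [sem_wire]
    constructor
    · rintro ⟨_, ⟨_, _, _, _, rfl, rfl, ⟨v, rfl, rfl⟩, rfl, w, rfl⟩, _, _, _, _, h, rfl, ⟨rfl, x, rfl⟩,
        y, rfl, rfl⟩
      simp at h
      obtain ⟨rfl, rfl, rfl⟩ := h
      exact ⟨_, rfl, by simp⟩
    · rintro ⟨v, rfl, rfl⟩
      exact ⟨[v, (v.1, -v.2), v], ⟨[v], [], [v], [_, _], rfl, rfl, ⟨v, rfl, rfl⟩, rfl, (v.1, -v.2),
        by simp⟩, [_, _], [v], [], [v], rfl, rfl, ⟨rfl, v, rfl⟩, v, rfl, rfl⟩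
  | cupSwap =>
    intro l l'
    constructor
    · rintro ⟨_, ⟨rfl, v, rfl⟩, x, y, h, rfl⟩
      simp at h
      obtain ⟨rfl, rfl⟩ := h
      exact ⟨rfl, (v.1, -v.2), by simp⟩
    · rintro ⟨rfl, v, rfl⟩
      exact ⟨_, ⟨rfl, (v.1, -v.2), rfl⟩, (v.1, -v.2), v, by simp, rfl⟩
  | swapCap =>
    intro l l'
    constructor
    · rintro ⟨_, ⟨x, y, rfl, rfl⟩, rfl, v, h⟩
      simp at h
      obtain ⟨rfl, rfl⟩ := h
      exact ⟨rfl, (y.1, -y.2), by simp⟩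
    · rintro ⟨rfl, v, rfl⟩
      exact ⟨_, ⟨v, (v.1, -v.2), rfl, rfl⟩, rfl, (v.1, -v.2), by simp⟩
  | flex g σ hσ h =>
    subst h
    intro l l'
    constructor
    · rintro ⟨k, h1, h2⟩
      exact sem_bend_perm g (hσ.sem_perm h2) h1
    -- A wire permutation reaches every list of outputs, and the bent generator also accepts the
    -- preimage.
    · intro h
      obtain ⟨k, hk⟩ := hσ.exists_sem (Diag.sem_length h).2
      exact ⟨k, sem_bend_perm g (hσ.sem_perm hk).symm h, hk⟩
  | gBend => exact fun l l' => (sem_bend_gMul l l').trans (sem_bend_gComul l l').symm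
  | rBend => exact fun l l' => (sem_bend_rMul l l').trans (sem_bend_rComul l l').symm
  | gUnitBend x y =>
    intro l l'
    rw [sem_bend, sem_bend]
    refine and_congr_right fun _ => ?_
    constructor
    · rintro ⟨_, _, rfl, rfl, q, rfl⟩
      exact ⟨_, _, by simp [Pt.flip], rfl, q, rfl⟩
    · rintro ⟨_, _, rfl, rfl, q, rfl⟩
      exact ⟨_, _, by simp [Pt.flip], rfl, q, rfl⟩
  | rUnitBend x y =>
    intro l l'
    rw [sem_bend, sem_bend]
    refine and_congr_right fun _ => ?_
    constructor
    · rintro ⟨_, _, rfl, rfl, q, rfl⟩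
      exact ⟨_, _, by simp [Pt.flip], rfl, q, rfl⟩
    · rintro ⟨_, _, rfl, rfl, q, rfl⟩
      exact ⟨_, _, by simp [Pt.flip], rfl, q, rfl⟩
  | gLabel =>
    intro l l'
    rw [sem_green_one_one, sem_gId]
    simp
  | rLabel =>
    intro l l'
    rw [sem_red_one_one]
    simp [rInv, Diag.sem, Gen.sem]
  | fusion m n m' n' a b c d => exact sem_fusion m n m' n' a b c d
  | colour m n a b => exact sem_colour m n a b
  | shear a c d =>
    intro l l'
    rw [sem_scalar_tensor (sem_omegaDot _ _), sem_scalar_tensor (sem_omegaDot _ _), sem_red_one_one]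
    constructor
    · rintro ⟨_, ⟨_, h1, h2⟩, h3⟩
      obtain ⟨v, rfl, rfl⟩ := (sem_green_one_one _ _ _ _).1 h1
      obtain ⟨_, h, rfl⟩ := (sem_red_one_one _ _ _ _).1 h2
      obtain rfl := (List.cons.inj h).1
      obtain ⟨_, h, rfl⟩ := (sem_green_one_one _ _ _ _).1 h3
      obtain rfl := (List.cons.inj h).1
      refine ⟨v, rfl, ?_⟩
      simp
      ring
    · rintro ⟨v, rfl, rfl⟩
      refine ⟨_, ⟨_, (sem_green_one_one _ _ _ _).2 ⟨_, rfl, rfl⟩,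
        (sem_red_one_one _ _ _ _).2 ⟨_, rfl, rfl⟩⟩, (sem_green_one_one _ _ _ _).2 ⟨_, rfl, ?_⟩⟩
      simp
      ring
  | char =>
    intro l l'
    rw [sem_scalar_tensor (sem_spow sem_sqrtP _), sem_multiEdge]
    constructor
    · rintro ⟨q, t, rfl, rfl⟩
      exact ⟨[], ⟨rfl, q, by simp⟩, rfl, -t, by simp⟩
    · rintro ⟨_, ⟨rfl, q, rfl⟩, -, t, rfl⟩
      exact ⟨q, -t, by simp⟩
  | bigebra =>
    intro l l'
    rw [sem_scalar_tensor (sem_spow sem_sqrtP _), sem_scalar_tensor sem_sqrtP]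
    constructor
    · rintro ⟨_, ⟨_, ⟨_, _, _, _, rfl, rfl, ⟨q, a, b, rfl, rfl⟩, q', a', b', rfl, rfl⟩,
        _, _, _, _, h1, rfl, ⟨v, rfl, rfl⟩, _, _, _, _, rfl, rfl, ⟨x, y, rfl, rfl⟩, w, rfl, rfl⟩,
        _, _, _, _, h2, rfl, ⟨r, r', t, rfl, rfl⟩, s, s', t', rfl, rfl⟩
      simp at h1 h2
      obtain ⟨rfl, rfl, rfl, rfl⟩ := h1
      simp at h2
      obtain ⟨⟨rfl, rfl⟩, ⟨rfl, rfl⟩, ⟨rfl, rfl⟩, ⟨rfl, rfl⟩⟩ := h2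
      exact ⟨_, ⟨q, q', _, rfl, rfl⟩, _, _, _, by simp [add_comm], rfl⟩
    · rintro ⟨_, ⟨a, b, t, rfl, rfl⟩, q, x, y, h, rfl⟩
      simp at h
      obtain ⟨rfl, h⟩ := h
      obtain rfl : t = -x + -y := by linear_combination -h
      -- Each input position is copied to both outputs, and each of the two output momenta is shared
      -- by both inputs.
      refine ⟨[(a, -x), (b, -x), (a, -y), (b, -y)], ⟨[(a, -x), (a, -y), (b, -x), (b, -y)],
        ⟨[_], [_], [_, _], [_, _], rfl, rfl, ⟨a, -x, -y, rfl, rfl⟩, b, -x, -y, rfl, rfl⟩,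
        [_], [_, _, _], [_], [_, _, _], rfl, rfl, ⟨_, rfl, rfl⟩, [_, _], [_], [_, _], [_], rfl, rfl,
        ⟨_, _, rfl, rfl⟩, _, rfl, rfl⟩, [_, _], [_, _], [_], [_], rfl, rfl,
        ⟨a, b, -x, rfl, ?_⟩, a, b, -y, rfl, ?_⟩
      · simp [add_comm]
      · simp [add_comm]
  | copy a =>
    intro l l'
    rw [sem_scalar_tensor sem_sqrtP]
    constructor
    · rintro ⟨_, ⟨rfl, t, rfl⟩, q, x, y, h, rfl⟩
      simp at h
      obtain ⟨rfl, rfl⟩ := h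
      exact ⟨[], [], [_], [_], rfl, rfl, ⟨rfl, x, by simp⟩, rfl, y, by simp⟩
    · rintro ⟨_, _, _, _, rfl, rfl, ⟨rfl, t, rfl⟩, rfl, t', rfl⟩
      exact ⟨_, ⟨rfl, t + t', rfl⟩, 2⁻¹ * a, t, t', by simp, by simp⟩
  | gElim => exact fun _ _ => Iff.rfl
  | rElim =>
    intro l l'
    rw [sem_wire]
    constructor
    · rintro ⟨_, ⟨v, rfl, rfl⟩, w, h, rfl⟩
      simp at h
      subst h
      exact ⟨v, rfl, by simp⟩
    · rintro ⟨v, rfl, rfl⟩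
      exact ⟨_, ⟨v, rfl, rfl⟩, _, rfl, by simp⟩
  | multRule z =>
    intro l l'
    rw [sem_scalar_tensor (sem_gDot_zero _), sem_scalar_tensor (sem_spow sem_sqrtP _),
      sem_scalar_tensor (sem_spow sem_sqrtP _)]
    exact sem_multRule (mul_inv_cancel₀ z.ne_zero) l l'
  | gauss z =>
    intro l l'
    rw [sem_scalar_tensor (sem_spow sem_star _)]
    rw [sem_scalar (sem_gDot_zero _), sem_scalar sem_gaussUnit]
  | mOne => exact sem_scalar_tensor sem_star _
  | mElim a b z =>
    intro l l'
    rw [sem_scalar_tensor (sem_spow sem_sqrtP _)]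
    exact sem_mElim a b (mul_inv_cancel₀ z.ne_zero) l l'
  | zero z =>
    intro l l'
    constructor
    · rintro ⟨a, b, a', b', -, -, h, -⟩
      exact (not_sem_gDot hp z _ _ h).elim
    · rintro ⟨a, b, a', b', -, -, h, -⟩
      exact (not_sem_gDot hp z _ _ h).elim
  | one =>
    intro l l'
    rw [sem_scalar_tensor sem_sqrtP]
    exact sem_scalar sem_sqrtPInv l l'

/-! ### Distinct normal forms have distinct semantics -/

theorem EqUpToScalar.sem_iff (hp : p ≠ 2) {n m : ℕ} {A B : Diag p n m} (h : EqUpToScalar p A B)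
    (l l' : List (Pt p)) : A.sem l l' ↔ B.sem l l' := by
  obtain ⟨C, hC, h⟩ := h
  rw [h.sem_iff hp, sem_tensor_scalar hC.sem]

theorem sem_mult (w : (ZMod p)ˣ) (l l' : List (Pt p)) : (mult (w : ZMod p)).sem l l' ↔
    ∃ v : Pt p, l = [v] ∧ l' = [((w : ZMod p) * v.1, ((w⁻¹ : (ZMod p)ˣ) : ZMod p) * v.2)] := by
  have h := sem_natMult (w : ZMod p).val l l'
  rw [ZMod.natCast_zmod_val] at h
  refine h.trans ⟨?_, ?_⟩
  · rintro ⟨q, t, rfl, rfl⟩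
    refine ⟨_, rfl, ?_⟩
    rw [← mul_assoc, Units.inv_mul, one_mul]
  · rintro ⟨v, rfl, rfl⟩
    refine ⟨_, _, ?_, rfl⟩
    rw [← mul_assoc, Units.mul_inv, one_mul]

/-- The affine map of phase space denoted by a normal form. -/
def NormalForm.map : NormalForm p → Pt p → Pt p
  | .first s t u v w, x =>
    let q := -((w : ZMod p) * x.1) + (2⁻¹ * u + v * (((w⁻¹ : (ZMod p)ˣ) : ZMod p) * x.2))
    (q, -(((w⁻¹ : (ZMod p)ˣ) : ZMod p) * x.2) + (2⁻¹ * s + t * q))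
  | .second s u v w, x =>
    let q := -((w : ZMod p) * x.1) + (2⁻¹ * u + v * (((w⁻¹ : (ZMod p)ˣ) : ZMod p) * x.2))
    let t := -(((w⁻¹ : (ZMod p)ˣ) : ZMod p) * x.2) + (2⁻¹ * s + q)
    (-q + t, -t)

theorem NormalForm.sem_toDiag (N : NormalForm p) (x : Pt p) (l' : List (Pt p)) :
    N.toDiag.sem [x] l' ↔ l' = [N.map x] := by
  have hs : ∀ {A B : Diag p 1 1} {f g : Pt p → Pt p},
      (∀ l l', A.sem l l' ↔ ∃ v, l = [v] ∧ l' = [f v]) →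
      (∀ l l', B.sem l l' ↔ ∃ v, l = [v] ∧ l' = [g v]) →
      ∀ l l', (A ⨟ B).sem l l' ↔ ∃ v, l = [v] ∧ l' = [g (f v)] := by
    intro A B f g hA hB l l'
    rw [sem_seq]
    simp only [hA, hB]
    constructor
    · rintro ⟨_, ⟨v, rfl, rfl⟩, w, h, rfl⟩
      rw [← (List.cons.inj h).1]
      exact ⟨v, rfl, rfl⟩
    · rintro ⟨v, rfl, rfl⟩
      exact ⟨_, ⟨v, rfl, rfl⟩, _, rfl, rfl⟩
  have key : ∀ f : Pt p → Pt p, (∃ v, [x] = [v] ∧ l' = [f v]) ↔ l' = [f x] := fun f =>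
    ⟨fun ⟨_, h, h'⟩ => (List.cons.inj h).1 ▸ h', fun h => ⟨x, rfl, h⟩⟩
  cases N with
  | first s t u v w =>
    exact (hs (hs (sem_mult w) (sem_red_one_one u v)) (sem_green_one_one s t) _ _).trans (key _)
  | second s u v w =>
    refine (hs (hs (hs (sem_mult w) (sem_red_one_one u v)) (sem_green_one_one s 1))
      (sem_red_one_one 0 1) _ _).trans ((key _).trans ?_)
    simp only [NormalForm.map, mul_zero, zero_add, one_mul]

/-- An affine map is determined by its values at the origin and the two basis vectors. The output
position depends on the input position with coefficient `-w` in the first family and not at all in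
the second, which separates the families. -/
theorem NormalForm.map_injective (hp : p ≠ 2) {N N' : NormalForm p} (h : ∀ x, N.map x = N'.map x) :
    N = N' := by
  have h2 : (2⁻¹ : ZMod p) ≠ 0 := inv_ne_zero (two_ne_zero_of_ne_two hp)
  have h00 := h (0, 0)
  have h10 := h (1, 0)
  have h01 := h (0, 1)
  rcases N with ⟨s, t, u, v, w⟩ | ⟨s, u, v, w⟩ <;> rcases N' with ⟨s', t', u', v', w'⟩ | ⟨s', u', v', w'⟩
    <;> simp only [NormalForm.map, mul_zero, mul_one, neg_zero, zero_add, add_zero, Prod.mk.injEq]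
      at h00 h10 h01
  · obtain ⟨e1, e2⟩ := h00
    obtain ⟨e3, e4⟩ := h10
    obtain ⟨e5, e6⟩ := h01
    obtain rfl := mul_left_cancel₀ h2 e1
    obtain rfl : w = w' := Units.ext (by linear_combination -e3)
    have hw := w.ne_zero
    have hw' := (w⁻¹).ne_zero
    obtain rfl : t = t' := mul_left_cancel₀ hw (by linear_combination e2 - e4)
    obtain rfl : v = v' := mul_right_cancel₀ hw' (by linear_combination e5)
    obtain rfl : s = s' := mul_left_cancel₀ h2 (by linear_combination e2)
    rfl
  · have := w.ne_zero
    exact absurd (by linear_combination h00.1 - h10.1) this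
  · have := w'.ne_zero
    exact absurd (by linear_combination h10.1 - h00.1) this
  · obtain ⟨e1, e2⟩ := h00
    obtain ⟨e3, e4⟩ := h10
    obtain ⟨e5, e6⟩ := h01
    obtain rfl : s = s' := mul_left_cancel₀ h2 (by linear_combination e1)
    obtain rfl : u = u' := mul_left_cancel₀ h2 (by linear_combination -e2)
    obtain rfl : w = w' := Units.ext (by linear_combination e4)
    have hw' := (w⁻¹).ne_zero
    obtain rfl : v = v' := mul_right_cancel₀ hw' (by linear_combination -e6)
    rfl

theorem existsUnique_normalForm (hp : p ≠ 2) {A : Diag p 1 1} (hA : IsC1 p A) :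
    ∃! N : NormalForm p, EqUpToScalar p A N.toDiag := by
  obtain ⟨N, hN⟩ := exists_normalForm hp hA
  refine ⟨N, hN, fun N' hN' => NormalForm.map_injective hp fun x => ?_⟩
  have h := (hN'.sem_iff hp [x] [N'.map x]).2 ((N'.sem_toDiag x _).2 rfl)
  exact (List.cons.inj ((N.sem_toDiag x _).1 ((hN.sem_iff hp _ _).1 h))).1

/-! ### The number of normal forms -/

theorem NormalForm.card : Nat.card (NormalForm p) = p ^ 3 * (p ^ 2 - 1) := by
  let e : NormalForm p ≃ (ZMod p × ZMod p × ZMod p × ZMod p × (ZMod p)ˣ) ⊕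
      (ZMod p × ZMod p × ZMod p × (ZMod p)ˣ) :=
    { toFun := fun N => match N with
        | .first s t u v w => .inl (s, t, u, v, w)
        | .second s u v w => .inr (s, u, v, w)
      invFun := fun x => match x with
        | .inl (s, t, u, v, w) => .first s t u v w
        | .inr (s, u, v, w) => .second s u v w
      left_inv := fun N => by cases N <;> rfl
      right_inv := fun x => by rcases x with x | x <;> rfl }
  have hu : Nat.card (ZMod p)ˣ = p - 1 := by
    rw [Nat.card_eq_fintype_card, ZMod.card_units]
  rw [Nat.card_congr e, Nat.card_sum]
  simp only [Nat.card_prod, Nat.card_zmod, hu]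
  obtain ⟨k, hk⟩ : ∃ k, p = k + 1 := ⟨p - 1, by have := (Fact.out : p.Prime).one_le; omega⟩
  have e1 : p - 1 = k := by omega
  have e2 : p ^ 2 - 1 = (k + 2) * k := by
    rw [hk]
    refine Nat.sub_eq_of_eq_add ?_
    ring
  rw [e1, e2, hk]
  ring

end Uniqueness
end QupitZX

/-! ### Pauli operators, Schur's lemma and the symplectic action. -/

namespace QupitZX
section PauliOperators

variable {p : ℕ} [Fact p.Prime]

/-! ### Powers of the root of unity -/

/-- The power of `ω` with exponent in `ZMod p`. -/
noncomputable def rootPow (k : ZMod p) : ℂ := ZMod.stdAddChar k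

theorem rootPow_add (a b : ZMod p) : rootPow (a + b) = rootPow a * rootPow b :=
  AddChar.map_add_eq_mul _ _ _

theorem rootPow_zero : rootPow (0 : ZMod p) = 1 := AddChar.map_zero_eq_one _

theorem rootPow_natCast (n : ℕ) : rootPow (n : ZMod p) = omega p ^ n := by
  have h := ZMod.stdAddChar_coe (N := p) (n : ℤ)
  rw [Int.cast_natCast] at h
  rw [rootPow, h, omega, ← Complex.exp_nat_mul]
  congr 1
  push_cast
  ring

theorem rootPow_injective : Function.Injective (rootPow : ZMod p → ℂ) := ZMod.injective_stdAddChar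

theorem rootPow_ne_zero (k : ZMod p) : rootPow k ≠ 0 := fun h => by
  have h1 := rootPow_add k (-k)
  rw [h, zero_mul, add_neg_cancel, rootPow_zero] at h1
  exact one_ne_zero h1

theorem star_rootPow (k : ZMod p) : Star.star (rootPow k) = rootPow (-k) :=
  (AddChar.map_neg_eq_conj _ _).symm

theorem isPrimitiveRoot_omega : IsPrimitiveRoot (omega p) p :=
  Complex.isPrimitiveRoot_exp p (Fact.out : p.Prime).ne_zero

/-! ### Pauli operators -/

/-- The Pauli operator `ω ^ k X ^ a Z ^ b` with exponents in `ZMod p`. -/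
noncomputable def pauli (k a b : ZMod p) : Matrix (ZMod p) (ZMod p) ℂ :=
  Matrix.of fun i j => if i = j + a then rootPow (k + b * j) else 0

theorem pauli_mul_apply (k a b : ZMod p) (M : Matrix (ZMod p) (ZMod p) ℂ) (i j : ZMod p) :
    (pauli k a b * M) i j = rootPow (k + b * (i - a)) * M (i - a) j := by
  rw [Matrix.mul_apply, Finset.sum_eq_single (i - a)]
  · simp [pauli]
  · intro m _ hm
    have : i ≠ m + a := fun h => hm (by rw [h, add_sub_cancel_right])
    simp [pauli, this]
  · simp

theorem mul_pauli_apply (k a b : ZMod p) (M : Matrix (ZMod p) (ZMod p) ℂ) (i j : ZMod p) :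
    (M * pauli k a b) i j = M i (j + a) * rootPow (k + b * j) := by
  rw [Matrix.mul_apply, Finset.sum_eq_single (j + a)]
  · simp [pauli]
  · intro m _ hm
    simp [pauli, hm]
  · simp

theorem pauli_mul (k a b k' a' b' : ZMod p) :
    pauli k a b * pauli k' a' b' = pauli (k + k' + b * a') (a + a') (b + b') := by
  ext i j
  rw [mul_pauli_apply, pauli, pauli, Matrix.of_apply, Matrix.of_apply, add_assoc, add_comm a']
  split_ifs with h
  · rw [← rootPow_add]
    congr 1
    ring
  · rw [zero_mul]

theorem pauli_zero : pauli (0 : ZMod p) 0 0 = 1 := by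
  ext i j
  simp [pauli, Matrix.one_apply, rootPow_zero]

theorem rootPow_smul_pauli (t k a b : ZMod p) : rootPow t • pauli k a b = pauli (t + k) a b := by
  ext i j
  simp only [pauli, Matrix.smul_apply, Matrix.of_apply, smul_eq_mul, mul_ite, mul_zero]
  rw [← rootPow_add, add_assoc]

theorem pauli_conjTranspose (k a b : ZMod p) :
    (pauli k a b).conjTranspose = pauli (b * a - k) (-a) (-b) := by
  ext i j
  rw [Matrix.conjTranspose_apply, pauli, pauli, Matrix.of_apply, Matrix.of_apply, ← sub_eq_add_neg]
  by_cases h : j = i + a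
  · rw [if_pos h, if_pos (by rw [h, add_sub_cancel_right]), star_rootPow, h]
    congr 1
    ring
  · rw [if_neg h, if_neg fun h' => h (by rw [h', sub_add_cancel]), star_zero]

theorem pauli_mem_unitaryGroup (k a b : ZMod p) : pauli k a b ∈ Matrix.unitaryGroup (ZMod p) ℂ := by
  rw [Matrix.mem_unitaryGroup_iff', Matrix.star_eq_conjTranspose, pauli_conjTranspose, pauli_mul,
    ← pauli_zero (p := p)]
  congr 1 <;> ring

/-- The nonzero entry of column 0 gives `a` and `k`; the one of column 1 then gives `b`. -/
theorem pauli_injective {k a b k' a' b' : ZMod p} (h : pauli k a b = pauli k' a' b') :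
    k = k' ∧ a = a' ∧ b = b' := by
  have h0 := congrFun (congrFun h a) 0
  have h1 := congrFun (congrFun h (1 + a)) 1
  simp only [pauli, Matrix.of_apply, zero_add, if_true, mul_zero, add_zero, mul_one] at h0 h1
  obtain rfl : a = a' := by
    by_contra ha
    rw [if_neg ha] at h0
    exact rootPow_ne_zero _ h0
  rw [if_pos rfl] at h0 h1
  obtain rfl := rootPow_injective h0
  exact ⟨rfl, rfl, add_left_cancel (rootPow_injective h1)⟩

theorem shiftX_eq : shiftX p = pauli 0 1 0 := by
  ext i j
  simp [shiftX, pauli, rootPow_zero]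

theorem clockZ_eq : clockZ p = pauli 0 0 1 := by
  ext i j
  rw [clockZ, Matrix.diagonal_apply, pauli, Matrix.of_apply, add_zero, zero_add, one_mul]
  by_cases h : i = j
  · rw [if_pos h, if_pos h, h, ← rootPow_natCast, ZMod.natCast_zmod_val]
  · rw [if_neg h, if_neg h]

theorem exists_pauli_pow (k a b : ZMod p) (n : ℕ) :
    ∃ k', pauli k a b ^ n = pauli k' ((n : ZMod p) * a) ((n : ZMod p) * b) := by
  induction n with
  | zero => exact ⟨0, by simp [pauli_zero]⟩
  | succ n ih =>
    obtain ⟨k', h⟩ := ih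
    refine ⟨k' + k + n * b * a, ?_⟩
    rw [pow_succ, h, pauli_mul, Nat.cast_succ, add_one_mul, add_one_mul]

theorem shiftX_pow_mul_clockZ_pow (a b : ℕ) : shiftX p ^ a * clockZ p ^ b = pauli 0 a b := by
  have hX : ∀ a : ℕ, shiftX p ^ a = pauli 0 a 0 := fun a => by
    induction a with
    | zero => simp [pauli_zero]
    | succ n ih => rw [pow_succ, ih, shiftX_eq, pauli_mul]; simp
  have hZ : ∀ b : ℕ, clockZ p ^ b = pauli 0 0 b := fun b => by
    induction b with
    | zero => simp [pauli_zero]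
    | succ n ih => rw [pow_succ, ih, clockZ_eq, pauli_mul]; simp
  rw [hX, hZ, pauli_mul]
  simp

theorem isPauli_iff {P : Matrix (ZMod p) (ZMod p) ℂ} : IsPauli p P ↔ ∃ k a b, P = pauli k a b := by
  constructor
  · rintro ⟨k, a, b, rfl⟩
    exact ⟨_, _, _, by rw [shiftX_pow_mul_clockZ_pow, ← rootPow_natCast, rootPow_smul_pauli]⟩
  · rintro ⟨k, a, b, rfl⟩
    refine ⟨k.val, a.val, b.val, ?_⟩
    rw [shiftX_pow_mul_clockZ_pow, ← rootPow_natCast, rootPow_smul_pauli]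
    simp

/-- Schur's lemma for the Pauli group. -/
theorem eq_smul_one_of_commute {M : Matrix (ZMod p) (ZMod p) ℂ}
    (hX : M * shiftX p = shiftX p * M) (hZ : M * clockZ p = clockZ p * M) : M = M 0 0 • 1 := by
  rw [shiftX_eq] at hX
  rw [clockZ_eq] at hZ
  have h1 : ∀ i j, M i (j + 1) = M (i - 1) j := fun i j => by
    have h := congrFun (congrFun hX i) j
    rw [mul_pauli_apply, pauli_mul_apply] at h
    simpa [rootPow_zero] using h
  have h2 : ∀ i j, i ≠ j → M i j = 0 := fun i j hij => by
    have h := congrFun (congrFun hZ i) j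
    rw [mul_pauli_apply, pauli_mul_apply] at h
    simp only [zero_add, one_mul, add_zero, sub_zero] at h
    rw [mul_comm] at h
    by_contra hM
    exact hij (rootPow_injective (mul_right_cancel₀ hM h)).symm
  have h3 : ∀ n : ℕ, M n n = M 0 0 := fun n => by
    induction n with
    | zero => simp
    | succ n ih => rw [Nat.cast_succ, h1, add_sub_cancel_right, ih]
  ext i j
  rw [Matrix.smul_apply, Matrix.one_apply, smul_eq_mul]
  by_cases hij : i = j
  · subst hij
    have h := h3 i.val
    rw [ZMod.natCast_zmod_val] at h
    simp [h]
  · rw [h2 i j hij, if_neg hij, mul_zero]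

/-! ### The action of Clifford operators -/

/-- Affine symplectic transformations of the phase space of a qupit. -/
@[ext]
structure AffineSymp (p : ℕ) where
  k₁ : ZMod p
  a : ZMod p
  b : ZMod p
  k₂ : ZMod p
  c : ZMod p
  d : ZMod p
  det : a * d - b * c = 1

/-- The operator `U` acts on Pauli operators by the affine symplectic transformation `s`. -/
def ActsBy (U : Matrix (ZMod p) (ZMod p) ℂ) (s : AffineSymp p) : Prop :=
  U * shiftX p = pauli s.k₁ s.a s.b * U ∧ U * clockZ p = pauli s.k₂ s.c s.d * U

theorem ActsBy.smul {U : Matrix (ZMod p) (ZMod p) ℂ} {s : AffineSymp p} (h : ActsBy U s) (c : ℂ) :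
    ActsBy (c • U) s :=
  ⟨by rw [Matrix.smul_mul, h.1, Matrix.mul_smul], by rw [Matrix.smul_mul, h.2, Matrix.mul_smul]⟩

theorem ActsBy.eq {U : Matrix (ZMod p) (ZMod p) ℂ} (hU : U ∈ Matrix.unitaryGroup (ZMod p) ℂ)
    {s s' : AffineSymp p} (h : ActsBy U s) (h' : ActsBy U s') : s = s' := by
  have hc : ∀ A B : Matrix (ZMod p) (ZMod p) ℂ, A * U = B * U → A = B := fun A B e => by
    have e' := congrArg (· * Star.star U) e
    beta_reduce at e'
    rwa [Matrix.mul_assoc, Matrix.mul_assoc, Matrix.mem_unitaryGroup_iff.1 hU, Matrix.mul_one,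
      Matrix.mul_one] at e'
  obtain ⟨h1, h2, h3⟩ := pauli_injective (hc _ _ (h.1.symm.trans h'.1))
  obtain ⟨h4, h5, h6⟩ := pauli_injective (hc _ _ (h.2.symm.trans h'.2))
  exact AffineSymp.ext h1 h2 h3 h4 h5 h6

/-- The determinant condition expresses that conjugation preserves `Z X = ω X Z`: comparing phases
of the conjugated relation gives `a d - b c = 1`. -/
theorem IsClifford.exists_actsBy {U : Matrix (ZMod p) (ZMod p) ℂ} (hU : IsClifford p U) :
    ∃ s, ActsBy U s := by
  have hu : U.conjTranspose * U = 1 := Matrix.mem_unitaryGroup_iff'.1 hU.1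
  have hu' : U * U.conjTranspose = 1 := Matrix.mem_unitaryGroup_iff.1 hU.1
  obtain ⟨k₁, a, b, h1⟩ := isPauli_iff.1 (hU.2 _ (isPauli_iff.2 ⟨0, 1, 0, shiftX_eq⟩))
  obtain ⟨k₂, c, d, h2⟩ := isPauli_iff.1 (hU.2 _ (isPauli_iff.2 ⟨0, 0, 1, clockZ_eq⟩))
  have e1 : U * shiftX p = pauli k₁ a b * U := by
    rw [← h1, Matrix.mul_assoc, hu, Matrix.mul_one]
  have e2 : U * clockZ p = pauli k₂ c d * U := by
    rw [← h2, Matrix.mul_assoc, hu, Matrix.mul_one]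
  refine ⟨⟨k₁, a, b, k₂, c, d, ?_⟩, e1, e2⟩
  have e3 : clockZ p * shiftX p = rootPow (1 : ZMod p) • (shiftX p * clockZ p) := by
    rw [shiftX_eq, clockZ_eq, pauli_mul, pauli_mul, rootPow_smul_pauli]
    congr 1 <;> ring
  have e4 : pauli k₂ c d * pauli k₁ a b = rootPow (1 : ZMod p) • (pauli k₁ a b * pauli k₂ c d) := by
    have e5 := congrArg (fun A => U * A * U.conjTranspose) e3
    beta_reduce at e5
    rwa [Matrix.mul_smul, Matrix.smul_mul, ← Matrix.mul_assoc U, ← Matrix.mul_assoc U, e1, e2,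
      Matrix.mul_assoc _ U, Matrix.mul_assoc _ U, e1, e2, ← Matrix.mul_assoc, ← Matrix.mul_assoc,
      Matrix.mul_assoc _ U, Matrix.mul_assoc _ U, hu', Matrix.mul_one, Matrix.mul_one] at e5
  rw [pauli_mul, pauli_mul, rootPow_smul_pauli] at e4
  linear_combination (pauli_injective e4).1

theorem ActsBy.isClifford {U : Matrix (ZMod p) (ZMod p) ℂ} {s : AffineSymp p} (h : ActsBy U s)
    (hU : U ∈ Matrix.unitaryGroup (ZMod p) ℂ) : IsClifford p U := by
  refine ⟨hU, ?_⟩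
  have hu' : U * U.conjTranspose = 1 := Matrix.mem_unitaryGroup_iff.1 hU
  have hpow : ∀ {A B : Matrix (ZMod p) (ZMod p) ℂ}, U * A = B * U → ∀ n : ℕ, U * A ^ n = B ^ n * U := by
    intro A B e n
    exact (SemiconjBy.pow_right (show SemiconjBy U A B from e) n).eq
  rintro P ⟨k, a, b, rfl⟩
  rw [Matrix.mul_smul, Matrix.smul_mul, ← Matrix.mul_assoc, hpow h.1, Matrix.mul_assoc _ U,
    hpow h.2, Matrix.mul_assoc, Matrix.mul_assoc _ U, hu', Matrix.mul_one]
  obtain ⟨k₁, e1⟩ := exists_pauli_pow s.k₁ s.a s.b a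
  obtain ⟨k₂, e2⟩ := exists_pauli_pow s.k₂ s.c s.d b
  rw [e1, e2, pauli_mul, ← rootPow_natCast, rootPow_smul_pauli]
  exact isPauli_iff.2 ⟨_, _, _, rfl⟩

/-- If `U` and `V` intertwine two unitaries in the same way, then `U† V` commutes with the
first of them. -/
theorem conjTranspose_mul_self_commute {U A A' : Matrix (ZMod p) (ZMod p) ℂ}
    (hA : A ∈ Matrix.unitaryGroup (ZMod p) ℂ) (hA' : A' ∈ Matrix.unitaryGroup (ZMod p) ℂ)
    {V : Matrix (ZMod p) (ZMod p) ℂ} (h : U * A = A' * U) (h' : V * A = A' * V) :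
    U.conjTranspose * V * A = A * (U.conjTranspose * V) := by
  have h1 : A.conjTranspose * U.conjTranspose = U.conjTranspose * A'.conjTranspose := by
    rw [← Matrix.conjTranspose_mul, h, Matrix.conjTranspose_mul]
  have hA1 : A * A.conjTranspose = 1 := Matrix.mem_unitaryGroup_iff.1 hA
  have hA2 : A'.conjTranspose * A' = 1 := Matrix.mem_unitaryGroup_iff'.1 hA'
  have h2 : U.conjTranspose * A' = A * U.conjTranspose := by
    calc U.conjTranspose * A' = A * (A.conjTranspose * U.conjTranspose) * A' := by
          rw [← Matrix.mul_assoc, hA1, Matrix.one_mul]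
      _ = A * U.conjTranspose * (A'.conjTranspose * A') := by
          rw [h1]; simp only [Matrix.mul_assoc]
      _ = A * U.conjTranspose := by rw [hA2, Matrix.mul_one]
  rw [Matrix.mul_assoc, h', ← Matrix.mul_assoc, h2, Matrix.mul_assoc]

/-- Neither operator is assumed unitary, so the case `U = V` can be used to normalise an operator
given only up to scale. -/
theorem ActsBy.exists_conjTranspose_mul {U V : Matrix (ZMod p) (ZMod p) ℂ} {s : AffineSymp p}
    (hU : ActsBy U s) (hV : ActsBy V s) :
    U.conjTranspose * V = (U.conjTranspose * V) 0 0 • 1 :=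
  eq_smul_one_of_commute
    (conjTranspose_mul_self_commute (shiftX_eq (p := p) ▸ pauli_mem_unitaryGroup _ _ _)
      (pauli_mem_unitaryGroup _ _ _) hU.1 hV.1)
    (conjTranspose_mul_self_commute (clockZ_eq (p := p) ▸ pauli_mem_unitaryGroup _ _ _)
      (pauli_mem_unitaryGroup _ _ _) hU.2 hV.2)

/-- By Schur's lemma the two differ by a scalar; equal determinants make it a `p`-th root of unity.
-/
theorem ActsBy.eq_smul {U V : Matrix (ZMod p) (ZMod p) ℂ} {s : AffineSymp p}
    (hU : ActsBy U s) (hV : ActsBy V s) (hU' : U ∈ Matrix.specialUnitaryGroup (ZMod p) ℂ)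
    (hV' : V ∈ Matrix.specialUnitaryGroup (ZMod p) ℂ) : ∃ t : ℤ, V = omega p ^ t • U := by
  obtain ⟨hU1, hU2⟩ := Matrix.mem_specialUnitaryGroup_iff.1 hU'
  obtain ⟨hV1, hV2⟩ := Matrix.mem_specialUnitaryGroup_iff.1 hV'
  have hu' : U * U.conjTranspose = 1 := Matrix.mem_unitaryGroup_iff.1 hU1
  have h := hU.exists_conjTranspose_mul hV
  generalize (U.conjTranspose * V) 0 0 = c at h
  have e : V = c • U := by
    calc V = U * (U.conjTranspose * V) := by rw [← Matrix.mul_assoc, hu', Matrix.one_mul]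
      _ = c • U := by rw [h, Matrix.mul_smul, Matrix.mul_one]
  rw [e, Matrix.det_smul, hU2, mul_one, ZMod.card] at hV2
  obtain ⟨t, -, ht⟩ := (isPrimitiveRoot_omega (p := p)).eq_pow_of_pow_eq_one hV2
  exact ⟨t, by rw [e, ← ht, zpow_natCast]⟩

/-- A nonzero operator with given action can be rescaled to a special unitary one. -/
theorem ActsBy.exists_specialUnitary {U : Matrix (ZMod p) (ZMod p) ℂ} {s : AffineSymp p}
    (hU : ActsBy U s) {i : ZMod p} (hi : U i 0 ≠ 0) :
    ∃ V, V ∈ Matrix.specialUnitaryGroup (ZMod p) ℂ ∧ ActsBy V s := by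
  have hp : p ≠ 0 := (Fact.out : p.Prime).ne_zero
  have h := hU.exists_conjTranspose_mul hU
  -- The matrix `U†U` is scalar by Schur's lemma. Its value is the squared norm of column 0,
  -- positive because that column has a nonzero entry.
  obtain ⟨r, hr, hr'⟩ : ∃ r : ℝ, 0 < r ∧ (U.conjTranspose * U) 0 0 = r := by
    refine ⟨∑ j, Complex.normSq (U j 0), Finset.sum_pos' (fun j _ => Complex.normSq_nonneg _)
      ⟨i, Finset.mem_univ _, Complex.normSq_pos.2 hi⟩, ?_⟩
    rw [Matrix.mul_apply, Complex.ofReal_sum]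
    refine Finset.sum_congr rfl fun j _ => ?_
    rw [Matrix.conjTranspose_apply, Complex.normSq_eq_conj_mul_self]
    rfl
  rw [hr'] at h
  have hd := congrArg Matrix.det h
  rw [Matrix.det_mul, Matrix.det_smul, Matrix.det_one, mul_one, ZMod.card] at hd
  have hd0 : U.det ≠ 0 := fun h0 => by
    rw [h0, mul_zero] at hd
    exact hr.ne' (by exact_mod_cast (pow_eq_zero_iff hp).1 hd.symm)
  -- A `p`-th root of `det⁻¹` normalises the determinant. Unitarity follows: the nonnegative real
  -- scalar of the rescaled Gram matrix has `p`-th power 1.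
  obtain ⟨c, hc⟩ := IsAlgClosed.exists_pow_nat_eq (U.det)⁻¹ (Nat.pos_of_ne_zero hp)
  have hV : (c • U).det = 1 := by
    rw [Matrix.det_smul, ZMod.card, hc, inv_mul_cancel₀ hd0]
  have hVV : (c • U).conjTranspose * (c • U) = ((Complex.normSq c * r : ℝ) : ℂ) • 1 := by
    rw [Matrix.conjTranspose_smul, Matrix.smul_mul, Matrix.mul_smul, h, smul_smul, smul_smul,
      Complex.ofReal_mul, Complex.normSq_eq_conj_mul_self, starRingEnd_apply, mul_assoc]
  have h1 : (Complex.normSq c * r) ^ p = 1 := by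
    have h2 := congrArg Matrix.det hVV
    rw [Matrix.det_mul, Matrix.det_conjTranspose, hV, Matrix.det_smul, Matrix.det_one, mul_one,
      mul_one, star_one, ZMod.card] at h2
    exact_mod_cast h2.symm
  have h2 : Complex.normSq c * r = 1 :=
    (pow_eq_one_iff_of_nonneg (mul_nonneg (Complex.normSq_nonneg _) hr.le) hp).1 h1
  refine ⟨c • U, Matrix.mem_specialUnitaryGroup_iff.2 ⟨Matrix.mem_unitaryGroup_iff'.2 ?_, hV⟩,
    hU.smul c⟩
  rw [Matrix.star_eq_conjTranspose, hVV, h2, Complex.ofReal_one, one_smul]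

end PauliOperators
end QupitZX

/-! ### Realisation of all affine symplectic transformations and the order of the Clifford group. -/

namespace QupitZX
section CliffordCount

variable {p : ℕ}

/-! ### Phases -/

/-- Treats both residues of `p` modulo 4 at once: only a nonzero generator besides `ω` matters. -/
theorem exists_phases_eq : ∃ g : ℂ, g ≠ 0 ∧
    phases p = {c | ∃ s t : ℤ, c = g ^ s * omega p ^ t} := by
  unfold phases
  split_ifs
  · exact ⟨-1, by norm_num, rfl⟩
  · exact ⟨Complex.I, Complex.I_ne_zero, rfl⟩

theorem omega_zpow_mem_phases (t : ℤ) : omega p ^ t ∈ phases p := by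
  obtain ⟨g, -, h⟩ := exists_phases_eq (p := p)
  rw [h]
  exact ⟨0, t, by simp⟩

theorem one_mem_phases : (1 : ℂ) ∈ phases p := by
  simpa using omega_zpow_mem_phases (p := p) 0

theorem omega_ne_zero : omega p ≠ 0 := Complex.exp_ne_zero _

theorem mul_mem_phases {c d : ℂ} (hc : c ∈ phases p) (hd : d ∈ phases p) : c * d ∈ phases p := by
  obtain ⟨g, hg, h⟩ := exists_phases_eq (p := p)
  rw [h] at hc hd ⊢
  obtain ⟨s, t, rfl⟩ := hc
  obtain ⟨s', t', rfl⟩ := hd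
  exact ⟨s + s', t + t', by rw [zpow_add₀ hg, zpow_add₀ omega_ne_zero]; ring⟩

theorem inv_mem_phases {c : ℂ} (hc : c ∈ phases p) : c⁻¹ ∈ phases p := by
  obtain ⟨g, hg, h⟩ := exists_phases_eq (p := p)
  rw [h] at hc ⊢
  obtain ⟨s, t, rfl⟩ := hc
  exact ⟨-s, -t, by rw [mul_inv, zpow_neg, zpow_neg]⟩

theorem ne_zero_of_mem_phases {c : ℂ} (hc : c ∈ phases p) : c ≠ 0 := by
  obtain ⟨g, hg, h⟩ := exists_phases_eq (p := p)
  rw [h] at hc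
  obtain ⟨s, t, rfl⟩ := hc
  exact mul_ne_zero (zpow_ne_zero _ hg) (zpow_ne_zero _ omega_ne_zero)

theorem phaseClass_smul {c : ℂ} (hc : c ∈ phases p) (U : Matrix (ZMod p) (ZMod p) ℂ) :
    {V | ∃ d ∈ phases p, V = d • (c • U)} = {V | ∃ d ∈ phases p, V = d • U} := by
  ext V
  constructor
  · rintro ⟨d, hd, rfl⟩
    exact ⟨d * c, mul_mem_phases hd hc, smul_smul _ _ _⟩
  · rintro ⟨d, hd, rfl⟩
    refine ⟨d * c⁻¹, mul_mem_phases hd (inv_mem_phases hc), ?_⟩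
    rw [smul_smul, inv_mul_cancel_right₀ (ne_zero_of_mem_phases hc)]

variable [Fact p.Prime]

/-! ### Existence of operators with given action -/

/-- The image of `Z` fixes a nonzero vector. -/
theorem exists_fixed_vector (hp : p ≠ 2) (s : AffineSymp p) : ∃ v : ZMod p → ℂ, (∃ i, v i ≠ 0) ∧
    ∀ j, rootPow (s.k₂ + s.d * (j - s.c)) * v (j - s.c) = v j := by
  obtain ⟨k₁, a, b, k₂, c, d, h⟩ := s
  dsimp only
  -- For `c = 0` the image of `Z` is diagonal and fixes the basis vector at the zero of `k₂ + d j`.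
  -- For `c ≠ 0` a vector with entries `ω ^ (x j² + y j)` is fixed once the coefficients of `j` and
  -- of 1 match.
  by_cases hc : c = 0
  · subst hc
    have hd : d ≠ 0 := fun hd => by simp [hd] at h
    refine ⟨fun j => if j = -k₂ / d then 1 else 0, ⟨-k₂ / d, by simp⟩, fun j => ?_⟩
    rw [sub_zero]
    dsimp only
    split_ifs with hj
    · rw [hj, mul_div_cancel₀ _ hd, add_neg_cancel, rootPow_zero, one_mul]
    · rw [mul_zero]
  · have h2 := two_ne_zero_of_ne_two hp
    obtain ⟨x, hx⟩ : ∃ x, 2 * x * c = d := ⟨d / (2 * c), by field_simp⟩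
    obtain ⟨y, hy⟩ : ∃ y, x * c ^ 2 + y * c = k₂ := ⟨(k₂ - x * c ^ 2) / c, by field_simp; ring⟩
    refine ⟨fun j => rootPow (x * j ^ 2 + y * j), ⟨0, rootPow_ne_zero _⟩, fun j => ?_⟩
    dsimp only
    rw [← rootPow_add, ← hx, ← hy]
    congr 1
    ring

/-- Every affine symplectic transformation is the action of an operator (Stone–von Neumann). -/
theorem exists_actsBy (hp : p ≠ 2) (s : AffineSymp p) :
    ∃ V, V ∈ Matrix.specialUnitaryGroup (ZMod p) ℂ ∧ ActsBy V s := by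
  obtain ⟨v, ⟨i, hi⟩, hv⟩ := exists_fixed_vector hp s
  obtain ⟨k₁, a, b, k₂, c, d, h⟩ := s
  dsimp only at hv
  have h2 := two_ne_zero_of_ne_two hp
  -- Column `m` is the `m`-th power of the image of `X` applied to the fixed vector. The closed
  -- formula for that power is polynomial in `m` over `ZMod p`, so it is automatically periodic.
  refine ActsBy.exists_specialUnitary (U := Matrix.of fun i m =>
    rootPow (m * k₁ + 2⁻¹ * a * b * m * (m - 1) + m * b * (i - m * a)) * v (i - m * a)) ⟨?_, ?_⟩
    (i := i) ?_
  · ext i m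
    rw [shiftX_eq, mul_pauli_apply, pauli_mul_apply]
    simp only [Matrix.of_apply]
    rw [zero_mul, add_zero, rootPow_zero, mul_one, ← mul_assoc, ← rootPow_add,
      show i - (m + 1) * a = i - a - m * a by ring]
    congr 2
    field_simp
    ring
  · ext i m
    rw [clockZ_eq, mul_pauli_apply, pauli_mul_apply]
    simp only [Matrix.of_apply]
    rw [add_zero, zero_add, one_mul, ← mul_assoc, ← rootPow_add, ← hv (i - m * a), ← mul_assoc,
      mul_right_comm, mul_assoc, mul_assoc, mul_left_comm, ← mul_assoc, ← mul_assoc,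
      ← rootPow_add, ← rootPow_add, show i - c - m * a = i - m * a - c by ring]
    congr 2
    -- The determinant condition supplies the eigenvalue `ω ^ m` of the image of `Z` on column `m`.
    linear_combination -m * h
  · simpa [rootPow_zero] using hi

/-- The affine symplectic transformations are counted by the normal forms. -/
def NormalForm.toAffineSymp : NormalForm p → AffineSymp p
  | .first s t u v w => ⟨s, w, t, u, v, (w⁻¹ : (ZMod p)ˣ) * (1 + t * v), by
      rw [← mul_assoc, Units.mul_inv, one_mul, add_sub_cancel_right]⟩
  | .second s u v w => ⟨s, 0, w, u, -((w⁻¹ : (ZMod p)ˣ) : ZMod p), v, by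
      rw [mul_neg, Units.mul_inv, zero_mul, zero_sub, neg_neg]⟩

/-- Used only for counting. If `a ≠ 0`, then `a`, `b`, `c` are free and determine `d`; if `a = 0`,
then `b` is a unit that determines `c`, and `d` is free. -/
theorem NormalForm.toAffineSymp_bijective :
    Function.Bijective (NormalForm.toAffineSymp : NormalForm p → AffineSymp p) := by
  constructor
  · rintro (⟨s, t, u, v, w⟩ | ⟨s, u, v, w⟩) (⟨s', t', u', v', w'⟩ | ⟨s', u', v', w'⟩) h <;>
      simp only [NormalForm.toAffineSymp, AffineSymp.mk.injEq] at h
    · obtain ⟨rfl, h2, rfl, rfl, rfl, -⟩ := h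
      rw [Units.ext h2]
    · exact absurd h.2.1 w.ne_zero
    · exact absurd h.2.1.symm w'.ne_zero
    · obtain ⟨rfl, -, h2, rfl, -, rfl⟩ := h
      rw [Units.ext h2]
  · rintro ⟨k₁, a, b, k₂, c, d, h⟩
    by_cases ha : a = 0
    · subst ha
      have hbc : b * -c = 1 := by linear_combination h
      refine ⟨.second k₁ k₂ d ⟨b, -c, hbc, (mul_comm _ _).trans hbc⟩, ?_⟩
      simp [NormalForm.toAffineSymp]
    · refine ⟨.first k₁ b k₂ c (Units.mk0 a ha), ?_⟩
      simp only [NormalForm.toAffineSymp, AffineSymp.mk.injEq, Units.val_mk0, true_and,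
        Units.val_inv_eq_inv_val]
      field_simp
      linear_combination -h

theorem AffineSymp.card : Nat.card (AffineSymp p) = p ^ 3 * (p ^ 2 - 1) := by
  rw [← NormalForm.card, Nat.card_congr (Equiv.ofBijective _ NormalForm.toAffineSymp_bijective)]

/-- The order of the reduced single-qupit Clifford group modulo its scalars. -/
theorem ncard_cliffordModScalars (hp : p ≠ 2) :
    (cliffordModScalars p).ncard = p ^ 3 * (p ^ 2 - 1) := by
  choose U hU hUs using exists_actsBy (p := p) hp
  have hu : ∀ s, U s ∈ Matrix.unitaryGroup (ZMod p) ℂ := fun s =>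
    (Matrix.mem_specialUnitaryGroup_iff.1 (hU s)).1
  let f : AffineSymp p → Set (Matrix (ZMod p) (ZMod p) ℂ) := fun s => {V | ∃ c ∈ phases p, V = c • U s}
  have hf : Function.Injective f := fun s s' h => by
    have h1 : U s ∈ f s := ⟨1, one_mem_phases, (one_smul _ _).symm⟩
    rw [h] at h1
    obtain ⟨c, -, hc⟩ := h1
    exact (hUs s).eq (hu s) (hc ▸ (hUs s').smul c)
  have hr : cliffordModScalars p = Set.range f := by
    ext S
    constructor
    · rintro ⟨_, ⟨c, hc, V, hV, hV', rfl⟩, rfl⟩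
      obtain ⟨s, hs⟩ := hV.exists_actsBy
      -- The chosen operator with the same action differs by a power of `ω`, which is a phase, so
      -- the classes coincide.
      obtain ⟨t, rfl⟩ := (hUs s).eq_smul hs (hU s) hV'
      refine ⟨s, ?_⟩
      dsimp only
      rw [phaseClass_smul hc, phaseClass_smul (omega_zpow_mem_phases t)]
    · rintro ⟨s, rfl⟩
      exact ⟨U s, ⟨1, one_mem_phases, U s, (hUs s).isClifford (hu s), hU s, (one_smul _ _).symm⟩, rfl⟩
  rw [hr, ← AffineSymp.card, ← Nat.card_range_of_injective hf, Nat.card_coe_set_eq]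

end CliffordCount
end QupitZX

theorem mainTheorem8 (p : ℕ) [Fact p.Prime] (hp : p ≠ 2) :
    (∀ A : QupitZX.Diag p 1 1, QupitZX.IsC1 p A →
      ∃! N : QupitZX.NormalForm p, QupitZX.EqUpToScalar p A N.toDiag) ∧
    Nat.card (QupitZX.NormalForm p) = p ^ 3 * (p ^ 2 - 1) ∧
    (QupitZX.cliffordModScalars p).ncard = p ^ 3 * (p ^ 2 - 1) :=
  ⟨fun _ hA => QupitZX.existsUnique_normalForm hp hA, QupitZX.NormalForm.card,
    QupitZX.ncard_cliffordModScalars hp⟩
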